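/- Let $n,d\ge 1$ be integers and let $K:[-1,1]\to[0,1]$. Let $x_1,\dots,x_n$ be i.i.d. uniform on the unit sphere $S^{d-1}\subset\mathbb R^d$; given $x_1,\dots,x_n$, let the edge indicators $A=(A_{ij})_{1\le i<j\le n}$ be independent with $A_{ij}\sim\mathrm{Bernoulli}(K(\langle x_i,x_j\rangle))$. Let $p=\mathbb E[K(\langle x,y\rangle)]$ for $x,y$ i.i.d. uniform on $S^{d-1}$, assume $0<p<1$, and let $\kappa(t)=\frac{K(t)-p}{\sqrt{p(1-p)}}$ for $t\in[-1,1]$ be the standardized kernel. Let $X\in\mathbb R^{n\times n}$ be given by $X_{ij}=\langle x_i,x_j\rangle$ for $i\ne j$ and $X_{ii}=0$, and let $\tilde X$ be a fresh draw from the posterior distribution of $X$ given $A$ (that is, given $A$, $\tilde X$ has the conditional law of $X$ given $A$ and is independent of $(x_1,\dots,x_n)$). Write $\langle\tilde X,X\rangle=\sum_{i,j}\tilde X_{ij}X_{ij}$. For every constant $D>0$ there is a constant $C>0$ depending only on $D$ such that, for all $n,d,K$ as above, the following two statements hold. (a) (Polynomial kernels.) Suppose that $\kappa(t)=\sum_{\ell=0}^L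 b_\ell t^\ell$ on $[-1,1]$ for some $L\ge 0$, where for some $B>0$ and $r>0$ $$|b_\ell|\le \frac{B r^\ell}{\sqrt{\ell!}}\quad(1\le \ell\le L),\qquad |b_0|\le \frac{Br^2}{d}.$$ If $$d\ge C\Big(B^2r^2+n^{1/2}Br^{3/2}+n^{1/2}(B+B^{1/2})r+n^{1/3}(B^{4/3}+B^{2/3})r^{4/3}+\log n+r^2(\log n)^3\Big),$$ then $$\mathbb P\Big(\langle\tilde X,X\rangle\ge \delta\,\frac{n^2}{d}\Big)\le n^{-D},\qquad \delta=C\max\Big\{\frac{B(B+1)r^2}{d},\frac{(\log n)^{1/2}}{n}\Big\}.$$ (b) (Linear kernels.) Suppose that $\kappa(t)=b_1t$ on $[-1,1]$ with $b_1\in\mathbb R$. If $$d\ge C\Big(n^{1/2}|b_1|+n^{1/3}|b_1|^{4/3}+\log n\Big),$$ then $$\mathbb P\Big(\langle\tilde X,X\rangle\ge \delta\,\frac{n^2}{d}\Big)\le n^{-D},\qquad \delta=C\max\Big\{\frac{b_1^2}{d},\frac{(\log n)^{1/2}}{n}\Big\}.$$ -/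

import Mathlib

open MeasureTheory ProbabilityTheory

noncomputable section

namespace RGG

/-- The unit sphere `S^{d-1}` in `ℝ^d`. -/
abbrev Sph (d : ℕ) : Type := Metric.sphere (0 : EuclideanSpace ℝ (Fin d)) 1

/-- The uniform distribution on `S^{d-1}`: normalized surface measure. -/
def sphereUnif (d : ℕ) : Measure (Sph d) :=
  ((volume : Measure (EuclideanSpace ℝ (Fin d))).toSphere Set.univ)⁻¹ •
    (volume : Measure (EuclideanSpace ℝ (Fin d))).toSphere

instance instIsFiniteMeasureSphereUnif (d : ℕ) : IsFiniteMeasure (sphereUnif d) := by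
  refine ⟨?_⟩
  simp only [sphereUnif, Measure.smul_apply, smul_eq_mul]
  exact lt_of_le_of_lt (ENNReal.inv_mul_le_one _) ENNReal.one_lt_top

/-- The inner product of two points of the unit sphere, as an element of `[-1,1]`. -/
def sphInner {d : ℕ} (x y : Sph d) : Set.Icc (-1 : ℝ) 1 :=
  ⟨inner ℝ (x : EuclideanSpace ℝ (Fin d)) (y : EuclideanSpace ℝ (Fin d)), by
    have h := abs_real_inner_le_norm (x : EuclideanSpace ℝ (Fin d))
      (y : EuclideanSpace ℝ (Fin d))
    rw [norm_eq_of_mem_sphere x, norm_eq_of_mem_sphere y, one_mul] at h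
    exact abs_le.mp h⟩

/-- The pairs `(i, j)` with `i < j`. -/
abbrev Pairs (n : ℕ) : Type := {e : Fin n × Fin n // e.1 < e.2}

/-- A graph on `n` vertices, recorded by its edge indicators `(A_{ij})_{i<j}`. -/
abbrev Graph (n : ℕ) : Type := Pairs n → Bool

/-- The law of the latent points: `x_1, …, x_n` i.i.d. uniform on `S^{d-1}`. -/
def latentLaw (n d : ℕ) : Measure (Fin n → Sph d) :=
  Measure.pi fun _ => sphereUnif d

instance instIsFiniteMeasureLatentLaw (n d : ℕ) : IsFiniteMeasure (latentLaw n d) := by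
  unfold latentLaw; infer_instance

/-- The conditional probability of the graph `a` given the latent points `x`: the pairs are
connected independently, the pair `(i, j)` with probability `K ⟨x_i, x_j⟩`. -/
def likelihood {n d : ℕ} (K : Set.Icc (-1 : ℝ) 1 → unitInterval) (x : Fin n → Sph d)
    (a : Graph n) : ℝ :=
  ∏ e : Pairs n,
    if a e then (K (sphInner (x e.1.1) (x e.1.2)) : ℝ)
    else 1 - (K (sphInner (x e.1.1) (x e.1.2)) : ℝ)

/-- The joint law of the latent points and the graph `A` in the random geometric graph model
with kernel `K`: the density of `(x, A)` with respect to (law of `x`) × (counting measure)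
is the conditional probability of `A` given `x`. -/
def rggLaw (n d : ℕ) (K : Set.Icc (-1 : ℝ) 1 → unitInterval) :
    Measure ((Fin n → Sph d) × Graph n) :=
  ((latentLaw n d).prod Measure.count).withDensity
    fun w => ENNReal.ofReal (likelihood K w.1 w.2)

theorem likelihood_le_one {n d : ℕ} (K : Set.Icc (-1 : ℝ) 1 → unitInterval)
    (x : Fin n → Sph d) (a : Graph n) : likelihood K x a ≤ 1 := by
  unfold likelihood
  refine Finset.prod_le_one (fun e _ => ?_) (fun e _ => ?_)
  · split_ifs
    · exact (K _).2.1
    · exact sub_nonneg.mpr (K _).2.2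
  · split_ifs
    · exact (K _).2.2
    · exact sub_le_self _ (K _).2.1

instance instIsFiniteMeasureRggLaw (n d : ℕ) (K : Set.Icc (-1 : ℝ) 1 → unitInterval) :
    IsFiniteMeasure (rggLaw n d K) := by
  unfold rggLaw
  refine isFiniteMeasure_withDensity (ne_of_lt ?_)
  calc ∫⁻ w, ENNReal.ofReal (likelihood K w.1 w.2) ∂((latentLaw n d).prod Measure.count)
      ≤ ∫⁻ _, 1 ∂((latentLaw n d).prod (Measure.count : Measure (Graph n))) :=
        lintegral_mono fun w => ENNReal.ofReal_le_one.mpr (likelihood_le_one K w.1 w.2)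
    _ < ⊤ := by simp [measure_lt_top]

/-- The matrix `X` with `X_{ij} = ⟨x_i, x_j⟩` for `i ≠ j` and zero diagonal. -/
def gram {n d : ℕ} (x : Fin n → Sph d) : Fin n → Fin n → ℝ :=
  fun i j => if i = j then 0 else (sphInner (x i) (x j) : ℝ)

/-- The posterior distribution `μ_A` of `X` conditional on `A`. -/
def posteriorLaw (n d : ℕ) (K : Set.Icc (-1 : ℝ) 1 → unitInterval) :
    Kernel (Graph n) (Fin n → Fin n → ℝ) :=
  condDistrib (fun w : (Fin n → Sph d) × Graph n => gram w.1)
    (fun w : (Fin n → Sph d) × Graph n => w.2) (rggLaw n d K)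

/-- The joint law of `((x, A), X̃)`, where `X̃` is a fresh draw from the posterior `μ_A`
(conditionally on `A`, independent of `x`). -/
def replicaLaw (n d : ℕ) (K : Set.Icc (-1 : ℝ) 1 → unitInterval) :
    Measure (((Fin n → Sph d) × Graph n) × (Fin n → Fin n → ℝ)) :=
  (rggLaw n d K) ⊗ₘ ((posteriorLaw n d K).comap Prod.snd measurable_snd)

/-- The entrywise (Frobenius) inner product of two matrices. -/
def frobInner {n : ℕ} (M N : Fin n → Fin n → ℝ) : ℝ := ∑ i, ∑ j, M i j * N i j

/-- The event `⟨X̃, X⟩ ≥ s`. -/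
def overlapEvent (n d : ℕ) (s : ℝ) :
    Set (((Fin n → Sph d) × Graph n) × (Fin n → Fin n → ℝ)) :=
  {w | s ≤ frobInner w.2 (gram w.1.1)}

/-- The edge density `p = E[K ⟨x_1, x_2⟩]`. -/
def edgeDensity (d : ℕ) (K : Set.Icc (-1 : ℝ) 1 → unitInterval) : ℝ :=
  ∫ z : Sph d × Sph d, (K (sphInner z.1 z.2) : ℝ) ∂((sphereUnif d).prod (sphereUnif d))

/-- The standardized kernel `κ(t) = (K(t) - p) / √(p (1 - p))`. -/
def stdKernel (d : ℕ) (K : Set.Icc (-1 : ℝ) 1 → unitInterval) (t : Set.Icc (-1 : ℝ) 1) : ℝ :=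
  ((K t : ℝ) - edgeDensity d K) / Real.sqrt (edgeDensity d K * (1 - edgeDensity d K))

end RGG

end

/-!
The posterior overlap is bounded by a second moment computation. Let `ℙ₀` be the law of the
Erdős–Rényi graph with edge density `p`. For graphs whose likelihood ratio with respect to `ℙ₀` is
at least `ε`, the normalization of the posterior costs at most a factor `ε⁻¹`; the remaining graphs
have total probability at most `ε`. Hence, for every set `G` of latent points, the probability of
the overlap event is at most
`ε + 2 P(Gᶜ) + ε⁻¹ E[1_{x, y ∈ G} 1_{⟨X, Y⟩ ≥ s} ∏ (1 + κ(⟨x_i, x_j⟩) κ(⟨y_i, y_j⟩))]`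
for independent latent points `x` and `y` (`replicaLaw_overlapEvent_le`).

The product is at most `exp (∑_{i < j} κ κ)`. The kernel is split into its linear part `β t` and a
remainder `g`; the indicator of the overlap event is at most `exp (η (⟨X, Y⟩ - s))`. This leaves
four exponents: the Gram overlap `⟨X, Y⟩`, two cross terms between a Gram matrix and a matrix of
remainders, and a product of two matrices of remainders. On a set `G` of typical points, where the
spectral norm, the entries and the fourth moment of the Gram matrix have their usual size
(`latentLaw_not_isTypical_le`), the last exponent is bounded deterministically, and each of the
others is a chaos `θ ∑ M_ij ⟨y_i, y_j⟩` in the points of one of the two configurations, whose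
matrix `M` is fixed by the other one. Its exponential moment is at most `exp (128 θ² ‖M‖_F² / d)`
as long as `|θ| ‖M‖ ≤ d / 32` (`lintegral_exp_chaos_latentLaw`). The result is
`truncated_second_moment_le`.

The bound for the chaos comes from Gaussian vectors. A standard Gaussian vector is the product of
its norm and an independent uniform direction, so by Jensen's inequality, applied to the integral
over the norms, exponential moments of a chaos without diagonal can only grow when the directions
are replaced by Gaussian vectors (after rescaling by the mean norm, of order `√d`). For Gaussian
vectors the chaos is a trace-free quadratic form, which is diagonalized.

With `η = Q + √(log n) d / n`, where `Q` bounds `β²` and the size of the remainder, all positive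
exponents are of order `(η n / d)²`, and they are beaten by `η s` when `s` is a large multiple of
`max (Q / d) (√(log n) / n) n² / d` (`exists_replicaLaw_overlapEvent_le`). Polynomial kernels are
covered by `Q = B (B + 1) r²`, linear kernels by `Q = b₁²` without remainder.
-/

namespace RGG

/-! ### Quadratic forms in Gaussian vectors -/

theorem lintegral_pi_prod {ι : Type*} [Fintype ι] {α : ι → Type*} [∀ i, MeasurableSpace (α i)]
    (μ : ∀ i, Measure (α i)) [∀ i, IsProbabilityMeasure (μ i)] (f : ∀ i, α i → ENNReal)
    (hf : ∀ i, Measurable (f i)) :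
    ∫⁻ x, ∏ i, f i (x i) ∂(Measure.pi μ) = ∏ i, ∫⁻ x, f i x ∂(μ i) := by
  have h := lintegral_prod_eq_prod_lintegral_of_indepFun (μ := Measure.pi μ) Finset.univ
    (fun i (x : ∀ i, α i) => f i (x i))
    (iIndepFun_pi (X := fun i => f i) fun i => (hf i).aemeasurable)
    (fun i => (hf i).comp (measurable_pi_apply i))
  rw [h]
  refine Finset.prod_congr rfl fun i _ => ?_
  exact (measurePreserving_eval μ i).lintegral_comp (hf i)

/-- The moment generating function `(1 - 2 a) ^ (-1 / 2)` of the square of a standard Gaussian, with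
the second-order bound that remains after subtracting its mean. -/
theorem inv_one_sub_le_exp {a : ℝ} (ha : |a| ≤ 1 / 4) :
    (1 - 2 * a)⁻¹ ≤ Real.exp (a + 2 * a ^ 2) ^ 2 := by
  rw [abs_le] at ha
  have h1 : 0 < 1 - 2 * a := by linarith
  rw [← Real.exp_nat_mul, inv_le_iff_one_le_mul₀ h1]
  push_cast
  rcases le_total 0 a with h | h
  · have h2 := Real.quadratic_le_exp_of_nonneg (x := 2 * (a + 2 * a ^ 2)) (by positivity)
    refine le_trans ?_ (mul_le_mul_of_nonneg_right h2 h1.le)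
    nlinarith [mul_nonneg h h, mul_nonneg (mul_nonneg h h) h,
      mul_nonneg (mul_nonneg h h) (by linarith : (0 : ℝ) ≤ 1 / 4 - a),
      mul_nonneg (mul_nonneg (mul_nonneg h h) h) (by linarith : (0 : ℝ) ≤ 1 / 4 - a),
      mul_nonneg (mul_nonneg (mul_nonneg (mul_nonneg h h) h) h) (by linarith : (0 : ℝ) ≤ 1 / 4 - a)]
  · obtain ⟨v, rfl⟩ : ∃ v, a = -v := ⟨-a, by ring⟩
    have hv : 0 ≤ v := by linarith
    have h3 : Real.exp (2 * v - 4 * v ^ 2) ≤ 1 + 2 * v := by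
      have h4 : |2 * v - 4 * v ^ 2| ≤ 1 := by
        rw [abs_le]; constructor <;> nlinarith
      have h5 := (abs_le.1 (Real.abs_exp_sub_one_sub_id_le h4)).2
      nlinarith [mul_nonneg (mul_nonneg hv hv) (mul_nonneg hv (by linarith : (0:ℝ) ≤ 1 - v))]
    have h6 : Real.exp (2 * (-v + 2 * (-v) ^ 2)) * Real.exp (2 * v - 4 * v ^ 2) = 1 := by
      rw [← Real.exp_add, ← Real.exp_zero]; congr 1; ring
    calc 1 = _ := h6.symm
      _ ≤ _ := by
        refine mul_le_mul_of_nonneg_left ?_ (Real.exp_pos _).le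
        linarith

theorem lintegral_exp_mul_sq_gaussianReal {a : ℝ} (ha : |a| ≤ 1 / 4) :
    ∫⁻ z, ENNReal.ofReal (Real.exp (a * z ^ 2)) ∂(gaussianReal 0 1)
      ≤ ENNReal.ofReal (Real.exp (a + 2 * a ^ 2)) := by
  have ha' := abs_le.1 ha
  have hb : 0 < 1 / 2 - a := by linarith
  rw [gaussianReal_of_var_ne_zero _ one_ne_zero,
    lintegral_withDensity_eq_lintegral_mul _ (measurable_gaussianPDF _ _) (by fun_prop)]
  have h1 : ∀ z : ℝ, (gaussianPDF 0 1 * fun z => ENNReal.ofReal (Real.exp (a * z ^ 2))) z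
      = ENNReal.ofReal ((√(2 * Real.pi))⁻¹ * Real.exp (-(1 / 2 - a) * z ^ 2)) := by
    intro z
    simp only [Pi.mul_apply, gaussianPDF, gaussianPDFReal]
    rw [← ENNReal.ofReal_mul (by positivity)]
    congr 1
    simp only [NNReal.coe_one, mul_one, sub_zero]
    rw [mul_assoc, ← Real.exp_add]
    congr 2; ring
  simp_rw [h1]
  rw [← ofReal_integral_eq_lintegral_ofReal ((integrable_exp_neg_mul_sq hb).const_mul _)
    (Filter.Eventually.of_forall fun z => by positivity)]
  refine ENNReal.ofReal_le_ofReal ?_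
  rw [integral_const_mul, integral_gaussian, ← Real.sqrt_inv, ← Real.sqrt_mul (by positivity)]
  refine Real.sqrt_le_iff.2 ⟨(Real.exp_pos _).le, le_trans (le_of_eq ?_) (inv_one_sub_le_exp ha)⟩
  have : 1 - 2 * a ≠ 0 := by linarith
  have : 1 / 2 - a ≠ 0 := by linarith
  field_simp

theorem measurable_exp_quadratic {E : Type*} [NormedAddCommGroup E]
    [InnerProductSpace ℝ E] [FiniteDimensional ℝ E] [MeasurableSpace E] [BorelSpace E]
    (T : E →ₗ[ℝ] E) : Measurable fun x => ENNReal.ofReal (Real.exp (inner ℝ x (T x))) := by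
  have hTc : Continuous T := T.continuous_of_finiteDimensional
  fun_prop

/-- Moment generating function of a trace-free Gaussian quadratic form, in the range where the
form is at most a quarter of the squared norm. In an eigenbasis of `T` the form is
`∑ λ_k z_k ^ 2` with independent standard Gaussians `z_k`, and the linear terms cancel. -/
theorem lintegral_exp_quadratic_stdGaussian {E : Type*} [NormedAddCommGroup E]
    [InnerProductSpace ℝ E] [FiniteDimensional ℝ E] [MeasurableSpace E] [BorelSpace E]
    (T : E →ₗ[ℝ] E) (hT : T.IsSymmetric) (hb : ∀ x, |inner ℝ x (T x)| ≤ 1 / 4 * ‖x‖ ^ 2)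
    (h0 : LinearMap.trace ℝ E T = 0) :
    ∫⁻ x, ENNReal.ofReal (Real.exp (inner ℝ x (T x))) ∂(stdGaussian E)
      ≤ ENNReal.ofReal (Real.exp (2 * LinearMap.trace ℝ E (T ∘ₗ T))) := by
  set b := hT.eigenvectorBasis rfl with hbdef
  set ev : Fin (Module.finrank ℝ E) → ℝ := hT.eigenvalues rfl with hev
  have hTb : ∀ k, T (b k) = ev k • b k := fun k => by
    exact hT.apply_eigenvectorBasis rfl k
  have hin : ∀ k, inner ℝ (b k) (b k) = (1 : ℝ) := fun k => by
    rw [real_inner_self_eq_norm_sq, b.norm_eq_one]; norm_num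
  have hevb : ∀ k, |ev k| ≤ 1 / 4 := fun k => by
    have := hb (b k)
    rwa [hTb, inner_smul_right, hin, mul_one, b.norm_eq_one, one_pow, mul_one] at this
  have htr : ∑ k, ev k = 0 := by
    rw [← h0, LinearMap.trace_eq_sum_inner T b]
    refine Finset.sum_congr rfl fun k _ => ?_
    rw [hTb, inner_smul_right, hin, mul_one]
  have htr2 : ∑ k, ev k ^ 2 = LinearMap.trace ℝ E (T ∘ₗ T) := by
    rw [LinearMap.trace_eq_sum_inner _ b]
    refine Finset.sum_congr rfl fun k _ => ?_
    rw [LinearMap.comp_apply, hTb, map_smul, hTb, smul_smul, inner_smul_right, hin]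
    ring
  have hq : ∀ z : Fin (Module.finrank ℝ E) → ℝ,
      inner ℝ (∑ k, z k • b k) (T (∑ k, z k • b k)) = ∑ k, ev k * z k ^ 2 := by
    intro z
    have : T (∑ k, z k • b k) = ∑ k, (z k * ev k) • b k := by
      rw [map_sum]
      refine Finset.sum_congr rfl fun k _ => ?_
      rw [map_smul, hTb, smul_smul]
    rw [this, b.orthonormal.inner_sum]
    refine Finset.sum_congr rfl fun k _ => ?_
    simp; ring
  rw [stdGaussian_eq_map_pi_orthonormalBasis b,
    lintegral_map (measurable_exp_quadratic T) (by fun_prop)]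
  simp_rw [hq, Real.exp_sum, ENNReal.ofReal_prod_of_nonneg (fun i _ => (Real.exp_pos _).le)]
  rw [lintegral_pi_prod (fun _ => gaussianReal 0 1)
    (fun k z => ENNReal.ofReal (Real.exp (ev k * z ^ 2))) (fun k => by fun_prop)]
  calc _ ≤ ∏ k, ENNReal.ofReal (Real.exp (ev k + 2 * ev k ^ 2)) :=
        Finset.prod_le_prod' fun k _ => lintegral_exp_mul_sq_gaussianReal (hevb k)
    _ = _ := by
        rw [← ENNReal.ofReal_prod_of_nonneg (fun i _ => (Real.exp_pos _).le), ← Real.exp_sum,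
          Finset.sum_add_distrib, htr, ← Finset.mul_sum, htr2, zero_add]

/-! ### Polar decomposition of the standard Gaussian -/

/-- The density of the standard Gaussian on `ℝ^d`, as a function of the norm. -/
noncomputable def gaussianRadialDensity (d : ℕ) (r : ℝ) : ENNReal :=
  ENNReal.ofReal (((2 * Real.pi) ^ ((d : ℝ) / 2))⁻¹ * Real.exp (-(1 / 2) * r ^ 2))

@[fun_prop]
theorem measurable_gaussianRadialDensity (d : ℕ) : Measurable (gaussianRadialDensity d) := by
  unfold gaussianRadialDensity; fun_prop

theorem integrable_exp_neg_half_norm_sq (d : ℕ) :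
    Integrable fun x : EuclideanSpace ℝ (Fin d) => Real.exp (-(1 / 2) * ‖x‖ ^ 2) := by
  -- the integral of a non-integrable function would be zero, but the Gaussian integral is not
  by_contra h
  have h1 := GaussianFourier.integral_rexp_neg_mul_sq_norm (V := EuclideanSpace ℝ (Fin d))
    (b := 1 / 2) (by norm_num)
  rw [integral_undef h] at h1
  have : (0 : ℝ) < (Real.pi / (1 / 2)) ^ (Module.finrank ℝ (EuclideanSpace ℝ (Fin d)) / 2 : ℝ) := by
    positivity
  linarith

theorem isFiniteMeasure_withDensity_gaussianRadialDensity (d : ℕ) :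
    IsFiniteMeasure ((volume : Measure (EuclideanSpace ℝ (Fin d))).withDensity
      fun x => gaussianRadialDensity d ‖x‖) := by
  refine isFiniteMeasure_withDensity_ofReal ?_
  exact ((integrable_exp_neg_half_norm_sq d).const_mul _).2

theorem stdGaussian_eq_withDensity (d : ℕ) :
    stdGaussian (EuclideanSpace ℝ (Fin d))
      = (volume : Measure (EuclideanSpace ℝ (Fin d))).withDensity
        fun x => gaussianRadialDensity d ‖x‖ := by
  have := isFiniteMeasure_withDensity_gaussianRadialDensity d
  refine Measure.ext_of_charFun (E := EuclideanSpace ℝ (Fin d)) ?_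
  ext t
  rw [charFun_stdGaussian, charFun_apply, integral_withDensity_eq_integral_toReal_smul
    (by fun_prop) (Filter.Eventually.of_forall fun x => by simp [gaussianRadialDensity])]
  have h := GaussianFourier.integral_cexp_neg_mul_sq_norm_add (V := EuclideanSpace ℝ (Fin d))
    (b := 1 / 2) (by norm_num) Complex.I t
  have h2 : ∀ x : EuclideanSpace ℝ (Fin d), (gaussianRadialDensity d ‖x‖).toReal •
      Complex.exp ((inner ℝ x t : ℝ) * Complex.I)
      = (((2 * Real.pi) ^ ((d : ℝ) / 2))⁻¹ : ℝ) *
        Complex.exp (-(1 / 2) * (‖x‖ : ℂ) ^ 2 + Complex.I * (inner ℝ t x : ℝ)) := by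
    intro x
    rw [gaussianRadialDensity, ENNReal.toReal_ofReal (by positivity), Complex.real_smul,
      Complex.ofReal_mul, mul_assoc, Complex.ofReal_exp, ← Complex.exp_add, real_inner_comm]
    congr 2
    push_cast; ring
  simp_rw [h2]
  rw [integral_const_mul, h, finrank_euclideanSpace_fin]
  have h3 : ((Real.pi : ℂ) / (1 / 2)) ^ ((d : ℂ) / 2) =
      (((2 * Real.pi) ^ ((d : ℝ) / 2) : ℝ) : ℂ) := by
    rw [Complex.ofReal_cpow (by positivity)]
    push_cast
    congr 1
    ring
  rw [h3, ← mul_assoc, ← Complex.ofReal_mul, inv_mul_cancel₀ (by positivity), Complex.ofReal_one,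
    one_mul, Complex.I_sq]
  congr 1
  ring

theorem lintegral_stdGaussian_polar (d : ℕ) {f : EuclideanSpace ℝ (Fin d) → ENNReal} [NeZero d]
    (hf : Measurable f) :
    ∫⁻ x, f x ∂(stdGaussian (EuclideanSpace ℝ (Fin d)))
      = ∫⁻ y : Sph d, ∫⁻ r : Set.Ioi (0 : ℝ), gaussianRadialDensity d r *
          f ((r : ℝ) • (y : EuclideanSpace ℝ (Fin d)))
          ∂(Measure.volumeIoiPow (d - 1))
          ∂((volume : Measure (EuclideanSpace ℝ (Fin d))).toSphere) := by
  have hpres :=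
    (volume : Measure (EuclideanSpace ℝ (Fin d))).measurePreserving_homeomorphUnitSphereProd
  rw [finrank_euclideanSpace_fin] at hpres
  have hF : Measurable fun p : Sph d × Set.Ioi (0 : ℝ) => gaussianRadialDensity d p.2 *
      f ((p.2 : ℝ) • (p.1 : EuclideanSpace ℝ (Fin d))) := by fun_prop
  have h0 : (volume : Measure (EuclideanSpace ℝ (Fin d))).restrict {0}ᶜ = volume := by
    refine Measure.restrict_eq_self_of_ae_mem ?_
    exact compl_mem_ae_iff.2 (measure_singleton _)
  rw [stdGaussian_eq_withDensity, lintegral_withDensity_eq_lintegral_mul _ (by fun_prop) hf,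
    ← h0, ← lintegral_subtype_comap (measurableSet_singleton _).compl,
    ← lintegral_prod _ hF.aemeasurable,
    h0, ← hpres.lintegral_comp hF]
  refine lintegral_congr fun x => ?_
  have hx : ‖(x : EuclideanSpace ℝ (Fin d))‖ ≠ 0 := norm_ne_zero_iff.2 x.2
  simp [homeomorphUnitSphereProd_apply_fst_coe, homeomorphUnitSphereProd_apply_snd_coe,
    smul_smul, hx]

theorem toSphere_univ_ne_zero (d : ℕ) [NeZero d] :
    (volume : Measure (EuclideanSpace ℝ (Fin d))).toSphere Set.univ ≠ 0 := by
  rw [Ne, Measure.measure_univ_eq_zero]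
  exact Measure.toSphere_ne_zero _

theorem toSphere_univ_ne_top (d : ℕ) :
    (volume : Measure (EuclideanSpace ℝ (Fin d))).toSphere Set.univ ≠ ⊤ := measure_ne_top _ _

instance instIsProbabilityMeasureSphereUnif (d : ℕ) [NeZero d] :
    IsProbabilityMeasure (sphereUnif d) := by
  refine ⟨?_⟩
  simp only [sphereUnif, Measure.smul_apply, smul_eq_mul]
  exact ENNReal.inv_mul_cancel (toSphere_univ_ne_zero d) (toSphere_univ_ne_top d)

instance instIsProbabilityMeasureLatentLaw (n d : ℕ) [NeZero d] :
    IsProbabilityMeasure (latentLaw n d) := by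
  unfold latentLaw; infer_instance

/-- The law of the norm of a standard Gaussian vector in `ℝ^d`. -/
noncomputable def gaussianRadius (d : ℕ) : Measure ℝ :=
  (stdGaussian (EuclideanSpace ℝ (Fin d))).map norm

instance instIsProbabilityMeasureGaussianRadius (d : ℕ) :
    IsProbabilityMeasure (gaussianRadius d) :=
  Measure.isProbabilityMeasure_map (by fun_prop)

theorem lintegral_gaussianRadius (d : ℕ) [NeZero d] {h : ℝ → ENNReal} (hh : Measurable h) :
    ∫⁻ r, h r ∂(gaussianRadius d) =
      (volume : Measure (EuclideanSpace ℝ (Fin d))).toSphere Set.univ *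
        ∫⁻ r : Set.Ioi (0 : ℝ), gaussianRadialDensity d r * h r
          ∂(Measure.volumeIoiPow (d - 1)) := by
  rw [gaussianRadius, lintegral_map hh (by fun_prop),
    lintegral_stdGaussian_polar d (by fun_prop)]
  have : ∀ (y : Sph d) (r : Set.Ioi (0 : ℝ)),
      ‖(r : ℝ) • (y : EuclideanSpace ℝ (Fin d))‖ = r := fun y r => by
    rw [norm_smul, norm_eq_of_mem_sphere, mul_one, Real.norm_eq_abs, abs_of_pos r.2]
  simp_rw [this]
  rw [lintegral_const, mul_comm]

/-- A standard Gaussian vector is the product of its norm and an independent uniform point of the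
unit sphere. -/
theorem measurePreserving_polar (d : ℕ) [NeZero d] :
    MeasurePreserving (fun p : Sph d × ℝ => p.2 • (p.1 : EuclideanSpace ℝ (Fin d)))
      ((sphereUnif d).prod (gaussianRadius d)) (stdGaussian (EuclideanSpace ℝ (Fin d))) := by
  refine ⟨by fun_prop, ?_⟩
  refine Measure.ext_of_lintegral _ fun f hf => ?_
  rw [lintegral_map hf (by fun_prop), lintegral_prod _ (by fun_prop),
    lintegral_stdGaussian_polar d hf, sphereUnif, lintegral_smul_measure, smul_eq_mul]
  have : ∀ y : Sph d, ∫⁻ r, f (r • (y : EuclideanSpace ℝ (Fin d))) ∂(gaussianRadius d) =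
      (volume : Measure (EuclideanSpace ℝ (Fin d))).toSphere Set.univ *
        ∫⁻ r : Set.Ioi (0 : ℝ), gaussianRadialDensity d r *
          f ((r : ℝ) • (y : EuclideanSpace ℝ (Fin d)))
          ∂(Measure.volumeIoiPow (d - 1)) := fun y =>
    lintegral_gaussianRadius d (h := fun r => f (r • (y : EuclideanSpace ℝ (Fin d)))) (by fun_prop)
  simp_rw [this]
  rw [lintegral_const_mul' _ _ (toSphere_univ_ne_top d), ← mul_assoc,
    ENNReal.inv_mul_cancel (toSphere_univ_ne_zero d) (toSphere_univ_ne_top d), one_mul]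

/-- The mean norm of a standard Gaussian vector in `ℝ^d`. -/
noncomputable def meanRadius (d : ℕ) : ℝ := ∫ r, r ∂(gaussianRadius d)

theorem integrable_gaussianRadius (d : ℕ) : Integrable (fun r : ℝ => r) (gaussianRadius d) := by
  rw [gaussianRadius, integrable_map_measure (by fun_prop) (by fun_prop)]
  exact (IsGaussian.integrable_id (μ := stdGaussian (EuclideanSpace ℝ (Fin d)))).norm

/-- The integral is `(1 + 2 / d) ^ (-d / 2)`, and Bernoulli's inequality gives
`(1 + 2 / d) ^ d ≥ 3`. -/
theorem integral_exp_neg_sq_norm_div_stdGaussian_le (d : ℕ) [NeZero d] :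
    ∫ x, Real.exp (-(‖x‖ ^ 2 / d)) ∂(stdGaussian (EuclideanSpace ℝ (Fin d))) ≤ 3 / 5 := by
  have hd : (0 : ℝ) < d := by exact_mod_cast Nat.pos_of_ne_zero (NeZero.ne d)
  rw [stdGaussian_eq_withDensity, integral_withDensity_eq_integral_toReal_smul
    (by fun_prop) (Filter.Eventually.of_forall fun x => by simp [gaussianRadialDensity])]
  have h2 : ∀ x : EuclideanSpace ℝ (Fin d), (gaussianRadialDensity d ‖x‖).toReal •
      Real.exp (-(‖x‖ ^ 2 / d)) = ((2 * Real.pi) ^ ((d : ℝ) / 2))⁻¹ *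
        Real.exp (-(1 / 2 + 1 / (d : ℝ)) * ‖x‖ ^ 2) := by
    intro x
    rw [gaussianRadialDensity, ENNReal.toReal_ofReal (by positivity), smul_eq_mul,
      mul_assoc, ← Real.exp_add]
    congr 2
    ring
  simp_rw [h2]
  rw [integral_const_mul, GaussianFourier.integral_rexp_neg_mul_sq_norm (by positivity),
    finrank_euclideanSpace_fin, ← Real.inv_rpow (by positivity),
    ← Real.mul_rpow (by positivity) (by positivity)]
  have h3 : (2 * Real.pi)⁻¹ * (Real.pi / (1 / 2 + 1 / (d : ℝ))) = (1 + 2 / (d : ℝ))⁻¹ := by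
    field_simp
  rw [h3]
  have hb : (3 : ℝ) ≤ (1 + 2 / (d : ℝ)) ^ d := by
    have h0 : (0 : ℝ) ≤ 2 / d := by positivity
    have := one_add_mul_le_pow (a := 2 / (d : ℝ)) (by linarith) d
    have h4 : (d : ℝ) * (2 / d) = 2 := by field_simp
    linarith
  rw [Real.inv_rpow (by positivity)]
  have h5 : ((1 + 2 / (d : ℝ)) ^ ((d : ℝ) / 2)) ^ 2 = (1 + 2 / (d : ℝ)) ^ d := by
    rw [← Real.rpow_natCast, ← Real.rpow_mul (by positivity), ← Real.rpow_natCast]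
    congr 1; push_cast; ring
  have h6 : (5 : ℝ) / 3 ≤ (1 + 2 / (d : ℝ)) ^ ((d : ℝ) / 2) := by
    refine le_of_sq_le_sq (α := ℝ) ?_ (by positivity)
    rw [h5]; norm_num at hb ⊢; linarith
  calc _ ≤ ((5 : ℝ) / 3)⁻¹ := inv_anti₀ (by norm_num) h6
    _ = 3 / 5 := by norm_num

/-- The mean norm is of order `√d`; the bound comes from integrating
`1 - exp (-u ^ 2) ≤ u` with `u = ‖g‖ / √d`. -/
theorem le_meanRadius_sq (d : ℕ) [NeZero d] : (d : ℝ) / 8 ≤ meanRadius d ^ 2 := by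
  have hd : (0 : ℝ) < d := by exact_mod_cast Nat.pos_of_ne_zero (NeZero.ne d)
  have hs : (0 : ℝ) < √d := Real.sqrt_pos.2 hd
  have h1 : meanRadius d = ∫ x, ‖x‖ ∂(stdGaussian (EuclideanSpace ℝ (Fin d))) := by
    rw [meanRadius, gaussianRadius, integral_map (by fun_prop) (by fun_prop)]
  have hint := (IsGaussian.integrable_id (μ := stdGaussian (EuclideanSpace ℝ (Fin d)))).norm
  have hle : ∀ u : ℝ, 0 ≤ u → 1 - Real.exp (-u ^ 2) ≤ u := by
    intro u hu
    rcases le_total 1 u with h | h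
    · linarith [Real.exp_pos (-u ^ 2)]
    · nlinarith [Real.add_one_le_exp (-u ^ 2)]
  have h2 : √d * (1 - 3 / 5) ≤ meanRadius d := by
    rw [h1]
    have hint2 : Integrable (fun x : EuclideanSpace ℝ (Fin d) => Real.exp (-(‖x‖ ^ 2 / d)))
        (stdGaussian (EuclideanSpace ℝ (Fin d))) := by
      refine Integrable.of_bound (by fun_prop) 1 (Filter.Eventually.of_forall fun x => ?_)
      rw [Real.norm_eq_abs, abs_of_pos (Real.exp_pos _), Real.exp_le_one_iff, neg_nonpos]
      positivity
    calc √d * (1 - 3 / 5)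
        ≤ √d * (1 - ∫ x, Real.exp (-(‖x‖ ^ 2 / d)) ∂(stdGaussian (EuclideanSpace ℝ (Fin d)))) := by
          gcongr
          exact integral_exp_neg_sq_norm_div_stdGaussian_le d
      _ = ∫ x, √d * (1 - Real.exp (-(‖x‖ ^ 2 / d))) ∂(stdGaussian (EuclideanSpace ℝ (Fin d))) := by
          rw [integral_const_mul, integral_sub (integrable_const _) hint2]
          simp
      _ ≤ _ := by
          refine integral_mono (((integrable_const _).sub hint2).const_mul _) hint fun x => ?_
          have h3 := hle (‖x‖ / √d) (by positivity)
          rw [div_pow, Real.sq_sqrt hd.le, ← neg_div] at h3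
          simp only [← neg_div]
          rw [le_div_iff₀ hs] at h3
          linarith
  have h4 : √d ^ 2 = d := Real.sq_sqrt hd.le
  nlinarith

/-! ### Moment generating functions on the sphere -/

/-- Jensen's inequality for the exponential, valid also when the right-hand side is infinite. -/
theorem ofReal_exp_integral_le {α : Type*} [MeasurableSpace α] {P : Measure α}
    [IsProbabilityMeasure P] {f : α → ℝ} (hf : Integrable f P) :
    ENNReal.ofReal (Real.exp (∫ a, f a ∂P)) ≤ ∫⁻ a, ENNReal.ofReal (Real.exp (f a)) ∂P := by
  by_cases h : ∫⁻ a, ENNReal.ofReal (Real.exp (f a)) ∂P = ⊤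
  · rw [h]; exact le_top
  have hm : AEStronglyMeasurable (fun a => Real.exp (f a)) P :=
    Real.continuous_exp.comp_aestronglyMeasurable hf.1
  have hi : Integrable (fun a => Real.exp (f a)) P :=
    (lintegral_ofReal_ne_top_iff_integrable hm
      (Filter.Eventually.of_forall fun a => (Real.exp_pos _).le)).1 h
  rw [← ofReal_integral_eq_lintegral_ofReal hi
    (Filter.Eventually.of_forall fun a => (Real.exp_pos _).le)]
  exact ENNReal.ofReal_le_ofReal (convexOn_exp.map_integral_le Real.continuous_exp.continuousOn
    isClosed_univ (Filter.Eventually.of_forall fun a => Set.mem_univ _) hf hi)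

/-- The uniform distribution on the sphere is sub-Gaussian, by comparison with a standard
Gaussian vector. -/
theorem lintegral_exp_inner_sphereUnif (d : ℕ) [NeZero d] (v : EuclideanSpace ℝ (Fin d)) :
    ∫⁻ y : Sph d, ENNReal.ofReal (Real.exp (meanRadius d *
        inner ℝ v (y : EuclideanSpace ℝ (Fin d))))
      ∂(sphereUnif d) ≤ ENNReal.ofReal (Real.exp (‖v‖ ^ 2 / 2)) := by
  have h1 : ∫⁻ x, ENNReal.ofReal (Real.exp (inner ℝ v x))
      ∂(stdGaussian (EuclideanSpace ℝ (Fin d))) = ENNReal.ofReal (Real.exp (‖v‖ ^ 2 / 2)) := by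
    have h2 := IsGaussian.map_eq_gaussianReal (μ := stdGaussian (EuclideanSpace ℝ (Fin d)))
      (innerSL ℝ v)
    rw [integral_strongDual_stdGaussian, variance_dual_stdGaussian, innerSL_apply_norm] at h2
    have h3 : ∫⁻ x, ENNReal.ofReal (Real.exp (inner ℝ v x))
        ∂(stdGaussian (EuclideanSpace ℝ (Fin d))) = ∫⁻ z, ENNReal.ofReal (Real.exp z)
        ∂((stdGaussian (EuclideanSpace ℝ (Fin d))).map (innerSL ℝ v)) := by
      rw [lintegral_map (by fun_prop) (by fun_prop)]
      rfl
    have hi := integrable_exp_mul_gaussianReal (μ := 0) (v := (‖v‖ ^ 2).toNNReal) 1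
    have h4 := congrFun (mgf_id_gaussianReal (μ := 0) (v := (‖v‖ ^ 2).toNNReal)) 1
    simp only [mgf, one_mul, id, zero_add, one_pow, mul_one,
      Real.coe_toNNReal _ (sq_nonneg ‖v‖)] at h4 hi
    rw [h3, h2, ← ofReal_integral_eq_lintegral_ofReal hi
      (Filter.Eventually.of_forall fun a => (Real.exp_pos _).le), h4]
  rw [← h1, ← (measurePreserving_polar d).lintegral_comp (by fun_prop),
    lintegral_prod _ (by fun_prop)]
  refine lintegral_mono fun y => ?_
  have hi : Integrable (fun r : ℝ => r * inner ℝ v (y : EuclideanSpace ℝ (Fin d)))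
      (gaussianRadius d) := (integrable_gaussianRadius d).mul_const _
  have h := ofReal_exp_integral_le hi
  rw [integral_mul_const] at h
  simp only [inner_smul_right]
  exact h

theorem integral_mul_pi_gaussianRadius (n d : ℕ) {i j : Fin n} (hij : i ≠ j) :
    Integrable (fun ρ : Fin n → ℝ => ρ i * ρ j) (Measure.pi fun _ => gaussianRadius d) ∧
    ∫ ρ : Fin n → ℝ, ρ i * ρ j ∂(Measure.pi fun _ => gaussianRadius d) = meanRadius d ^ 2 := by
  have hind := (iIndepFun_pi (μ := fun _ : Fin n => gaussianRadius d)
    (X := fun _ (r : ℝ) => r) (fun i => by fun_prop)).indepFun hij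
  have hint : ∀ k : Fin n, Integrable (fun ρ : Fin n → ℝ => ρ k)
      (Measure.pi fun _ => gaussianRadius d) := fun k =>
    integrable_comp_eval (μ := fun _ : Fin n => gaussianRadius d) (f := fun r : ℝ => r)
      (integrable_gaussianRadius d)
  have hval : ∀ k : Fin n, ∫ ρ : Fin n → ℝ, ρ k ∂(Measure.pi fun _ => gaussianRadius d)
      = meanRadius d := fun k =>
    integral_comp_eval (μ := fun _ : Fin n => gaussianRadius d) (f := fun r : ℝ => r) (by fun_prop)
  refine ⟨hind.integrable_mul (hint i) (hint j), ?_⟩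
  have := hind.integral_mul_eq_mul_integral (hint i).1 (hint j).1
  rw [hval, hval] at this
  rw [sq, ← this]
  rfl

/-- Exponential moments of a chaos without diagonal terms can only grow when uniform points of the
sphere are replaced by Gaussian vectors: by Jensen's inequality for the independent norms. -/
theorem lintegral_exp_chaos_latentLaw_le_gaussian (n d : ℕ) [NeZero d] (M : Fin n → Fin n → ℝ)
    (hM : ∀ i, M i i = 0) :
    ∫⁻ y : Fin n → Sph d, ENNReal.ofReal (Real.exp (∑ i, ∑ j, meanRadius d ^ 2 * (M i j *
        inner ℝ (y i : EuclideanSpace ℝ (Fin d)) (y j)))) ∂(latentLaw n d)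
      ≤ ∫⁻ g : Fin n → EuclideanSpace ℝ (Fin d),
          ENNReal.ofReal (Real.exp (∑ i, ∑ j, M i j * inner ℝ (g i) (g j)))
          ∂(Measure.pi fun _ => stdGaussian (EuclideanSpace ℝ (Fin d))) := by
  have hp := measurePreserving_pi (fun _ : Fin n => (sphereUnif d).prod (gaussianRadius d))
    (fun _ => stdGaussian (EuclideanSpace ℝ (Fin d))) fun _ => measurePreserving_polar d
  have ha := (measurePreserving_arrowProdEquivProdArrow (Sph d) ℝ (Fin n)
    (fun _ => sphereUnif d) (fun _ => gaussianRadius d)).symm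
  have hc := hp.comp ha
  rw [← hc.lintegral_comp (by fun_prop), lintegral_prod _ (by
    refine Measurable.aemeasurable ?_
    refine Measurable.comp (g := fun g : Fin n → EuclideanSpace ℝ (Fin d) =>
      ENNReal.ofReal (Real.exp (∑ i, ∑ j, M i j * inner ℝ (g i) (g j)))) (by fun_prop)
      hc.measurable)]
  refine lintegral_mono fun y => ?_
  set f : (Fin n → ℝ) → ℝ := fun ρ => ∑ i, ∑ j, (M i j *
    inner ℝ (y i : EuclideanSpace ℝ (Fin d)) (y j)) * (ρ i * ρ j) with hf
  have hterm : ∀ i j : Fin n, Integrable (fun ρ : Fin n → ℝ => (M i j *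
      inner ℝ (y i : EuclideanSpace ℝ (Fin d)) (y j)) * (ρ i * ρ j))
      (Measure.pi fun _ => gaussianRadius d) := by
    intro i j
    by_cases hij : i = j
    · subst hij; simp [hM]
    · exact (integral_mul_pi_gaussianRadius n d hij).1.const_mul _
  have hfi : Integrable f (Measure.pi fun _ => gaussianRadius d) :=
    integrable_finsetSum _ fun i _ => integrable_finsetSum _ fun j _ => hterm i j
  have h := ofReal_exp_integral_le hfi
  have hval : ∫ ρ, f ρ ∂(Measure.pi fun _ => gaussianRadius d) = ∑ i, ∑ j, meanRadius d ^ 2 *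
      (M i j * inner ℝ (y i : EuclideanSpace ℝ (Fin d)) (y j)) := by
    rw [integral_finsetSum _ fun i _ => integrable_finsetSum _ fun j _ => hterm i j]
    refine Finset.sum_congr rfl fun i _ => ?_
    rw [integral_finsetSum _ fun j _ => hterm i j]
    refine Finset.sum_congr rfl fun j _ => ?_
    by_cases hij : i = j
    · subst hij; simp [hM]
    · rw [integral_const_mul, (integral_mul_pi_gaussianRadius n d hij).2, mul_comm]
  rw [hval] at h
  refine h.trans (le_of_eq (lintegral_congr fun ρ => ?_))
  congr 2
  refine Finset.sum_congr rfl fun i _ => Finset.sum_congr rfl fun j _ => ?_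
  simp only [Function.comp, MeasurableEquiv.arrowProdEquivProdArrow, MeasurableEquiv.symm_mk,
    MeasurableEquiv.coe_mk, Equiv.arrowProdEquivProdArrow, Equiv.coe_fn_symm_mk,
    inner_smul_left, inner_smul_right]
  simp
  ring

/-- The operator `M ⊗ 1` on `n`-tuples of vectors in `ℝ^d`. -/
noncomputable def tensorId (n d : ℕ) (M : Fin n → Fin n → ℝ) :
    PiLp 2 (fun _ : Fin n => EuclideanSpace ℝ (Fin d)) →ₗ[ℝ]
      PiLp 2 (fun _ : Fin n => EuclideanSpace ℝ (Fin d)) where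
  toFun w := WithLp.toLp 2 fun i => ∑ j, M i j • w j
  map_add' v w := by
    ext i : 1
    simp [smul_add, Finset.sum_add_distrib]
  map_smul' c w := by
    ext i : 1
    simp only [PiLp.smul_apply, RingHom.id_apply, Finset.smul_sum]
    exact Finset.sum_congr rfl fun j _ => smul_comm _ _ _

theorem inner_tensorId (n d : ℕ) (M : Fin n → Fin n → ℝ)
    (v w : PiLp 2 (fun _ : Fin n => EuclideanSpace ℝ (Fin d))) :
    inner ℝ v (tensorId n d M w) = ∑ i, ∑ j, M i j * inner ℝ (v i) (w j) := by
  rw [PiLp.inner_apply]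
  refine Finset.sum_congr rfl fun i _ => ?_
  simp [tensorId, inner_sum, inner_smul_right]

theorem tensorId_comp (n d : ℕ) (M N : Fin n → Fin n → ℝ) :
    tensorId n d M ∘ₗ tensorId n d N = tensorId n d fun i j => ∑ k, M i k * N k j := by
  refine LinearMap.ext fun w => ?_
  ext i : 1
  simp only [tensorId, LinearMap.comp_apply, LinearMap.coe_mk, AddHom.coe_mk, Finset.smul_sum,
    Finset.sum_smul, smul_smul]
  exact Finset.sum_comm

theorem trace_tensorId (n d : ℕ) (M : Fin n → Fin n → ℝ) :
    LinearMap.trace ℝ _ (tensorId n d M) = d * ∑ i, M i i := by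
  classical
  rw [LinearMap.trace_eq_sum_inner _
    (Pi.orthonormalBasis fun _ : Fin n => EuclideanSpace.basisFun (Fin d) ℝ), Fintype.sum_sigma,
    Finset.mul_sum]
  refine Finset.sum_congr rfl fun k _ => ?_
  rw [Finset.sum_congr rfl (g := fun _ => M k k), Finset.sum_const, Finset.card_univ,
    Fintype.card_fin, nsmul_eq_mul]
  intro l _
  rw [inner_tensorId, Finset.sum_eq_single k, Finset.sum_eq_single k]
  · simp
  · intro j _ hj; simp [hj]
  · simp
  · intro i _ hi; simp [hi]
  · simp

theorem map_pi_stdGaussian (n d : ℕ) :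
    (Measure.pi fun _ : Fin n => stdGaussian (EuclideanSpace ℝ (Fin d))).map (WithLp.toLp 2)
      = stdGaussian (PiLp 2 fun _ : Fin n => EuclideanSpace ℝ (Fin d)) := by
  refine Measure.ext_of_charFun (E := PiLp 2 fun _ : Fin n => EuclideanSpace ℝ (Fin d)) ?_
  ext t
  rw [charFun_pi, charFun_stdGaussian]
  simp_rw [charFun_stdGaussian]
  rw [← Complex.exp_sum, ← Finset.sum_div, Finset.sum_neg_distrib, ← Complex.ofReal_pow,
    PiLp.norm_sq_eq_of_L2]
  push_cast
  rfl

theorem abs_inner_tensorId_le (n d : ℕ) (M : Fin n → Fin n → ℝ) {τ : ℝ}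
    (hτ : ∀ u : Fin n → ℝ, |∑ i, ∑ j, M i j * (u i * u j)| ≤ τ * ∑ i, u i ^ 2)
    (x : PiLp 2 (fun _ : Fin n => EuclideanSpace ℝ (Fin d))) :
    |inner ℝ x (tensorId n d M x)| ≤ τ * ‖x‖ ^ 2 := by
  have h3 : inner ℝ x (tensorId n d M x) = ∑ l, ∑ i, ∑ j, M i j * (x i l * x j l) := by
    rw [inner_tensorId]
    symm
    rw [Finset.sum_comm]
    refine Finset.sum_congr rfl fun i _ => ?_
    rw [Finset.sum_comm]
    refine Finset.sum_congr rfl fun j _ => ?_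
    rw [PiLp.inner_apply, Finset.mul_sum]
    refine Finset.sum_congr rfl fun l _ => ?_
    simp only [RCLike.inner_apply, conj_trivial]
    ring
  have h4 : ‖x‖ ^ 2 = ∑ l, ∑ i, x i l ^ 2 := by
    rw [PiLp.norm_sq_eq_of_L2, Finset.sum_comm]
    refine Finset.sum_congr rfl fun i _ => ?_
    rw [EuclideanSpace.norm_sq_eq]
    simp
  rw [h3, h4, Finset.mul_sum]
  exact (Finset.abs_sum_le_sum_abs _ _).trans
    (Finset.sum_le_sum fun l _ => hτ fun i => x i l)

/-- A chaos in Gaussian vectors is a quadratic form in a Gaussian vector of `n`-tuples, with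
operator `N ⊗ 1`. -/
theorem lintegral_exp_chaos_gaussian (n d : ℕ) (N : Fin n → Fin n → ℝ)
    (hN : ∀ i, N i i = 0) (hs : ∀ i j, N i j = N j i)
    (hb : ∀ u : Fin n → ℝ, |∑ i, ∑ j, N i j * (u i * u j)| ≤ 1 / 4 * ∑ i, u i ^ 2) :
    ∫⁻ g : Fin n → EuclideanSpace ℝ (Fin d),
          ENNReal.ofReal (Real.exp (∑ i, ∑ j, N i j * inner ℝ (g i) (g j)))
          ∂(Measure.pi fun _ => stdGaussian (EuclideanSpace ℝ (Fin d)))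
      ≤ ENNReal.ofReal (Real.exp (2 * (d * ∑ i, ∑ j, N i j ^ 2))) := by
  have hsym : (tensorId n d N).IsSymmetric := by
    intro v w
    rw [real_inner_comm, inner_tensorId, inner_tensorId, Finset.sum_comm]
    refine Finset.sum_congr rfl fun i _ => Finset.sum_congr rfl fun j _ => ?_
    rw [real_inner_comm, hs]
  have htr : LinearMap.trace ℝ _ (tensorId n d N) = 0 := by
    rw [trace_tensorId]; simp [hN]
  have h5 := lintegral_exp_quadratic_stdGaussian _ hsym (abs_inner_tensorId_le n d N hb) htr
  rw [← map_pi_stdGaussian, lintegral_map (measurable_exp_quadratic (tensorId n d N))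
    (WithLp.measurable_toLp 2 _), tensorId_comp, trace_tensorId] at h5
  simp only [inner_tensorId] at h5
  have h6 : ∑ i, ∑ k, N i k * N k i = ∑ i, ∑ j, N i j ^ 2 :=
    Finset.sum_congr rfl fun i _ => Finset.sum_congr rfl fun j _ => by rw [hs j i, sq]
  rwa [h6] at h5

/-- Moment generating function of a chaos `∑ M_ij ⟨y_i, y_j⟩` in independent uniform points of
the sphere, for scalings `θ` at most of order `d / ‖M‖`. -/
theorem lintegral_exp_chaos_latentLaw (n d : ℕ) [NeZero d] (M : Fin n → Fin n → ℝ)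
    (hM : ∀ i, M i i = 0) (hs : ∀ i j, M i j = M j i) {τ θ : ℝ}
    (hτ : ∀ u : Fin n → ℝ, |∑ i, ∑ j, M i j * (u i * u j)| ≤ τ * ∑ i, u i ^ 2)
    (hτ0 : 0 ≤ τ) (hθ : |θ| * τ ≤ d / 32) :
    ∫⁻ y : Fin n → Sph d, ENNReal.ofReal (Real.exp (θ * ∑ i, ∑ j, M i j *
        inner ℝ (y i : EuclideanSpace ℝ (Fin d)) (y j))) ∂(latentLaw n d)
      ≤ ENNReal.ofReal (Real.exp (128 * θ ^ 2 / d * ∑ i, ∑ j, M i j ^ 2)) := by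
  have hd : (0 : ℝ) < d := by exact_mod_cast Nat.pos_of_ne_zero (NeZero.ne d)
  have hc := le_meanRadius_sq d
  have hc0 : 0 < meanRadius d ^ 2 := by linarith [div_pos hd (by norm_num : (0:ℝ) < 8)]
  set a := θ / meanRadius d ^ 2 with ha
  set N : Fin n → Fin n → ℝ := fun i j => a * M i j with hN
  have haθ : |a| ≤ 8 * |θ| / d := by
    rw [ha, abs_div, abs_of_pos hc0, div_le_div_iff₀ hc0 hd]
    nlinarith [abs_nonneg θ]
  have h1 := lintegral_exp_chaos_latentLaw_le_gaussian n d N (fun i => by simp [hN, hM])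
  have h2 : ∀ y : Fin n → Sph d, ∑ i, ∑ j, meanRadius d ^ 2 * (N i j *
      inner ℝ (y i : EuclideanSpace ℝ (Fin d)) (y j)) = θ * ∑ i, ∑ j, M i j *
        inner ℝ (y i : EuclideanSpace ℝ (Fin d)) (y j) := by
    intro y
    simp_rw [Finset.mul_sum]
    refine Finset.sum_congr rfl fun i _ => Finset.sum_congr rfl fun j _ => ?_
    have : meanRadius d ^ 2 * a = θ := by
      rw [ha, ← mul_div_assoc, mul_div_cancel_left₀ _ hc0.ne']
    simp only [hN]
    rw [← this]
    ring
  simp_rw [h2] at h1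
  refine h1.trans ?_
  have haτ : |a| * τ ≤ 1 / 4 := by
    calc |a| * τ ≤ 8 * |θ| / d * τ := by gcongr
      _ = 8 * (|θ| * τ) / d := by ring
      _ ≤ 8 * (d / 32) / d := by gcongr
      _ = 1 / 4 := by field_simp; norm_num
  have hbd : ∀ u : Fin n → ℝ, |∑ i, ∑ j, N i j * (u i * u j)| ≤ 1 / 4 * ∑ i, u i ^ 2 := by
    intro u
    have h3 : ∑ i, ∑ j, N i j * (u i * u j) = a * ∑ i, ∑ j, M i j * (u i * u j) := by
      simp_rw [Finset.mul_sum, hN, mul_assoc]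
    rw [h3, abs_mul]
    calc |a| * |∑ i, ∑ j, M i j * (u i * u j)| ≤ |a| * (τ * ∑ i, u i ^ 2) := by gcongr; exact hτ u
      _ = |a| * τ * ∑ i, u i ^ 2 := by ring
      _ ≤ _ := by gcongr
  have hsN : ∀ i j, N i j = N j i := fun i j => by simp only [hN]; rw [hs]
  refine (lintegral_exp_chaos_gaussian n d N (fun i => by simp [hN, hM]) hsN hbd).trans
    (ENNReal.ofReal_le_ofReal (Real.exp_le_exp.2 ?_))
  have h6 : ∑ i, ∑ j, N i j ^ 2 = a ^ 2 * ∑ i, ∑ j, M i j ^ 2 := by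
    simp_rw [Finset.mul_sum, hN, mul_pow]
  rw [h6]
  have h7 : a ^ 2 ≤ 64 * θ ^ 2 / d ^ 2 := by
    rw [← sq_abs a]
    calc |a| ^ 2 ≤ (8 * |θ| / d) ^ 2 := by gcongr
      _ = _ := by rw [div_pow, mul_pow, sq_abs]; norm_num
  have h8 : 0 ≤ ∑ i, ∑ j, M i j ^ 2 := by positivity
  calc 2 * (d * (a ^ 2 * ∑ i, ∑ j, M i j ^ 2))
      ≤ 2 * (d * (64 * θ ^ 2 / d ^ 2 * ∑ i, ∑ j, M i j ^ 2)) := by gcongr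
    _ = _ := by field_simp; ring

/-! ### Spectral norm of the Gram matrix -/

theorem gram_self {n d : ℕ} (x : Fin n → Sph d) (i : Fin n) : gram x i i = 0 := if_pos rfl

theorem gram_of_ne {n d : ℕ} (x : Fin n → Sph d) {i j : Fin n} (h : i ≠ j) :
    gram x i j = inner ℝ (x i : EuclideanSpace ℝ (Fin d)) (x j) := if_neg h

theorem gram_symm {n d : ℕ} (x : Fin n → Sph d) (i j : Fin n) : gram x i j = gram x j i := by
  by_cases h : i = j
  · rw [h]
  · rw [gram_of_ne x h, gram_of_ne x (Ne.symm h), real_inner_comm]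

theorem continuous_gram {n d : ℕ} : Continuous (gram (n := n) (d := d)) := by
  refine continuous_pi fun i => continuous_pi fun j => ?_
  by_cases h : i = j
  · subst h; simp only [gram_self]; exact continuous_const
  · simp only [gram_of_ne _ h]; fun_prop

@[fun_prop]
theorem continuous_gram_apply {n d : ℕ} (i j : Fin n) :
    Continuous fun x : Fin n → Sph d => gram x i j :=
  (continuous_apply j).comp ((continuous_apply i).comp continuous_gram)

theorem frobInner_comm {n : ℕ} (M N : Fin n → Fin n → ℝ) : frobInner M N = frobInner N M := by
  unfold frobInner
  exact Finset.sum_congr rfl fun i _ => Finset.sum_congr rfl fun j _ => mul_comm _ _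

theorem lintegral_exp_frobInner_gram {n d : ℕ} [NeZero d] {M : Fin n → Fin n → ℝ}
    (hM : ∀ i, M i i = 0) (hs : ∀ i j, M i j = M j i) {τ θ : ℝ}
    (hτ : ∀ u : Fin n → ℝ, |∑ i, ∑ j, M i j * (u i * u j)| ≤ τ * ∑ i, u i ^ 2)
    (hτ0 : 0 ≤ τ) (hθ : |θ| * τ ≤ d / 32) :
    ∫⁻ y : Fin n → Sph d, ENNReal.ofReal (Real.exp (θ * frobInner M (gram y))) ∂(latentLaw n d)
      ≤ ENNReal.ofReal (Real.exp (128 * θ ^ 2 / d * ∑ i, ∑ j, M i j ^ 2)) := by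
  refine le_trans (le_of_eq (lintegral_congr fun y => ?_))
    (lintegral_exp_chaos_latentLaw n d M hM hs hτ hτ0 hθ)
  congr 3
  unfold frobInner
  refine Finset.sum_congr rfl fun i _ => Finset.sum_congr rfl fun j _ => ?_
  by_cases h : i = j
  · subst h; simp [hM]
  · rw [gram_of_ne y h]

/-- The quadratic form of a matrix is bounded by its Frobenius norm. -/
theorem abs_form_le_of_frobenius {n : ℕ} (M : Fin n → Fin n → ℝ) {F : ℝ} (hF : 0 ≤ F)
    (h : ∑ i, ∑ j, M i j ^ 2 ≤ F ^ 2) (u : Fin n → ℝ) :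
    |∑ i, ∑ j, M i j * (u i * u j)| ≤ F * ∑ i, u i ^ 2 := by
  have hu : 0 ≤ ∑ i, u i ^ 2 := by positivity
  refine abs_le_of_sq_le_sq ?_ (by positivity)
  have h1 := Finset.sum_mul_sq_le_sq_mul_sq (Finset.univ : Finset (Fin n × Fin n))
    (fun p => M p.1 p.2) (fun p => u p.1 * u p.2)
  simp only [Fintype.sum_prod_type] at h1
  refine h1.trans ?_
  rw [mul_pow]
  have h2 : ∑ i, ∑ j, (u i * u j) ^ 2 = (∑ i, u i ^ 2) ^ 2 := by
    rw [sq (∑ i, u i ^ 2), Finset.sum_mul_sum]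
    simp_rw [mul_pow]
  rw [h2]
  gcongr

/-- A `1/2`-net of the unit ball of `ℝ^n` with at most `5 ^ n` elements. -/
theorem exists_net (n : ℕ) : ∃ N : Finset (EuclideanSpace ℝ (Fin n)),
    (∀ u ∈ N, ‖u‖ ≤ 1) ∧ N.card ≤ 5 ^ n ∧
      ∀ w : EuclideanSpace ℝ (Fin n), ‖w‖ ≤ 1 → ∃ u ∈ N, ‖w - u‖ ≤ 1 / 2 := by
  classical
  let P : Finset (EuclideanSpace ℝ (Fin n)) → Prop := fun s =>
    (∀ c ∈ s, ‖c‖ ≤ 2) ∧ ∀ c ∈ s, ∀ e ∈ s, c ≠ e → 1 ≤ ‖c - e‖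
  have hcard : ∀ s, P s → s.card ≤ 5 ^ n := fun s hs => by
    simpa using Besicovitch.card_le_of_separated s hs.1 hs.2
  -- a maximal separated set is a net
  obtain ⟨m, ⟨s, hs, rfl⟩, hmax⟩ : ∃ m, (∃ s, P s ∧ s.card = m) ∧
      ∀ s, P s → s.card ≤ m := by
    let S : Set ℕ := {m | ∃ s, P s ∧ s.card = m}
    have hne : S.Nonempty := ⟨0, ∅, by simp [P], rfl⟩
    have hbd : BddAbove S := ⟨5 ^ n, by rintro _ ⟨s, hs, rfl⟩; exact hcard s hs⟩
    exact ⟨sSup S, Nat.sSup_mem hne hbd, fun s hs => le_csSup hbd ⟨s, hs, rfl⟩⟩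
  refine ⟨s.image fun c => (1 / 2 : ℝ) • c, ?_, Finset.card_image_le.trans (hcard s hs), ?_⟩
  · intro u hu
    obtain ⟨c, hc, rfl⟩ := Finset.mem_image.1 hu
    have := hs.1 c hc
    rw [norm_smul]
    norm_num
    linarith
  · intro w hw
    by_contra hcon
    push Not at hcon
    have hfar : ∀ c ∈ s, 1 < ‖(2 : ℝ) • w - c‖ := by
      intro c hc
      have h1 := hcon _ (Finset.mem_image_of_mem _ hc)
      have h2 : (2 : ℝ) • w - c = (2 : ℝ) • (w - (1 / 2 : ℝ) • c) := by
        rw [smul_sub, smul_smul]; norm_num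
      rw [h2, norm_smul]
      norm_num at h1 ⊢
      linarith
    have hnot : (2 : ℝ) • w ∉ s := fun hmem => by
      have := hfar _ hmem
      simp at this
      linarith
    have hP : P (insert ((2 : ℝ) • w) s) := by
      refine ⟨fun c hc => ?_, fun c hc e he hne => ?_⟩
      · rcases Finset.mem_insert.1 hc with rfl | hc
        · rw [norm_smul]; norm_num; linarith
        · exact hs.1 c hc
      · rcases Finset.mem_insert.1 hc with rfl | hc <;> rcases Finset.mem_insert.1 he with rfl | he
        · exact absurd rfl hne
        · exact (hfar e he).le
        · rw [norm_sub_rev]; exact (hfar c hc).le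
        · exact hs.2 c hc e he hne
    have := hmax _ hP
    rw [Finset.card_insert_of_notMem hnot] at this
    omega

/-- The norm of an operator is controlled by its matrix coefficients on a `1/2`-net. -/
theorem opNorm_le_of_net {E : Type*} [NormedAddCommGroup E] [InnerProductSpace ℝ E]
    (T : E →L[ℝ] E) (N : Finset E) (hN : ∀ w : E, ‖w‖ ≤ 1 → ∃ u ∈ N, ‖w - u‖ ≤ 1 / 2) {t : ℝ}
    (ht : 0 ≤ t) (h : ∀ u ∈ N, ∀ v ∈ N, inner ℝ u (T v) ≤ t) : ‖T‖ ≤ 4 * t := by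
  have h1 : ∀ v ∈ N, ‖T v‖ ≤ 2 * t := by
    intro v hv
    by_cases h0 : T v = 0
    · rw [h0, norm_zero]; positivity
    have hpos : 0 < ‖T v‖ := norm_pos_iff.2 h0
    obtain ⟨u, hu, hdist⟩ := hN (‖T v‖⁻¹ • T v) (by
      rw [norm_smul, norm_inv, norm_norm, inv_mul_cancel₀ hpos.ne'])
    have h2 : inner ℝ (‖T v‖⁻¹ • T v) (T v) = ‖T v‖ := by
      rw [inner_smul_left, real_inner_self_eq_norm_sq]
      simp
      field_simp
    have h3 : inner ℝ (‖T v‖⁻¹ • T v - u) (T v) ≤ 1 / 2 * ‖T v‖ :=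
      (real_inner_le_norm _ _).trans (by gcongr)
    rw [inner_sub_left, h2] at h3
    linarith [h u hu v hv]
  have h2 : ‖T‖ ≤ 2 * t + ‖T‖ * (1 / 2) := by
    refine T.opNorm_le_of_unit_norm (by positivity) fun w hw => ?_
    obtain ⟨v, hv, hdist⟩ := hN w hw.le
    calc ‖T w‖ = ‖T v + T (w - v)‖ := by rw [← map_add]; congr 2; abel
      _ ≤ ‖T v‖ + ‖T (w - v)‖ := norm_add_le _ _
      _ ≤ 2 * t + ‖T‖ * (1 / 2) :=
        add_le_add (h1 v hv) ((T.le_opNorm _).trans (by gcongr))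
  linarith

theorem form_gram_le_of_net {n d : ℕ} (x : Fin n → Sph d)
    (N : Finset (EuclideanSpace ℝ (Fin n)))
    (hN : ∀ w : EuclideanSpace ℝ (Fin n), ‖w‖ ≤ 1 → ∃ u ∈ N, ‖w - u‖ ≤ 1 / 2) {t : ℝ}
    (ht : 0 ≤ t) (h : ∀ u ∈ N, ∀ v ∈ N, ∑ i, ∑ j, gram x i j * (u i * v j) ≤ t)
    (w : Fin n → ℝ) : |∑ i, ∑ j, gram x i j * (w i * w j)| ≤ 4 * t * ∑ i, w i ^ 2 := by
  set T := Matrix.toEuclideanCLM (𝕜 := ℝ) (Matrix.of (gram x)) with hT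
  have hin : ∀ u v : EuclideanSpace ℝ (Fin n),
      inner ℝ u (T v) = ∑ i, ∑ j, gram x i j * (u i * v j) := by
    intro u v
    rw [PiLp.inner_apply]
    refine Finset.sum_congr rfl fun i _ => ?_
    have : (T v) i = ∑ j, gram x i j * v j := by
      simp [hT, Matrix.mulVec, dotProduct]
    rw [this]
    simp only [RCLike.inner_apply, conj_trivial]
    rw [Finset.sum_mul]
    exact Finset.sum_congr rfl fun j _ => by ring
  have hnorm := opNorm_le_of_net T N hN ht fun u hu v hv => (hin u v).trans_le (h u hu v hv)
  have h1 := hin (WithLp.toLp 2 w) (WithLp.toLp 2 w)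
  simp only at h1
  rw [← h1]
  have h2 : ‖(WithLp.toLp 2 w : EuclideanSpace ℝ (Fin n))‖ ^ 2 = ∑ i, w i ^ 2 := by
    rw [EuclideanSpace.norm_sq_eq]; simp
  calc _ ≤ ‖(WithLp.toLp 2 w : EuclideanSpace ℝ (Fin n))‖ * ‖T (WithLp.toLp 2 w)‖ :=
        abs_real_inner_le_norm _ _
    _ ≤ ‖(WithLp.toLp 2 w : EuclideanSpace ℝ (Fin n))‖ *
        (4 * t * ‖(WithLp.toLp 2 w : EuclideanSpace ℝ (Fin n))‖) := by
        gcongr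
        exact (T.le_opNorm _).trans (by gcongr)
    _ = _ := by rw [← h2]; ring

theorem log_natCast_le (n : ℕ) : Real.log n ≤ n :=
  (Real.log_le_self (by positivity))

/-- Chernoff bound for a single bilinear form in the Gram matrix, with the scaling `θ` of order
`min d √(n d)`. -/
theorem latentLaw_bilinear_gram_gt_le {n d : ℕ} [NeZero d] (u v : EuclideanSpace ℝ (Fin n))
    (hu : ‖u‖ ≤ 1) (hv : ‖v‖ ≤ 1) {C : ℝ} (hC : 0 ≤ C) :
    latentLaw n d {x | C * (n / d + √(n / d)) < ∑ i, ∑ j, gram x i j * (u i * v j)}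
      ≤ ENNReal.ofReal (Real.exp (-((C / 32 - 1 / 8) * n))) := by
  have hd : (0 : ℝ) < d := by exact_mod_cast Nat.pos_of_ne_zero (NeZero.ne d)
  set M : Fin n → Fin n → ℝ := fun i j => if i = j then 0 else (u i * v j + u j * v i) / 2 with hM
  have hus : ∑ i, u i ^ 2 ≤ 1 := by
    have := EuclideanSpace.norm_sq_eq u
    simp only [Real.norm_eq_abs, sq_abs] at this
    rw [← this]; exact pow_le_one₀ (norm_nonneg _) hu
  have hvs : ∑ i, v i ^ 2 ≤ 1 := by
    have := EuclideanSpace.norm_sq_eq v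
    simp only [Real.norm_eq_abs, sq_abs] at this
    rw [← this]; exact pow_le_one₀ (norm_nonneg _) hv
  have hM2 : ∑ i, ∑ j, M i j ^ 2 ≤ 1 := by
    calc ∑ i, ∑ j, M i j ^ 2 ≤ ∑ i, ∑ j, (u i ^ 2 * v j ^ 2 + v i ^ 2 * u j ^ 2) / 2 := by
          refine Finset.sum_le_sum fun i _ => Finset.sum_le_sum fun j _ => ?_
          simp only [hM]
          split_ifs
          · rw [zero_pow two_ne_zero]; positivity
          · nlinarith [sq_nonneg (u i * v j - u j * v i)]
      _ = (∑ i, u i ^ 2) * ∑ j, v j ^ 2 := by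
          simp_rw [← Finset.sum_div, Finset.sum_add_distrib, ← Finset.mul_sum, ← Finset.sum_mul]
          ring
      _ ≤ 1 := mul_le_one₀ hus (by positivity) hvs
  have hfrob : ∀ x : Fin n → Sph d,
      frobInner M (gram x) = ∑ i, ∑ j, gram x i j * (u i * v j) := by
    intro x
    have h1 : frobInner M (gram x) = (∑ i, ∑ j, gram x i j * (u i * v j) +
        ∑ i, ∑ j, gram x i j * (u j * v i)) / 2 := by
      rw [← Finset.sum_add_distrib, Finset.sum_div]
      refine Finset.sum_congr rfl fun i _ => ?_
      rw [← Finset.sum_add_distrib, Finset.sum_div]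
      refine Finset.sum_congr rfl fun j _ => ?_
      simp only [hM]
      split_ifs with h
      · subst h; simp [gram_self]
      · ring
    have h2 : ∑ i, ∑ j, gram x i j * (u j * v i) = ∑ i, ∑ j, gram x i j * (u i * v j) := by
      rw [Finset.sum_comm]
      exact Finset.sum_congr rfl fun i _ => Finset.sum_congr rfl fun j _ => by rw [gram_symm]
    rw [h1, h2]; ring
  obtain ⟨θ, hθ0, hθd, hθ2, hθt⟩ : ∃ θ : ℝ, 0 ≤ θ ∧ θ ≤ d / 32 ∧ 128 * θ ^ 2 / d ≤ n / 8 ∧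
      (n : ℝ) / 32 ≤ θ * (n / d + √(n / d)) := by
    have hn0 : (0 : ℝ) ≤ n := Nat.cast_nonneg n
    rcases le_total (d : ℝ) n with h | h
    · refine ⟨d / 32, by positivity, le_rfl, ?_, ?_⟩
      · calc 128 * ((d : ℝ) / 32) ^ 2 / d = d / 8 := by field_simp; norm_num
          _ ≤ n / 8 := by gcongr
      · have : (d : ℝ) / 32 * (n / d) = n / 32 := by field_simp
        have h2 : 0 ≤ (d : ℝ) / 32 * √(n / d) := by positivity
        linarith
    · refine ⟨√(n * d) / 32, by positivity, ?_, ?_, ?_⟩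
      · gcongr
        rw [Real.sqrt_le_left hd.le]
        nlinarith
      · rw [div_pow, Real.sq_sqrt (by positivity)]
        refine le_of_eq ?_
        field_simp
        ring
      · have h1 : √(n * d) * √((n : ℝ) / d) = n := by
          rw [← Real.sqrt_mul (by positivity)]
          rw [show (n : ℝ) * d * (n / d) = n ^ 2 by field_simp, Real.sqrt_sq hn0]
        have h2 : 0 ≤ √((n : ℝ) * d) * (n / d) := by positivity
        linarith
  have hmgf := lintegral_exp_frobInner_gram (n := n) (d := d) (M := M) (by simp [hM])
    (fun i j => by simp only [hM]; rw [add_comm, eq_comm]; simp [eq_comm])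
    (τ := 1) (θ := θ) (abs_form_le_of_frobenius M zero_le_one (by simpa using hM2)) zero_le_one
    (by rw [abs_of_nonneg hθ0]; linarith)
  calc latentLaw n d {x | C * (n / d + √(n / d)) < ∑ i, ∑ j, gram x i j * (u i * v j)}
      ≤ latentLaw n d {x | ENNReal.ofReal (Real.exp (θ * (C * (n / d + √(n / d))))) ≤
          ENNReal.ofReal (Real.exp (θ * frobInner M (gram x)))} := by
        refine measure_mono fun x hx => ?_
        refine ENNReal.ofReal_le_ofReal (Real.exp_le_exp.2 ?_)
        rw [hfrob]
        exact mul_le_mul_of_nonneg_left (le_of_lt hx) hθ0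
    _ ≤ (∫⁻ x, ENNReal.ofReal (Real.exp (θ * frobInner M (gram x))) ∂(latentLaw n d)) /
          ENNReal.ofReal (Real.exp (θ * (C * (n / d + √(n / d))))) := by
        refine meas_ge_le_lintegral_div ?_ ?_ ENNReal.ofReal_ne_top
        · unfold frobInner
          refine Measurable.aemeasurable (Measurable.ennreal_ofReal (Continuous.measurable ?_))
          fun_prop
        · simp [Real.exp_pos]
    _ ≤ ENNReal.ofReal (Real.exp ((n : ℝ) / 8)) /
          ENNReal.ofReal (Real.exp (θ * (C * (n / d + √(n / d))))) := by
        refine ENNReal.div_le_div_right (hmgf.trans (ENNReal.ofReal_le_ofReal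
          (Real.exp_le_exp.2 ?_))) _
        calc 128 * θ ^ 2 / (d : ℝ) * ∑ i, ∑ j, M i j ^ 2 ≤ 128 * θ ^ 2 / d * 1 := by gcongr
          _ ≤ (n : ℝ) / 8 := by linarith
    _ ≤ _ := by
        rw [← ENNReal.ofReal_div_of_pos (Real.exp_pos _), ← Real.exp_sub]
        refine ENNReal.ofReal_le_ofReal (Real.exp_le_exp.2 ?_)
        nlinarith [mul_le_mul_of_nonneg_left hθt hC]

/-- The spectral norm of the Gram matrix is of order `n / d + √(n / d)` with high probability. -/
theorem latentLaw_opNorm_gram {n d : ℕ} [NeZero d] (hn : 1 ≤ n) {k : ℝ} (hk : 0 ≤ k) :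
    latentLaw n d {x | ¬ ∀ w : Fin n → ℝ, |∑ i, ∑ j, gram x i j * (w i * w j)| ≤
        4 * ((32 * k + 132) * (n / d + √(n / d))) * ∑ i, w i ^ 2}
      ≤ ENNReal.ofReal ((n : ℝ) ^ (-k)) := by
  obtain ⟨N, hN1, hN2, hN3⟩ := exists_net n
  have hn0 : (0 : ℝ) < n := by exact_mod_cast hn
  have hsub : {x : Fin n → Sph d | ¬ ∀ w : Fin n → ℝ, |∑ i, ∑ j, gram x i j * (w i * w j)| ≤
        4 * ((32 * k + 132) * (n / d + √(n / d))) * ∑ i, w i ^ 2} ⊆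
      ⋃ p ∈ N ×ˢ N, {x | (32 * k + 132) * (n / d + √(n / d)) <
        ∑ i, ∑ j, gram x i j * (p.1 i * p.2 j)} := by
    intro x hx
    by_contra hcon
    refine hx (form_gram_le_of_net x N hN3 (by positivity) fun u hu v hv => ?_)
    by_contra hlt
    refine hcon (Set.mem_biUnion (x := (u, v)) ?_ (not_le.1 hlt))
    exact_mod_cast Finset.mem_product.2 ⟨hu, hv⟩
  refine (measure_mono hsub).trans ((measure_biUnion_finset_le _ _).trans ?_)
  have h1 : ∀ p ∈ N ×ˢ N, latentLaw n d {x | (32 * k + 132) * (n / d + √(n / d)) <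
        ∑ i, ∑ j, gram x i j * (p.1 i * p.2 j)} ≤ ENNReal.ofReal (Real.exp (-((k + 4) * n))) := by
    intro p hp
    obtain ⟨hp1, hp2⟩ := Finset.mem_product.1 hp
    refine (latentLaw_bilinear_gram_gt_le p.1 p.2 (hN1 _ hp1) (hN1 _ hp2) (by positivity)).trans
      (le_of_eq ?_)
    congr 4
    ring
  refine (Finset.sum_le_sum h1).trans ?_
  rw [Finset.sum_const, nsmul_eq_mul, ← ENNReal.ofReal_natCast,
    ← ENNReal.ofReal_mul (Nat.cast_nonneg _)]
  refine ENNReal.ofReal_le_ofReal ?_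
  have h25 : ((N ×ˢ N).card : ℝ) ≤ Real.exp (4 * n) := by
    rw [Finset.card_product]
    have h5 : (N.card : ℝ) ≤ 5 ^ n := by exact_mod_cast hN2
    have he : (5 : ℝ) ≤ Real.exp 2 := by
      have := Real.quadratic_le_exp_of_nonneg (x := 2) (by norm_num)
      linarith
    push_cast
    calc (N.card : ℝ) * N.card ≤ 5 ^ n * 5 ^ n := by gcongr
      _ ≤ Real.exp 2 ^ n * Real.exp 2 ^ n := by gcongr
      _ = Real.exp (4 * n) := by rw [← Real.exp_nat_mul, ← Real.exp_add]; ring_nf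
  calc ((N ×ˢ N).card : ℝ) * Real.exp (-((k + 4) * n))
      ≤ Real.exp (4 * n) * Real.exp (-((k + 4) * n)) := by gcongr
    _ = Real.exp (-(k * n)) := by rw [← Real.exp_add]; ring_nf
    _ ≤ Real.exp (Real.log n * -k) := by
        refine Real.exp_le_exp.2 ?_
        nlinarith [log_natCast_le n]
    _ = (n : ℝ) ^ (-k) := (Real.rpow_def_of_pos hn0 _).symm

/-! ### Entries of the Gram matrix -/

theorem lintegral_exp_mul_inner_sphereUnif {d : ℕ} [NeZero d] (v : Sph d) (s : ℝ) :
    ∫⁻ y : Sph d, ENNReal.ofReal (Real.exp (s * inner ℝ (v : EuclideanSpace ℝ (Fin d)) y))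
      ∂(sphereUnif d) ≤ ENNReal.ofReal (Real.exp (4 * s ^ 2 / d)) := by
  have hd : (0 : ℝ) < d := by exact_mod_cast Nat.pos_of_ne_zero (NeZero.ne d)
  have hc := le_meanRadius_sq d
  have hc0 : 0 < meanRadius d ^ 2 := by linarith [div_pos hd (by norm_num : (0:ℝ) < 8)]
  have hcne : meanRadius d ≠ 0 := fun h => by simp [h] at hc0
  have h := lintegral_exp_inner_sphereUnif d ((s / meanRadius d) • (v : EuclideanSpace ℝ (Fin d)))
  have h1 : ∀ y : Sph d, meanRadius d * inner ℝ ((s / meanRadius d) •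
      (v : EuclideanSpace ℝ (Fin d))) (y : EuclideanSpace ℝ (Fin d)) =
      s * inner ℝ (v : EuclideanSpace ℝ (Fin d)) y := by
    intro y
    rw [real_inner_smul_left, ← mul_assoc, ← mul_div_assoc, mul_div_cancel_left₀ _ hcne]
  simp_rw [h1] at h
  refine h.trans (ENNReal.ofReal_le_ofReal (Real.exp_le_exp.2 ?_))
  rw [norm_smul, norm_eq_of_mem_sphere, mul_one, Real.norm_eq_abs, sq_abs, div_pow, div_div,
    div_le_div_iff₀ (by positivity) hd]
  nlinarith [sq_nonneg s]

theorem sphereUnif_lt_abs_inner_le {d : ℕ} [NeZero d] (v : Sph d) {t : ℝ} (ht : 0 ≤ t) :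
    sphereUnif d {y | t < |inner ℝ (v : EuclideanSpace ℝ (Fin d)) (y : EuclideanSpace ℝ (Fin d))|}
      ≤ 2 * ENNReal.ofReal (Real.exp (-(d * t ^ 2 / 16))) := by
  have hd : (0 : ℝ) < d := by exact_mod_cast Nat.pos_of_ne_zero (NeZero.ne d)
  -- `|s| = d t / 8` minimizes the Chernoff exponent `4 s ^ 2 / d - |s| t`
  have key : ∀ s : ℝ, |s| = d * t / 8 → sphereUnif d {y | d * t / 8 * t ≤
      s * inner ℝ (v : EuclideanSpace ℝ (Fin d)) (y : EuclideanSpace ℝ (Fin d))}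
      ≤ ENNReal.ofReal (Real.exp (-(d * t ^ 2 / 16))) := by
    intro s hs
    calc _ ≤ sphereUnif d {y | ENNReal.ofReal (Real.exp (d * t / 8 * t)) ≤ ENNReal.ofReal (Real.exp
            (s * inner ℝ (v : EuclideanSpace ℝ (Fin d)) (y : EuclideanSpace ℝ (Fin d))))} :=
          measure_mono fun y hy => ENNReal.ofReal_le_ofReal (Real.exp_le_exp.2 hy)
      _ ≤ (∫⁻ y : Sph d, ENNReal.ofReal (Real.exp (s * inner ℝ (v : EuclideanSpace ℝ (Fin d)) y))
          ∂(sphereUnif d)) / ENNReal.ofReal (Real.exp (d * t / 8 * t)) :=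
          meas_ge_le_lintegral_div (by fun_prop) (by simp [Real.exp_pos]) ENNReal.ofReal_ne_top
      _ ≤ ENNReal.ofReal (Real.exp (4 * s ^ 2 / d)) / ENNReal.ofReal (Real.exp (d * t / 8 * t)) :=
          ENNReal.div_le_div_right (lintegral_exp_mul_inner_sphereUnif v s) _
      _ = _ := by
          rw [← ENNReal.ofReal_div_of_pos (Real.exp_pos _), ← Real.exp_sub, ← sq_abs s, hs]
          congr 2
          field_simp
          ring
  have hs0 : 0 ≤ d * t / 8 := by positivity
  calc _ ≤ sphereUnif d ({y | d * t / 8 * t ≤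
      (d * t / 8) * inner ℝ (v : EuclideanSpace ℝ (Fin d)) (y : EuclideanSpace ℝ (Fin d))} ∪
      {y | d * t / 8 * t ≤
      (-(d * t / 8)) * inner ℝ (v : EuclideanSpace ℝ (Fin d)) (y : EuclideanSpace ℝ (Fin d))}) := by
        refine measure_mono fun y hy => ?_
        rcases lt_abs.1 (show t < |_| from hy) with h | h
        · exact Or.inl (mul_le_mul_of_nonneg_left h.le hs0)
        · refine Or.inr ?_
          have := mul_le_mul_of_nonneg_left h.le hs0
          simp only [Set.mem_ofPred_eq]
          linarith
    _ ≤ _ := measure_union_le _ _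
    _ ≤ _ := by
        rw [two_mul]
        exact add_le_add (key _ (abs_of_nonneg hs0)) (key _ (by rw [abs_neg, abs_of_nonneg hs0]))

/-- The fourth moment of a coordinate of a uniform point of the sphere is at most of order
`1 / d ^ 2`. -/
theorem lintegral_inner_pow_four_sphereUnif {d : ℕ} [NeZero d] (v : Sph d) :
    ∫⁻ y : Sph d, ENNReal.ofReal ((d : ℝ) ^ 2 *
        (inner ℝ (v : EuclideanSpace ℝ (Fin d)) (y : EuclideanSpace ℝ (Fin d))) ^ 4)
      ∂(sphereUnif d) ≤ ENNReal.ofReal (48 * Real.exp 4) := by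
  have hd : (0 : ℝ) < d := by exact_mod_cast Nat.pos_of_ne_zero (NeZero.ne d)
  have hsq : √(d : ℝ) ^ 2 = d := Real.sq_sqrt hd.le
  have hpt : ∀ z : ℝ, z ^ 4 ≤ 24 * (Real.exp z + Real.exp (-z)) := by
    intro z
    have h1 := Real.pow_div_factorial_le_exp |z| (abs_nonneg z) 4
    have h2 : |z| ^ 4 = z ^ 4 := by rw [← abs_pow, abs_of_nonneg (by positivity)]
    have h3 : Real.exp |z| ≤ Real.exp z + Real.exp (-z) := by
      rcases abs_choice z with h | h <;> rw [h] <;> linarith [Real.exp_pos z, Real.exp_pos (-z)]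
    rw [h2] at h1
    norm_num [Nat.factorial] at h1
    linarith
  calc _ ≤ ∫⁻ y : Sph d, (24 : ENNReal) * (ENNReal.ofReal (Real.exp (√d *
          inner ℝ (v : EuclideanSpace ℝ (Fin d)) y)) + ENNReal.ofReal (Real.exp (-√d *
          inner ℝ (v : EuclideanSpace ℝ (Fin d)) y))) ∂(sphereUnif d) := by
        refine lintegral_mono fun y => ?_
        rw [← ENNReal.ofReal_add (Real.exp_pos _).le (Real.exp_pos _).le,
          show (24 : ENNReal) = ENNReal.ofReal 24 by norm_num, ← ENNReal.ofReal_mul (by norm_num)]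
        refine ENNReal.ofReal_le_ofReal (le_trans (le_of_eq ?_) (le_trans (hpt (√d *
          inner ℝ (v : EuclideanSpace ℝ (Fin d)) y)) (le_of_eq ?_)))
        · rw [mul_pow, show √(d : ℝ) ^ 4 = (√(d : ℝ) ^ 2) ^ 2 by ring, hsq]
        · rw [neg_mul]
    _ = 24 * (∫⁻ y : Sph d, (ENNReal.ofReal (Real.exp (√d *
          inner ℝ (v : EuclideanSpace ℝ (Fin d)) y))) ∂(sphereUnif d) +
          ∫⁻ y : Sph d, ENNReal.ofReal (Real.exp (-√d *
          inner ℝ (v : EuclideanSpace ℝ (Fin d)) y)) ∂(sphereUnif d)) := by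
        rw [lintegral_const_mul _ (by fun_prop), lintegral_add_left (by fun_prop)]
    _ ≤ 24 * (ENNReal.ofReal (Real.exp 4) + ENNReal.ofReal (Real.exp 4)) := by
        gcongr
        · refine (lintegral_exp_mul_inner_sphereUnif v (√d)).trans (le_of_eq ?_)
          rw [hsq]; congr 2; field_simp
        · refine (lintegral_exp_mul_inner_sphereUnif v (-√d)).trans (le_of_eq ?_)
          rw [neg_sq, hsq]; congr 2; field_simp
    _ = _ := by
        rw [← ENNReal.ofReal_add (Real.exp_pos _).le (Real.exp_pos _).le,
          show (24 : ENNReal) = ENNReal.ofReal 24 by norm_num, ← ENNReal.ofReal_mul (by norm_num)]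
        congr 1; ring

/-- Concentration of a sum of independent copies of a nonnegative function truncated at `T`. -/
theorem pi_lt_sum_min_le {α : Type*} [MeasurableSpace α] (P : Measure α) [IsProbabilityMeasure P]
    {w : α → ℝ} (hw : Measurable w) (hw0 : ∀ a, 0 ≤ w a) {W T s : ℝ} (hT : 0 < T) (hW0 : 0 ≤ W)
    (hW : ∫⁻ a, ENNReal.ofReal (w a) ∂P ≤ ENNReal.ofReal W) (m : ℕ) :
    (Measure.pi fun _ : Fin m => P) {y | 2 * W * m + s < ∑ k, min (w (y k)) T}
      ≤ ENNReal.ofReal (Real.exp (-(s / T))) := by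
  have hm : Measurable fun a => ENNReal.ofReal (Real.exp (min (w a) T / T)) := by fun_prop
  have h1 : ∫⁻ a, ENNReal.ofReal (Real.exp (min (w a) T / T)) ∂P
      ≤ ENNReal.ofReal (Real.exp (2 * W / T)) := by
    calc _ ≤ ∫⁻ a, (1 + ENNReal.ofReal (2 / T) * ENNReal.ofReal (w a)) ∂P := by
          refine lintegral_mono fun a => ?_
          rw [← ENNReal.ofReal_mul (by positivity), ← ENNReal.ofReal_one,
            ← ENNReal.ofReal_add zero_le_one (mul_nonneg (by positivity) (hw0 a))]
          refine ENNReal.ofReal_le_ofReal ?_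
          have hz0 : 0 ≤ min (w a) T / T := div_nonneg (le_min (hw0 a) hT.le) hT.le
          have hz1 : min (w a) T / T ≤ 1 := (div_le_one hT).2 (min_le_right _ _)
          have h2 := (abs_le.1 (Real.abs_exp_sub_one_sub_id_le (x := min (w a) T / T)
            (by rw [abs_of_nonneg hz0]; exact hz1))).2
          have h3 : min (w a) T / T ≤ w a / T := by gcongr; exact min_le_left _ _
          have h4 : 2 / T * w a = 2 * (w a / T) := by ring
          rw [h4]
          nlinarith
      _ = 1 + ENNReal.ofReal (2 / T) * ∫⁻ a, ENNReal.ofReal (w a) ∂P := by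
          rw [lintegral_add_left measurable_const, lintegral_const_mul _ (by fun_prop)]
          simp
      _ ≤ 1 + ENNReal.ofReal (2 / T) * ENNReal.ofReal W := by gcongr
      _ ≤ _ := by
          rw [← ENNReal.ofReal_mul (by positivity), ← ENNReal.ofReal_one,
            ← ENNReal.ofReal_add zero_le_one (by positivity)]
          refine ENNReal.ofReal_le_ofReal ?_
          have := Real.add_one_le_exp (2 * W / T)
          have h4 : 2 / T * W = 2 * W / T := by ring
          linarith
  calc _ ≤ (Measure.pi fun _ : Fin m => P) {y | ENNReal.ofReal (Real.exp ((2 * W * m + s) / T)) ≤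
          ∏ k, ENNReal.ofReal (Real.exp (min (w (y k)) T / T))} := by
        refine measure_mono fun y hy => ?_
        simp only [Set.mem_ofPred_eq]
        rw [← ENNReal.ofReal_prod_of_nonneg (fun i _ => (Real.exp_pos _).le), ← Real.exp_sum,
          ← Finset.sum_div]
        refine ENNReal.ofReal_le_ofReal (Real.exp_le_exp.2 ?_)
        gcongr
        exact le_of_lt hy
    _ ≤ (∫⁻ y, ∏ k, ENNReal.ofReal (Real.exp (min (w (y k)) T / T))
          ∂(Measure.pi fun _ : Fin m => P)) / ENNReal.ofReal (Real.exp ((2 * W * m + s) / T)) :=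
        meas_ge_le_lintegral_div (Measurable.aemeasurable (by fun_prop)) (by simp [Real.exp_pos])
          ENNReal.ofReal_ne_top
    _ ≤ ENNReal.ofReal (Real.exp (2 * W / T)) ^ m /
          ENNReal.ofReal (Real.exp ((2 * W * m + s) / T)) := by
        refine ENNReal.div_le_div_right ?_ _
        rw [lintegral_pi_prod (fun _ : Fin m => P)
          (fun _ a => ENNReal.ofReal (Real.exp (min (w a) T / T))) (fun _ => hm),
          Finset.prod_const, Finset.card_univ, Fintype.card_fin]
        gcongr
    _ = _ := by
        rw [← ENNReal.ofReal_pow (Real.exp_pos _).le, ← Real.exp_nat_mul,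
          ← ENNReal.ofReal_div_of_pos (Real.exp_pos _), ← Real.exp_sub]
        congr 2
        ring

/-- The event that a point `p.1` of the sphere has an inner product larger than `t` with one of the
`m` points `p.2`, or that the fourth moment of these inner products is large. Inner products are
truncated at `t` in the fourth moment, which makes it a sum of bounded independent variables once
`p.1` is fixed. -/
def rowBad (m d : ℕ) (t W s : ℝ) : Set (Sph d × (Fin m → Sph d)) :=
  {p | ∃ k, t < |inner ℝ (p.1 : EuclideanSpace ℝ (Fin d)) (p.2 k : EuclideanSpace ℝ (Fin d))|} ∪
  {p | 2 * W * m + s < ∑ k, min ((d : ℝ) ^ 2 *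
    (inner ℝ (p.1 : EuclideanSpace ℝ (Fin d)) (p.2 k : EuclideanSpace ℝ (Fin d))) ^ 4)
      ((d : ℝ) ^ 2 * t ^ 4)}

theorem measurableSet_rowBad (m d : ℕ) (t W s : ℝ) : MeasurableSet (rowBad m d t W s) := by
  refine IsOpen.measurableSet (IsOpen.union ?_ ?_)
  · rw [Set.ofPred_exists]
    exact isOpen_iUnion fun k => isOpen_lt (by fun_prop) (by fun_prop)
  · exact isOpen_lt (by fun_prop) (by fun_prop)

theorem prod_rowBad_le (m : ℕ) {d : ℕ} [NeZero d] {t s : ℝ} (ht : 0 < t) :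
    ((sphereUnif d).prod (Measure.pi fun _ : Fin m => sphereUnif d))
        (rowBad m d t (48 * Real.exp 4) s)
      ≤ ENNReal.ofReal (2 * m * Real.exp (-(d * t ^ 2 / 16)) +
          Real.exp (-(s / ((d : ℝ) ^ 2 * t ^ 4)))) := by
  have hd : (0 : ℝ) < d := by exact_mod_cast Nat.pos_of_ne_zero (NeZero.ne d)
  rw [Measure.prod_apply (measurableSet_rowBad _ _ _ _ _)]
  calc _ ≤ ∫⁻ _ : Sph d, ENNReal.ofReal (2 * m * Real.exp (-(d * t ^ 2 / 16)) +
          Real.exp (-(s / ((d : ℝ) ^ 2 * t ^ 4)))) ∂(sphereUnif d) := ?_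
    _ = _ := by simp
  refine lintegral_mono fun v => ?_
  have hsub : Prod.mk v ⁻¹' rowBad m d t (48 * Real.exp 4) s ⊆
      (⋃ k ∈ (Finset.univ : Finset (Fin m)), {y : Fin m → Sph d |
        t < |inner ℝ (v : EuclideanSpace ℝ (Fin d)) (y k : EuclideanSpace ℝ (Fin d))|}) ∪
      {y | 2 * (48 * Real.exp 4) * m + s < ∑ k, min ((d : ℝ) ^ 2 *
    (inner ℝ (v : EuclideanSpace ℝ (Fin d)) (y k : EuclideanSpace ℝ (Fin d))) ^ 4)
      ((d : ℝ) ^ 2 * t ^ 4)} := by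
    rintro y (⟨k, hk⟩ | h)
    · exact Or.inl (Set.mem_biUnion (Finset.mem_coe.2 (Finset.mem_univ k)) hk)
    · exact Or.inr h
  refine (measure_mono hsub).trans ((measure_union_le _ _).trans ?_)
  rw [ENNReal.ofReal_add (by positivity) (Real.exp_pos _).le]
  refine add_le_add ?_ (pi_lt_sum_min_le (sphereUnif d) (by fun_prop) (fun a => by positivity)
    (by positivity) (by positivity) (lintegral_inner_pow_four_sphereUnif v) m)
  refine (measure_biUnion_finset_le _ _).trans ?_
  have h1 : ∀ k ∈ (Finset.univ : Finset (Fin m)), (Measure.pi fun _ : Fin m => sphereUnif d)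
      {y : Fin m → Sph d | t < |inner ℝ (v : EuclideanSpace ℝ (Fin d))
        (y k : EuclideanSpace ℝ (Fin d))|} ≤
      2 * ENNReal.ofReal (Real.exp (-(d * t ^ 2 / 16))) := by
    intro k _
    have hm := measurePreserving_eval (fun _ : Fin m => sphereUnif d) k
    have hmeas : MeasurableSet {y : Sph d | t < |inner ℝ (v : EuclideanSpace ℝ (Fin d))
        (y : EuclideanSpace ℝ (Fin d))|} := measurableSet_lt measurable_const (by fun_prop)
    have := hm.measure_preimage hmeas.nullMeasurableSet
    exact this.trans_le (sphereUnif_lt_abs_inner_le v ht.le)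
  refine (Finset.sum_le_sum h1).trans (le_of_eq ?_)
  rw [Finset.sum_const, Finset.card_univ, Fintype.card_fin, nsmul_eq_mul,
    ENNReal.ofReal_mul (by positivity), mul_comm (2 : ℝ), ENNReal.ofReal_mul (by positivity)]
  simp [mul_assoc]

/-! ### Typical latent points -/

/-- Latent points are typical, up to the constant `C`, if their Gram matrix has spectral norm of
order at most `n / d + √(n / d)`, entries of order at most `√(log n / d)`, and entries whose fourth
powers are of order at most `1 / d ^ 2` on average. -/
structure IsTypical {n d : ℕ} (C : ℝ) (x : Fin n → Sph d) : Prop where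
  form : ∀ w : Fin n → ℝ, |∑ i, ∑ j, gram x i j * (w i * w j)| ≤
    C * (n / d + √(n / d)) * ∑ i, w i ^ 2
  entry : ∀ i j, |gram x i j| ≤ C * √(Real.log n / d)
  four : ∑ i, ∑ j, gram x i j ^ 4 ≤ C * (n ^ 2 / d ^ 2)

theorem measurableSet_isTypical {n d : ℕ} (C : ℝ) :
    MeasurableSet {x : Fin n → Sph d | IsTypical C x} := by
  have h : {x : Fin n → Sph d | IsTypical C x} =
      (⋂ w : Fin n → ℝ, {x | |∑ i, ∑ j, gram x i j * (w i * w j)| ≤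
        C * (n / d + √(n / d)) * ∑ i, w i ^ 2}) ∩
      ((⋂ i, ⋂ j, {x | |gram x i j| ≤ C * √(Real.log n / d)}) ∩
      {x | ∑ i, ∑ j, gram x i j ^ 4 ≤ C * (n ^ 2 / d ^ 2)}) := by
    ext x
    simp only [Set.mem_inter_iff, Set.mem_iInter, Set.mem_ofPred_eq]
    exact ⟨fun h => ⟨h.1, h.2, h.3⟩, fun h => ⟨h.1, h.2.1, h.2.2⟩⟩
  rw [h]
  refine IsClosed.measurableSet (IsClosed.inter (isClosed_iInter fun w => ?_)
    (IsClosed.inter (isClosed_iInter fun i => isClosed_iInter fun j => ?_) ?_))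
  · exact isClosed_le (by fun_prop) continuous_const
  · exact isClosed_le (by fun_prop) continuous_const
  · exact isClosed_le (by fun_prop) continuous_const

theorem log_cube_le {n : ℕ} (hn : 1 ≤ n) : Real.log n ^ 3 ≤ 27 * n := by
  have hn0 : (0 : ℝ) < n := by exact_mod_cast hn
  have h1 : Real.log n ≤ 3 * (n : ℝ) ^ (1 / 3 : ℝ) := by
    have := Real.log_le_rpow_div hn0.le (ε := 1 / 3) (by norm_num)
    linarith
  have h2 : ((n : ℝ) ^ (1 / 3 : ℝ)) ^ 3 = n := by
    rw [← Real.rpow_natCast, ← Real.rpow_mul hn0.le]; norm_num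
  calc Real.log (n : ℝ) ^ 3 ≤ (3 * (n : ℝ) ^ (1 / 3 : ℝ)) ^ 3 := by
        gcongr
    _ = 27 * (n : ℝ) := by rw [mul_pow, h2]; norm_num

theorem exp_neg_mul_log {n : ℕ} (hn : 1 ≤ n) (a : ℝ) :
    Real.exp (-(a * Real.log n)) = (n : ℝ) ^ (-a) := by
  rw [Real.rpow_def_of_pos (by exact_mod_cast hn)]
  congr 1; ring

/-- Outside the exceptional event no entry of the row reaches the truncation level, so the
truncated fourth moment is the fourth moment. -/
theorem rowSum_pow_four_le_of_notMem_rowBad {m d : ℕ} [NeZero d] {t W s : ℝ}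
    {x : Fin (m + 1) → Sph d} {i : Fin (m + 1)} (ht : 0 ≤ t)
    (h : (x i, fun k => x (i.succAbove k)) ∉ rowBad m d t W s) :
    (∀ j, |gram x i j| ≤ t) ∧ ∑ j, gram x i j ^ 4 ≤ (2 * W * m + s) / (d : ℝ) ^ 2 := by
  have hd : (0 : ℝ) < d := by exact_mod_cast Nat.pos_of_ne_zero (NeZero.ne d)
  simp only [rowBad, Set.mem_union, Set.mem_ofPred_eq, not_or, not_exists, not_lt] at h
  obtain ⟨h1, h2⟩ := h
  have hgram : ∀ k, gram x i (i.succAbove k) =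
      inner ℝ (x i : EuclideanSpace ℝ (Fin d)) (x (i.succAbove k)) := fun k =>
    gram_of_ne x (Fin.succAbove_ne i k).symm
  simp only [← hgram] at h1 h2
  refine ⟨fun j => ?_, ?_⟩
  · rcases Fin.eq_self_or_eq_succAbove i j with rfl | ⟨k, rfl⟩
    · rw [gram_self, abs_zero]; exact ht
    · exact h1 k
  · rw [Fin.sum_univ_succAbove _ i, gram_self, zero_pow (by norm_num), zero_add,
      le_div_iff₀ (by positivity), Finset.sum_mul]
    refine le_trans (le_of_eq (Finset.sum_congr rfl fun k _ => ?_)) h2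
    have h4 : gram x i (i.succAbove k) ^ 4 ≤ t ^ 4 := by
      calc gram x i (i.succAbove k) ^ 4 = |gram x i (i.succAbove k)| ^ 4 := by
            rw [← abs_pow, abs_of_nonneg (by positivity)]
        _ ≤ t ^ 4 := pow_le_pow_left₀ (abs_nonneg _) (h1 k) 4
    rw [min_eq_left (by gcongr), mul_comm]

theorem latentLaw_rowBad_le {m d : ℕ} [NeZero d] {t s : ℝ} (ht : 0 < t) (i : Fin (m + 1)) :
    latentLaw (m + 1) d {x | (x i, fun k => x (i.succAbove k)) ∈ rowBad m d t (48 * Real.exp 4) s}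
      ≤ ENNReal.ofReal (2 * m * Real.exp (-(d * t ^ 2 / 16)) +
          Real.exp (-(s / ((d : ℝ) ^ 2 * t ^ 4)))) := by
  have hp := measurePreserving_piFinSuccAbove (fun _ : Fin (m + 1) => sphereUnif d) i
  have h := hp.measure_preimage
    (measurableSet_rowBad m d t (48 * Real.exp 4) s).nullMeasurableSet
  refine le_trans (le_of_eq ?_) (prod_rowBad_le m ht)
  exact h

/-- Latent points are typical with high probability. The fourth moment is controlled row by row:
given `x_i`, the entries of row `i` are independent, and the truncation at `t ^ 2 = A log n / d` bounds
the probability of a deviation of order `n / d ^ 2` by `exp (-c n / (log n) ^ 2)`. -/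
theorem latentLaw_not_isTypical_le {k : ℝ} (hk : 0 ≤ k) : ∃ C : ℝ, 1 ≤ C ∧
    ∀ (n d : ℕ) [NeZero d], 2 ≤ n →
      latentLaw n d {x | ¬ IsTypical C x} ≤ ENNReal.ofReal ((n : ℝ) ^ (-k)) := by
  set A : ℝ := 16 * (k + 4) with hA
  set S : ℝ := 27 * (k + 3) * A ^ 2 with hS
  set C : ℝ := 4 * (32 * (k + 2) + 132) + A + 2 * (48 * Real.exp 4) + S with hC
  have hA1 : 1 ≤ A := by rw [hA]; linarith
  have hA0 : 0 ≤ A := by linarith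
  have hS0 : 0 ≤ S := by positivity
  have he4 : 0 < Real.exp 4 := Real.exp_pos 4
  refine ⟨C, by rw [hC]; linarith, fun n d hNe hn => ?_⟩
  obtain ⟨m, rfl⟩ : ∃ m, n = m + 1 := ⟨n - 1, by omega⟩
  set n := m + 1 with hndef
  have hd : (0 : ℝ) < d := by exact_mod_cast Nat.pos_of_ne_zero (NeZero.ne d)
  have hn1 : 1 ≤ n := by omega
  have hn0 : (0 : ℝ) < n := by exact_mod_cast hn1
  have hn2 : (2 : ℝ) ≤ n := by exact_mod_cast hn
  have hmn : (m : ℝ) ≤ n := by rw [hndef]; push_cast; linarith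
  have hlog : 0 < Real.log n := Real.log_pos (by linarith)
  set t := √(A * (Real.log n / d)) with ht
  have ht2 : t ^ 2 = A * (Real.log n / d) := Real.sq_sqrt (by positivity)
  have ht0 : 0 < t := Real.sqrt_pos.2 (by positivity)
  have htle : t ≤ C * √(Real.log n / d) := by
    rw [ht, Real.sqrt_mul hA0]
    gcongr
    refine (Real.sqrt_le_left hA0).2 (by nlinarith) |>.trans ?_
    rw [hC]; linarith
  have hsub : {x : Fin n → Sph d | ¬ IsTypical C x} ⊆
      {x | ¬ ∀ w : Fin n → ℝ, |∑ i, ∑ j, gram x i j * (w i * w j)| ≤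
        4 * ((32 * (k + 2) + 132) * (n / d + √(n / d))) * ∑ i, w i ^ 2} ∪
      ⋃ i ∈ (Finset.univ : Finset (Fin n)), {x | (x i, fun k => x (i.succAbove k)) ∈
        rowBad m d t (48 * Real.exp 4) (S * n)} := by
    intro x hx
    by_contra hcon
    simp only [Set.mem_union, not_or, Set.mem_ofPred_eq, not_not, Set.mem_iUnion,
      not_exists] at hcon
    obtain ⟨h1, h2⟩ := hcon
    have h3 := fun i => rowSum_pow_four_le_of_notMem_rowBad (x := x) ht0.le
      (h2 i (Finset.mem_univ i))
    refine hx ⟨fun w => (h1 w).trans ?_, fun i j => ((h3 i).1 j).trans htle, ?_⟩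
    · have : 4 * (32 * (k + 2) + 132) ≤ C := by rw [hC]; linarith
      rw [← mul_assoc]
      gcongr
    · calc ∑ i, ∑ j, gram x i j ^ 4
          ≤ ∑ i : Fin n, (2 * (48 * Real.exp 4) * m + S * n) / (d : ℝ) ^ 2 :=
            Finset.sum_le_sum fun i _ => (h3 i).2
        _ = n * ((2 * (48 * Real.exp 4) * m + S * n) / (d : ℝ) ^ 2) := by simp
        _ ≤ n * ((2 * (48 * Real.exp 4) * n + S * n) / (d : ℝ) ^ 2) := by gcongr
        _ = (2 * (48 * Real.exp 4) + S) * (n ^ 2 / d ^ 2) := by ring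
        _ ≤ C * (n ^ 2 / d ^ 2) := by
            gcongr
            rw [hC]; linarith
  have hrow : ∀ i ∈ (Finset.univ : Finset (Fin n)), latentLaw n d
      {x | (x i, fun k => x (i.succAbove k)) ∈ rowBad m d t (48 * Real.exp 4) (S * n)} ≤
      ENNReal.ofReal (2 * n * (n : ℝ) ^ (-(k + 4)) + (n : ℝ) ^ (-(k + 3))) := by
    intro i _
    refine (latentLaw_rowBad_le ht0 i).trans (ENNReal.ofReal_le_ofReal ?_)
    refine add_le_add ?_ ?_
    · rw [← exp_neg_mul_log hn1]
      have : (d : ℝ) * t ^ 2 / 16 = (k + 4) * Real.log n := by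
        rw [ht2, hA]; field_simp
      rw [this]
      gcongr
    · rw [← exp_neg_mul_log hn1]
      refine Real.exp_le_exp.2 (neg_le_neg ?_)
      have h4 : (d : ℝ) ^ 2 * t ^ 4 = A ^ 2 * Real.log n ^ 2 := by
        rw [show t ^ 4 = (t ^ 2) ^ 2 by ring, ht2]; field_simp
      rw [h4, hS, le_div_iff₀ (by positivity)]
      have h5 := log_cube_le hn1
      calc (k + 3) * Real.log n * (A ^ 2 * Real.log n ^ 2)
          = (k + 3) * A ^ 2 * Real.log n ^ 3 := by ring
        _ ≤ (k + 3) * A ^ 2 * (27 * n) := by gcongr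
        _ = _ := by ring
  have hpow : ∀ a b : ℝ, (n : ℝ) ^ a * (n : ℝ) ^ b = (n : ℝ) ^ (a + b) := fun a b =>
    (Real.rpow_add hn0 a b).symm
  calc _ ≤ ENNReal.ofReal ((n : ℝ) ^ (-(k + 2))) +
        ∑ i : Fin n, ENNReal.ofReal (2 * n * (n : ℝ) ^ (-(k + 4)) + (n : ℝ) ^ (-(k + 3))) :=
        (measure_mono hsub).trans ((measure_union_le _ _).trans (add_le_add
          (latentLaw_opNorm_gram hn1 (by linarith))
          ((measure_biUnion_finset_le _ _).trans (Finset.sum_le_sum hrow))))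
    _ = ENNReal.ofReal ((n : ℝ) ^ (-(k + 2)) +
        n * (2 * n * (n : ℝ) ^ (-(k + 4)) + (n : ℝ) ^ (-(k + 3)))) := by
        rw [Finset.sum_const, Finset.card_univ, Fintype.card_fin, nsmul_eq_mul,
          ← ENNReal.ofReal_natCast, ← ENNReal.ofReal_mul hn0.le,
          ← ENNReal.ofReal_add (by positivity) (by positivity)]
    _ ≤ _ := by
        refine ENNReal.ofReal_le_ofReal ?_
        have e1 : (n : ℝ) ^ (-(k + 3)) = (n : ℝ) ^ (-(k + 4)) * n := by
          rw [← Real.rpow_add_one hn0.ne']; congr 1; ring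
        have e2 : (n : ℝ) ^ (-(k + 2)) = (n : ℝ) ^ (-(k + 3)) * n := by
          rw [← Real.rpow_add_one hn0.ne']; congr 1; ring
        have e3 : (n : ℝ) ^ (-(k + 1)) = (n : ℝ) ^ (-(k + 2)) * n := by
          rw [← Real.rpow_add_one hn0.ne']; congr 1; ring
        have e4 : (n : ℝ) ^ (-k) = (n : ℝ) ^ (-(k + 1)) * n := by
          rw [← Real.rpow_add_one hn0.ne']; congr 1; ring
        rw [e4, e3, e2, e1]
        have hp : 0 < (n : ℝ) ^ (-(k + 4)) := by positivity
        set q := (n : ℝ) ^ (-(k + 4))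
        have : 4 * (q * n * n) ≤ q * n * n * n * n := by
          have h6 : (4 : ℝ) ≤ n * n := by nlinarith
          calc 4 * (q * n * n) ≤ (n * n) * (q * n * n) := by gcongr
            _ = _ := by ring
        linarith

/-! ### From the posterior to a truncated second moment -/

/-- The probability of the graph `a` when all pairs are connected independently with
probability `p`. -/
noncomputable def nullLikelihood {n : ℕ} (p : ℝ) (a : Graph n) : ℝ :=
  ∏ e : Pairs n, if a e then p else 1 - p

theorem sum_graph_prod {n : ℕ} (f : Pairs n → Bool → ℝ) :
    ∑ a : Graph n, ∏ e, f e (a e) = ∏ e, (f e true + f e false) := by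
  have h := (Finset.prod_univ_sum (fun _ : Pairs n => (Finset.univ : Finset Bool)) f).symm
  rw [Fintype.piFinset_univ] at h
  rw [h]
  exact Finset.prod_congr rfl fun e _ => by simp

theorem sum_nullLikelihood {n : ℕ} (p : ℝ) : ∑ a : Graph n, nullLikelihood p a = 1 := by
  have h := sum_graph_prod (n := n) fun _ b => if b then p else 1 - p
  simp only [nullLikelihood]
  rw [h]
  exact Finset.prod_eq_one fun e _ => by simp

theorem nullLikelihood_pos {n : ℕ} {p : ℝ} (h0 : 0 < p) (h1 : p < 1) (a : Graph n) :
    0 < nullLikelihood p a := by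
  refine Finset.prod_pos fun e _ => ?_
  split_ifs
  · exact h0
  · linarith

theorem likelihood_nonneg {n d : ℕ} (K : Set.Icc (-1 : ℝ) 1 → unitInterval)
    (x : Fin n → Sph d) (a : Graph n) : 0 ≤ likelihood K x a := by
  refine Finset.prod_nonneg fun e _ => ?_
  split_ifs
  · exact (K _).2.1
  · exact sub_nonneg.2 (K _).2.2

theorem sum_likelihood {n d : ℕ} (K : Set.Icc (-1 : ℝ) 1 → unitInterval)
    (x : Fin n → Sph d) : ∑ a : Graph n, likelihood K x a = 1 := by
  have h := sum_graph_prod (n := n) fun e b =>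
    if b then (K (sphInner (x e.1.1) (x e.1.2)) : ℝ)
    else 1 - (K (sphInner (x e.1.1) (x e.1.2)) : ℝ)
  simp only [likelihood]
  rw [h]
  exact Finset.prod_eq_one fun e _ => by simp

/-- The expectation, under the null model, of the product of the likelihood ratios of two
configurations of latent points. -/
theorem sum_likelihood_mul_div {n d : ℕ} (K : Set.Icc (-1 : ℝ) 1 → unitInterval)
    (h0 : 0 < edgeDensity d K) (h1 : edgeDensity d K < 1) (x y : Fin n → Sph d) :
    ∑ a : Graph n, (nullLikelihood (edgeDensity d K) a)⁻¹ * (likelihood K x a * likelihood K y a)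
      = ∏ e : Pairs n, (1 + stdKernel d K (sphInner (x e.1.1) (x e.1.2)) *
          stdKernel d K (sphInner (y e.1.1) (y e.1.2))) := by
  set p := edgeDensity d K with hp
  have hp1 : 0 < 1 - p := by linarith
  have h := sum_graph_prod (n := n) fun e b =>
    (if b then p else 1 - p)⁻¹ *
    ((if b then (K (sphInner (x e.1.1) (x e.1.2)) : ℝ)
    else 1 - (K (sphInner (x e.1.1) (x e.1.2)) : ℝ)) *
    (if b then (K (sphInner (y e.1.1) (y e.1.2)) : ℝ)
    else 1 - (K (sphInner (y e.1.1) (y e.1.2)) : ℝ)))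
  simp only [likelihood, nullLikelihood, ← Finset.prod_inv_distrib, ← Finset.prod_mul_distrib]
  rw [h]
  refine Finset.prod_congr rfl fun e _ => ?_
  have hs : Real.sqrt (p * (1 - p)) * Real.sqrt (p * (1 - p)) = p * (1 - p) :=
    Real.mul_self_sqrt (by positivity)
  simp only [stdKernel, ← hp, if_true, div_mul_div_comm, hs, Bool.false_eq_true, if_false]
  field_simp
  ring

theorem measurable_sphInner {d : ℕ} {α : Type*} [MeasurableSpace α] {f g : α → Sph d}
    (hf : Measurable f) (hg : Measurable g) : Measurable fun a => sphInner (f a) (g a) := by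
  refine Measurable.subtype_mk ?_
  fun_prop

theorem measurable_likelihood {n d : ℕ} {K : Set.Icc (-1 : ℝ) 1 → unitInterval}
    (hK : Measurable K) (a : Graph n) :
    Measurable fun x : Fin n → Sph d => likelihood K x a := by
  unfold likelihood
  refine Finset.measurable_prod _ fun e _ => ?_
  have h : Measurable fun x : Fin n → Sph d => (K (sphInner (x e.1.1) (x e.1.2)) : ℝ) :=
    measurable_subtype_coe.comp (hK.comp (measurable_sphInner (by fun_prop) (by fun_prop)))
  by_cases ha : a e = true
  · simpa [ha] using h
  · simpa [ha] using h.const_sub 1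

theorem measurable_likelihood_prod {n d : ℕ} {K : Set.Icc (-1 : ℝ) 1 → unitInterval}
    (hK : Measurable K) :
    Measurable fun w : (Fin n → Sph d) × Graph n => likelihood K w.1 w.2 :=
  measurable_from_prod_countable_left fun a => measurable_likelihood hK a

theorem lintegral_rggLaw {n d : ℕ} {K : Set.Icc (-1 : ℝ) 1 → unitInterval}
    (hK : Measurable K) {f : (Fin n → Sph d) × Graph n → ENNReal} (hf : Measurable f) :
    ∫⁻ w, f w ∂(rggLaw n d K) =
      ∑ a, ∫⁻ x, ENNReal.ofReal (likelihood K x a) * f (x, a) ∂(latentLaw n d) := by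
  have hm : Measurable fun w : (Fin n → Sph d) × Graph n =>
      ENNReal.ofReal (likelihood K w.1 w.2) := (measurable_likelihood_prod hK).ennreal_ofReal
  rw [rggLaw, lintegral_withDensity_eq_lintegral_mul _ hm hf,
    lintegral_prod_symm _ (hm.mul hf).aemeasurable, lintegral_count, tsum_fintype]
  rfl

theorem measurable_gram {n d : ℕ} : Measurable (gram (n := n) (d := d)) :=
  continuous_gram.measurable

theorem rggLaw_map_snd_singleton {n d : ℕ} {K : Set.Icc (-1 : ℝ) 1 → unitInterval}
    (hK : Measurable K) (a : Graph n) :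
    (rggLaw n d K).map Prod.snd {a} =
      ∫⁻ x, ENNReal.ofReal (likelihood K x a) ∂(latentLaw n d) := by
  have hs : MeasurableSet (Prod.snd ⁻¹' {a} : Set ((Fin n → Sph d) × Graph n)) :=
    measurable_snd (measurableSet_singleton a)
  rw [Measure.map_apply measurable_snd (measurableSet_singleton a), ← lintegral_indicator_one hs,
    lintegral_rggLaw hK (measurable_one.indicator hs), Finset.sum_eq_single a]
  · simp [Set.indicator]
  · intro b _ hb
    simp [Set.indicator, hb]
  · simp

theorem posteriorLaw_apply {n d : ℕ} {K : Set.Icc (-1 : ℝ) 1 → unitInterval}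
    (hK : Measurable K) (a : Graph n)
    (ha : ∫⁻ x, ENNReal.ofReal (likelihood K x a) ∂(latentLaw n d) ≠ 0)
    {S : Set (Fin n → Fin n → ℝ)} (hS : MeasurableSet S) :
    posteriorLaw n d K a S = (∫⁻ x, ENNReal.ofReal (likelihood K x a) ∂(latentLaw n d))⁻¹ *
      ∫⁻ y in {y | gram y ∈ S}, ENNReal.ofReal (likelihood K y a) ∂(latentLaw n d) := by
  have hg : Measurable fun w : (Fin n → Sph d) × Graph n => gram w.1 :=
    measurable_gram.comp measurable_fst
  have hmap := rggLaw_map_snd_singleton (d := d) hK a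
  have hmeas : MeasurableSet {y : Fin n → Sph d | gram y ∈ S} := measurable_gram hS
  have hs : MeasurableSet ((fun w : (Fin n → Sph d) × Graph n => (w.2, gram w.1)) ⁻¹' ({a} ×ˢ S)) :=
    (measurable_snd.prodMk hg) ((measurableSet_singleton a).prod hS)
  rw [posteriorLaw, condDistrib_apply_of_ne_zero hg a (by rw [hmap]; exact ha), hmap]
  congr 1
  rw [Measure.map_apply (measurable_snd.prodMk hg) ((measurableSet_singleton a).prod hS),
    ← lintegral_indicator_one hs, lintegral_rggLaw hK (measurable_one.indicator hs),
    Finset.sum_eq_single a, ← lintegral_indicator hmeas]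
  · refine lintegral_congr fun x => ?_
    by_cases hx : gram x ∈ S <;> simp [Set.indicator, hx]
  · intro b _ hb
    simp [Set.indicator, hb]
  · simp

/-- The pairs of latent configurations with overlap at least `s`. -/
def overlapPairs (n d : ℕ) (s : ℝ) : Set ((Fin n → Sph d) × (Fin n → Sph d)) :=
  {w | s ≤ frobInner (gram w.2) (gram w.1)}

theorem measurable_frobInner_gram {n d : ℕ} :
    Measurable fun w : (Fin n → Fin n → ℝ) × (Fin n → Sph d) => frobInner w.1 (gram w.2) := by
  refine Finset.measurable_fun_sum _ fun i _ => Finset.measurable_fun_sum _ fun j _ =>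
    Measurable.mul ?_ ((continuous_gram_apply i j).measurable.comp measurable_snd)
  exact (measurable_pi_apply j).comp ((measurable_pi_apply i).comp measurable_fst)

theorem measurableSet_overlapPairs (n d : ℕ) (s : ℝ) : MeasurableSet (overlapPairs n d s) := by
  refine measurableSet_le measurable_const ?_
  unfold frobInner
  exact Finset.measurable_fun_sum _ fun i _ => Finset.measurable_fun_sum _ fun j _ =>
    Measurable.mul ((continuous_gram_apply i j).measurable.comp measurable_snd)
      ((continuous_gram_apply i j).measurable.comp measurable_fst)

theorem measurableSet_overlapEvent (n d : ℕ) (s : ℝ) : MeasurableSet (overlapEvent n d s) :=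
  measurableSet_le measurable_const (measurable_frobInner_gram.comp
    (measurable_snd.prodMk (measurable_fst.comp measurable_fst)))

instance instIsMarkovKernelPosteriorLaw (n d : ℕ) (K : Set.Icc (-1 : ℝ) 1 → unitInterval) :
    IsMarkovKernel (posteriorLaw n d K) := by
  unfold posteriorLaw; infer_instance

/-- The probability of the overlap event, disintegrated over graphs and latent points. -/
theorem replicaLaw_overlapEvent {n d : ℕ} {K : Set.Icc (-1 : ℝ) 1 → unitInterval}
    (hK : Measurable K) (s : ℝ) :
    replicaLaw n d K (overlapEvent n d s) = ∑ a, ∫⁻ x, ENNReal.ofReal (likelihood K x a) *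
      posteriorLaw n d K a {Y | s ≤ frobInner Y (gram x)} ∂(latentLaw n d) := by
  rw [replicaLaw, Measure.compProd_apply (measurableSet_overlapEvent n d s),
    lintegral_rggLaw hK (Kernel.measurable_kernel_prodMk_left (measurableSet_overlapEvent n d s))]
  rfl

/-- Contribution of a single graph `a`, with an arbitrary threshold `c` for its marginal
probability. If that probability is at most `c` the contribution is at most `c`; otherwise the
normalization of the posterior costs at most a factor `c⁻¹`. -/
theorem lintegral_likelihood_mul_posteriorLaw_le {n d : ℕ}
    {K : Set.Icc (-1 : ℝ) 1 → unitInterval} (hK : Measurable K) (a : Graph n) (s : ℝ)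
    {G : Set (Fin n → Sph d)} (hG : MeasurableSet G) (c : ENNReal) :
    ∫⁻ x, ENNReal.ofReal (likelihood K x a) *
        posteriorLaw n d K a {Y | s ≤ frobInner Y (gram x)} ∂(latentLaw n d)
      ≤ c + 2 * ∫⁻ x in Gᶜ, ENNReal.ofReal (likelihood K x a) ∂(latentLaw n d) +
        c⁻¹ * ∫⁻ x in G, ∫⁻ y in G, (overlapPairs n d s).indicator 1 (x, y) *
          (ENNReal.ofReal (likelihood K x a) * ENNReal.ofReal (likelihood K y a))
          ∂(latentLaw n d) ∂(latentLaw n d) := by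
  set μ := latentLaw n d with hμ
  set l : (Fin n → Sph d) → ENNReal := fun x => ENNReal.ofReal (likelihood K x a) with hl
  have hlm : Measurable l := (measurable_likelihood hK a).ennreal_ofReal
  set Z := ∫⁻ x, l x ∂μ with hZ
  have hZtop : Z ≠ ⊤ := by
    refine ne_of_lt (lt_of_le_of_lt (lintegral_mono (g := fun _ => 1) fun x => ?_) ?_)
    · exact ENNReal.ofReal_le_one.2 (likelihood_le_one K x a)
    · simp [measure_lt_top]
  have hπ1 : ∀ x, l x * posteriorLaw n d K a {Y | s ≤ frobInner Y (gram x)} ≤ l x := fun x =>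
    mul_le_of_le_one_right' prob_le_one
  rcases le_or_gt Z c with hc | hc
  · calc _ ≤ Z := lintegral_mono hπ1
      _ ≤ c := hc
      _ ≤ _ := by rw [add_assoc]; exact le_self_add
  have hZ0 : Z ≠ 0 := (pos_of_gt hc).ne'
  set I := (overlapPairs n d s).indicator
    (1 : (Fin n → Sph d) × (Fin n → Sph d) → ENNReal) with hI
  have hIm : Measurable I := measurable_one.indicator (measurableSet_overlapPairs n d s)
  have hpost : ∀ x, posteriorLaw n d K a {Y | s ≤ frobInner Y (gram x)} ≤
      Z⁻¹ * (∫⁻ y in Gᶜ, l y ∂μ) + Z⁻¹ * ∫⁻ y in G, I (x, y) * l y ∂μ := by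
    intro x
    have hS : MeasurableSet {Y : Fin n → Fin n → ℝ | s ≤ frobInner Y (gram x)} :=
      measurableSet_le measurable_const
        (measurable_frobInner_gram.comp (measurable_id.prodMk measurable_const))
    rw [posteriorLaw_apply hK a hZ0 hS, ← mul_add]
    gcongr
    calc _ = ∫⁻ y, I (x, y) * l y ∂μ := by
          rw [← lintegral_indicator (show MeasurableSet {y : Fin n → Sph d | gram y ∈
            {Y : Fin n → Fin n → ℝ | s ≤ frobInner Y (gram x)}} from measurable_gram hS)]
          refine lintegral_congr fun y => ?_
          by_cases hy : s ≤ frobInner (gram y) (gram x) <;>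
            simp [hI, Set.indicator, overlapPairs, hy, hl]
      _ = ∫⁻ y in Gᶜ, I (x, y) * l y ∂μ + ∫⁻ y in G, I (x, y) * l y ∂μ := by
          rw [add_comm, lintegral_add_compl _ hG]
      _ ≤ _ := by
          gcongr with y
          refine mul_le_of_le_one_left' ?_
          simp only [hI, Set.indicator]
          split_ifs <;> simp
  calc _ = ∫⁻ x in Gᶜ, l x * posteriorLaw n d K a {Y | s ≤ frobInner Y (gram x)} ∂μ +
        ∫⁻ x in G, l x * posteriorLaw n d K a {Y | s ≤ frobInner Y (gram x)} ∂μ := by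
        rw [add_comm, lintegral_add_compl _ hG]
    _ ≤ ∫⁻ x in Gᶜ, l x ∂μ + ∫⁻ x in G, (Z⁻¹ * (∫⁻ y in Gᶜ, l y ∂μ) * l x +
          Z⁻¹ * ∫⁻ y in G, I (x, y) * (l x * l y) ∂μ) ∂μ := by
        refine add_le_add (lintegral_mono hπ1) (lintegral_mono fun x => ?_)
        calc _ ≤ l x * (Z⁻¹ * (∫⁻ y in Gᶜ, l y ∂μ) + Z⁻¹ * ∫⁻ y in G, I (x, y) * l y ∂μ) := by
              gcongr; exact hpost x
          _ = _ := by
              have h1 : ∫⁻ y in G, I (x, y) * (l x * l y) ∂μ =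
                  l x * ∫⁻ y in G, I (x, y) * l y ∂μ := by
                rw [← lintegral_const_mul _ (by fun_prop)]
                exact lintegral_congr fun y => by ring
              rw [h1]; ring
    _ = ∫⁻ x in Gᶜ, l x ∂μ + (Z⁻¹ * (∫⁻ y in Gᶜ, l y ∂μ) * ∫⁻ x in G, l x ∂μ +
          Z⁻¹ * ∫⁻ x in G, ∫⁻ y in G, I (x, y) * (l x * l y) ∂μ ∂μ) := by
        rw [lintegral_add_left (by fun_prop), lintegral_const_mul _ hlm, lintegral_const_mul _]
        exact Measurable.lintegral_prod_right' (f := fun w : (Fin n → Sph d) × (Fin n → Sph d) =>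
          I w * (l w.1 * l w.2)) (by fun_prop)
    _ ≤ ∫⁻ x in Gᶜ, l x ∂μ + (∫⁻ y in Gᶜ, l y ∂μ +
          c⁻¹ * ∫⁻ x in G, ∫⁻ y in G, I (x, y) * (l x * l y) ∂μ ∂μ) := by
        gcongr
        · calc Z⁻¹ * (∫⁻ y in Gᶜ, l y ∂μ) * ∫⁻ x in G, l x ∂μ
              ≤ Z⁻¹ * (∫⁻ y in Gᶜ, l y ∂μ) * Z := by
                gcongr
                exact setLIntegral_le_lintegral _ _
            _ = (Z⁻¹ * Z) * ∫⁻ y in Gᶜ, l y ∂μ := by ring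
            _ = _ := by rw [ENNReal.inv_mul_cancel hZ0 hZtop, one_mul]
    _ ≤ _ := by
        rw [← add_assoc, ← two_mul, add_assoc]
        exact le_add_self

/-- The posterior overlap is controlled by a second moment of the likelihood ratio with respect to
the null model, truncated to a set `G` of typical latent points. Graphs whose likelihood ratio is
less than `ε` have total probability at most `ε`, so the normalization of the posterior costs only
a factor `ε⁻¹`. -/
theorem replicaLaw_overlapEvent_le {n d : ℕ} [NeZero d] {K : Set.Icc (-1 : ℝ) 1 → unitInterval}
    (hK : Measurable K) (h0 : 0 < edgeDensity d K) (h1 : edgeDensity d K < 1) (s : ℝ)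
    {G : Set (Fin n → Sph d)} (hG : MeasurableSet G) {ε : ℝ} (hε : 0 < ε) :
    replicaLaw n d K (overlapEvent n d s) ≤ ENNReal.ofReal ε + 2 * latentLaw n d Gᶜ +
      ENNReal.ofReal ε⁻¹ * ∫⁻ x in G, ∫⁻ y in G, (overlapPairs n d s).indicator 1 (x, y) *
        ENNReal.ofReal (∏ e : Pairs n, (1 + stdKernel d K (sphInner (x e.1.1) (x e.1.2)) *
          stdKernel d K (sphInner (y e.1.1) (y e.1.2)))) ∂(latentLaw n d) ∂(latentLaw n d) := by
  set p := edgeDensity d K with hp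
  set μ := latentLaw n d with hμ
  set I := (overlapPairs n d s).indicator
    (1 : (Fin n → Sph d) × (Fin n → Sph d) → ENNReal) with hI
  have hIm : Measurable I := measurable_one.indicator (measurableSet_overlapPairs n d s)
  have hq : ∀ a : Graph n, 0 < nullLikelihood p a := nullLikelihood_pos h0 h1
  have hlm : ∀ a : Graph n, Measurable fun x : Fin n → Sph d =>
      ENNReal.ofReal (likelihood K x a) := fun a => (measurable_likelihood hK a).ennreal_ofReal
  rw [replicaLaw_overlapEvent hK]
  refine (Finset.sum_le_sum fun a _ => lintegral_likelihood_mul_posteriorLaw_le hK a s hG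
    (ENNReal.ofReal (ε * nullLikelihood p a))).trans ?_
  rw [Finset.sum_add_distrib, Finset.sum_add_distrib]
  refine add_le_add (add_le_add (le_of_eq ?_) (le_of_eq ?_)) (le_of_eq ?_)
  · rw [← ENNReal.ofReal_sum_of_nonneg fun a _ => (mul_pos hε (hq a)).le, ← Finset.mul_sum,
      sum_nullLikelihood, mul_one]
  · rw [← Finset.mul_sum, ← lintegral_finsetSum _ fun a _ => hlm a]
    have : ∀ x : Fin n → Sph d, ∑ a : Graph n, ENNReal.ofReal (likelihood K x a) = 1 := by
      intro x
      rw [← ENNReal.ofReal_sum_of_nonneg fun a _ => likelihood_nonneg K x a, sum_likelihood,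
        ENNReal.ofReal_one]
    simp_rw [this]
    simp [hμ]
  · have hF : ∀ a : Graph n, Measurable fun w : (Fin n → Sph d) × (Fin n → Sph d) =>
        I w * (ENNReal.ofReal (likelihood K w.1 a) * ENNReal.ofReal (likelihood K w.2 a)) :=
      fun a => hIm.mul (((hlm a).comp measurable_fst).mul ((hlm a).comp measurable_snd))
    calc _ = ∑ a : Graph n, ENNReal.ofReal ε⁻¹ * (ENNReal.ofReal (nullLikelihood p a)⁻¹ *
          ∫⁻ x in G, ∫⁻ y in G, I (x, y) * (ENNReal.ofReal (likelihood K x a) *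
            ENNReal.ofReal (likelihood K y a)) ∂μ ∂μ) := by
          refine Finset.sum_congr rfl fun a _ => ?_
          rw [← mul_assoc, ← ENNReal.ofReal_mul (by positivity), ← mul_inv,
            ENNReal.ofReal_inv_of_pos (mul_pos hε (hq a))]
      _ = ENNReal.ofReal ε⁻¹ * ∫⁻ x in G, ∫⁻ y in G, ∑ a : Graph n,
          ENNReal.ofReal (nullLikelihood p a)⁻¹ * (I (x, y) * (ENNReal.ofReal (likelihood K x a) *
            ENNReal.ofReal (likelihood K y a))) ∂μ ∂μ := by
          rw [← Finset.mul_sum]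
          congr 1
          have hin : ∀ x, ∫⁻ y in G, ∑ a : Graph n, ENNReal.ofReal (nullLikelihood p a)⁻¹ *
              (I (x, y) * (ENNReal.ofReal (likelihood K x a) *
                ENNReal.ofReal (likelihood K y a))) ∂μ = ∑ a : Graph n,
              ENNReal.ofReal (nullLikelihood p a)⁻¹ * ∫⁻ y in G,
              (I (x, y) * (ENNReal.ofReal (likelihood K x a) *
                ENNReal.ofReal (likelihood K y a))) ∂μ := by
            intro x
            have hFx : ∀ a : Graph n, Measurable fun y => I (x, y) *
                (ENNReal.ofReal (likelihood K x a) * ENNReal.ofReal (likelihood K y a)) :=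
              fun a => (hF a).comp measurable_prodMk_left
            rw [lintegral_finsetSum _ fun a _ => (hFx a).const_mul _]
            exact Finset.sum_congr rfl fun a _ => lintegral_const_mul _ (hFx a)
          simp_rw [hin]
          have hout : ∀ a : Graph n, Measurable fun x => ∫⁻ y in G,
              (I (x, y) * (ENNReal.ofReal (likelihood K x a) *
                ENNReal.ofReal (likelihood K y a))) ∂μ := fun a =>
            Measurable.lintegral_prod_right' (hF a)
          rw [lintegral_finsetSum _ fun a _ => (hout a).const_mul _]
          exact Finset.sum_congr rfl fun a _ => (lintegral_const_mul _ (hout a)).symm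
      _ = _ := by
          congr 1
          refine lintegral_congr fun x => lintegral_congr fun y => ?_
          rw [← sum_likelihood_mul_div K h0 h1, ENNReal.ofReal_sum_of_nonneg, Finset.mul_sum]
          · refine Finset.sum_congr rfl fun a _ => ?_
            rw [ENNReal.ofReal_mul (inv_pos.2 (hq a)).le,
              ENNReal.ofReal_mul (likelihood_nonneg K x a)]
            ring
          · intro a _
            exact mul_nonneg (inv_pos.2 (hq a)).le
              (mul_nonneg (likelihood_nonneg K x a) (likelihood_nonneg K y a))

/-! ### The truncated second moment -/

/-- The matrix with zero diagonal and entries `f ⟨x_i, x_j⟩` off the diagonal. -/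
noncomputable def kernelMatrix {n d : ℕ} (f : Set.Icc (-1 : ℝ) 1 → ℝ) (x : Fin n → Sph d) :
    Fin n → Fin n → ℝ :=
  fun i j => if i = j then 0 else f (sphInner (x i) (x j))

theorem sphInner_comm {d : ℕ} (x y : Sph d) : sphInner x y = sphInner y x :=
  Subtype.ext (real_inner_comm _ _)

theorem kernelMatrix_self {n d : ℕ} (f : Set.Icc (-1 : ℝ) 1 → ℝ) (x : Fin n → Sph d) (i : Fin n) :
    kernelMatrix f x i i = 0 := if_pos rfl

theorem kernelMatrix_symm {n d : ℕ} (f : Set.Icc (-1 : ℝ) 1 → ℝ) (x : Fin n → Sph d)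
    (i j : Fin n) : kernelMatrix f x i j = kernelMatrix f x j i := by
  unfold kernelMatrix
  rw [sphInner_comm]
  simp only [eq_comm]

theorem sum_pairs {n : ℕ} (f : Fin n → Fin n → ℝ) (hs : ∀ i j, f i j = f j i)
    (h0 : ∀ i, f i i = 0) : ∑ e : Pairs n, f e.1.1 e.1.2 = 1 / 2 * ∑ i, ∑ j, f i j := by
  have h1 : ∑ e : Pairs n, f e.1.1 e.1.2 = ∑ i, ∑ j, if i < j then f i j else 0 := by
    rw [← Fintype.sum_prod_type' (f := fun i j => if i < j then f i j else 0),
      ← Finset.sum_filter]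
    exact (Finset.sum_subtype (p := fun e : Fin n × Fin n => e.1 < e.2)
      (Finset.univ.filter fun e : Fin n × Fin n => e.1 < e.2) (by simp)
      (fun e => f e.1 e.2)).symm
  have h2 : ∑ i, ∑ j, (if j < i then f i j else 0) = ∑ i, ∑ j, if i < j then f i j else 0 := by
    rw [Finset.sum_comm]
    exact Finset.sum_congr rfl fun i _ => Finset.sum_congr rfl fun j _ => by rw [hs]
  have h3 : ∑ i, ∑ j, f i j = ∑ i, ∑ j, (if i < j then f i j else 0) +
      ∑ i, ∑ j, (if j < i then f i j else 0) := by
    rw [← Finset.sum_add_distrib]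
    refine Finset.sum_congr rfl fun i _ => ?_
    rw [← Finset.sum_add_distrib]
    refine Finset.sum_congr rfl fun j _ => ?_
    rcases lt_trichotomy i j with h | h | h
    · simp [h, h.not_gt]
    · subst h; simp [h0]
    · simp [h, h.not_gt]
  rw [h1, h3, h2]
  ring

theorem sum_pairs_kernel_mul {n d : ℕ} (f : Set.Icc (-1 : ℝ) 1 → ℝ) (x y : Fin n → Sph d) :
    ∑ e : Pairs n, f (sphInner (x e.1.1) (x e.1.2)) * f (sphInner (y e.1.1) (y e.1.2))
      = 1 / 2 * frobInner (kernelMatrix f x) (kernelMatrix f y) := by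
  unfold frobInner
  rw [← sum_pairs (fun i j => kernelMatrix f x i j * kernelMatrix f y i j)
    (fun i j => by rw [kernelMatrix_symm f x, kernelMatrix_symm f y])
    (fun i => by rw [kernelMatrix_self, zero_mul])]
  refine Finset.sum_congr rfl fun e _ => ?_
  simp [kernelMatrix, e.2.ne]

/-- Splitting off the linear part of the kernel. -/
theorem frobInner_kernelMatrix {n d : ℕ} (f : Set.Icc (-1 : ℝ) 1 → ℝ) (β : ℝ)
    (x y : Fin n → Sph d) :
    frobInner (kernelMatrix f x) (kernelMatrix f y) =
      β ^ 2 * frobInner (gram x) (gram y)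
      + β * frobInner (kernelMatrix (fun t => f t - β * t) y) (gram x)
      + β * frobInner (kernelMatrix (fun t => f t - β * t) x) (gram y)
      + frobInner (kernelMatrix (fun t => f t - β * t) x)
          (kernelMatrix (fun t => f t - β * t) y) := by
  simp only [frobInner, Finset.mul_sum, ← Finset.sum_add_distrib]
  refine Finset.sum_congr rfl fun i _ => Finset.sum_congr rfl fun j _ => ?_
  by_cases h : i = j
  · subst h; simp [kernelMatrix_self, gram_self]
  · simp only [kernelMatrix, gram, h, if_false]
    ring

theorem frobInner_le {n : ℕ} (M N : Fin n → Fin n → ℝ) {F : ℝ}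
    (hM : ∑ i, ∑ j, M i j ^ 2 ≤ F ^ 2) (hN : ∑ i, ∑ j, N i j ^ 2 ≤ F ^ 2) :
    frobInner M N ≤ F ^ 2 := by
  calc frobInner M N ≤ ∑ i, ∑ j, (M i j ^ 2 + N i j ^ 2) / 2 := by
        refine Finset.sum_le_sum fun i _ => Finset.sum_le_sum fun j _ => ?_
        nlinarith [sq_nonneg (M i j - N i j)]
    _ = (∑ i, ∑ j, M i j ^ 2 + ∑ i, ∑ j, N i j ^ 2) / 2 := by
        simp_rw [← Finset.sum_div, Finset.sum_add_distrib]
    _ ≤ F ^ 2 := by linarith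

/-- The second moment of the entries, from the fourth by Cauchy–Schwarz. -/
theorem IsTypical.sum_gram_sq_le {n d : ℕ} [NeZero d] {C : ℝ} (hC : 1 ≤ C) {x : Fin n → Sph d}
    (hx : IsTypical C x) : ∑ i, ∑ j, gram x i j ^ 2 ≤ C * (n ^ 2 / d) := by
  have hd : (0 : ℝ) < d := by exact_mod_cast Nat.pos_of_ne_zero (NeZero.ne d)
  have h1 : (∑ i, ∑ j, gram x i j ^ 2) ^ 2 ≤ (n : ℝ) ^ 2 * ∑ i, ∑ j, gram x i j ^ 4 := by
    have h := Finset.sum_mul_sq_le_sq_mul_sq (Finset.univ : Finset (Fin n × Fin n))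
      (fun _ => (1 : ℝ)) (fun p => gram x p.1 p.2 ^ 2)
    simp only [Fintype.sum_prod_type, one_mul, one_pow, ← pow_mul] at h
    have h2 : (∑ _x : Fin n, ∑ _y : Fin n, (1 : ℝ)) = (n : ℝ) ^ 2 := by simp [sq]
    rwa [h2] at h
  refine (sq_le_sq₀ (by positivity) (by positivity)).1 (h1.trans ?_)
  calc (n : ℝ) ^ 2 * ∑ i, ∑ j, gram x i j ^ 4 ≤ (n : ℝ) ^ 2 * (C * (n ^ 2 / d ^ 2)) := by
        gcongr; exact hx.four
    _ = C * ((n : ℝ) ^ 2 / d) ^ 2 := by ring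
    _ ≤ C ^ 2 * ((n : ℝ) ^ 2 / d) ^ 2 := by
        gcongr; nlinarith
    _ = _ := by ring

/-- Higher-order terms contribute a matrix of Frobenius norm `ρ n / d`: entries of typical Gram
matrices lie where the kernel is within `ρ / d + 2 ρ t ^ 2` of its linear part, and their fourth
moment is under control. -/
theorem IsTypical.sum_kernelMatrix_sq_le {n d : ℕ} {C ρ r : ℝ} (hC : 1 ≤ C)
    (hr : 0 ≤ r) {g : Set.Icc (-1 : ℝ) 1 → ℝ}
    (hg : ∀ t : Set.Icc (-1 : ℝ) 1, r * |(t : ℝ)| ≤ 1 / 2 → |g t| ≤ ρ / d + 2 * ρ * (t : ℝ) ^ 2)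
    (hrn : r * (C * √(Real.log n / d)) ≤ 1 / 2) {x : Fin n → Sph d}
    (hx : IsTypical C x) :
    ∑ i, ∑ j, kernelMatrix g x i j ^ 2 ≤ (10 * C * ρ * n / d) ^ 2 := by
  have h1 : ∀ i j, kernelMatrix g x i j ^ 2 ≤ 2 * (ρ / d) ^ 2 + 8 * ρ ^ 2 * gram x i j ^ 4 := by
    intro i j
    by_cases h : i = j
    · subst h; rw [kernelMatrix_self, zero_pow two_ne_zero]; positivity
    have h2 : gram x i j = sphInner (x i) (x j) := if_neg h
    have h3 := hg (sphInner (x i) (x j)) (by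
      rw [← h2]; exact (mul_le_mul_of_nonneg_left (hx.entry i j) hr).trans hrn)
    rw [← h2] at h3
    have h4 : kernelMatrix g x i j = g (sphInner (x i) (x j)) := if_neg h
    rw [h4, ← sq_abs]
    calc |g (sphInner (x i) (x j))| ^ 2 ≤ (ρ / d + 2 * ρ * gram x i j ^ 2) ^ 2 := by gcongr
      _ ≤ _ := by nlinarith [sq_nonneg (ρ / d - 2 * ρ * gram x i j ^ 2)]
  calc _ ≤ ∑ i, ∑ j, (2 * (ρ / d) ^ 2 + 8 * ρ ^ 2 * gram x i j ^ 4) :=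
        Finset.sum_le_sum fun i _ => Finset.sum_le_sum fun j _ => h1 i j
    _ = 2 * (ρ / d) ^ 2 * n ^ 2 + 8 * ρ ^ 2 * ∑ i, ∑ j, gram x i j ^ 4 := by
        simp_rw [Finset.sum_add_distrib, ← Finset.mul_sum]
        simp
        ring
    _ ≤ 2 * (ρ / d) ^ 2 * n ^ 2 + 8 * ρ ^ 2 * (C * (n ^ 2 / d ^ 2)) := by
        gcongr; exact hx.four
    _ = (2 + 8 * C) * (ρ * n / d) ^ 2 := by ring
    _ ≤ (100 * C ^ 2) * (ρ * n / d) ^ 2 := by gcongr; nlinarith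
    _ = _ := by ring

/-- The factors are nonnegative because `K` takes values in `[0, 1]`. -/
theorem prod_one_add_stdKernel_le {n d : ℕ} (K : Set.Icc (-1 : ℝ) 1 → unitInterval)
    (h0 : 0 < edgeDensity d K) (h1 : edgeDensity d K < 1) (x y : Fin n → Sph d) :
    ∏ e : Pairs n, (1 + stdKernel d K (sphInner (x e.1.1) (x e.1.2)) *
          stdKernel d K (sphInner (y e.1.1) (y e.1.2)))
      ≤ Real.exp (1 / 2 * frobInner (kernelMatrix (stdKernel d K) x)
          (kernelMatrix (stdKernel d K) y)) := by
  rw [← sum_pairs_kernel_mul, Real.exp_sum]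
  refine Finset.prod_le_prod (fun e _ => ?_) fun e _ => by
    rw [add_comm]; exact Real.add_one_le_exp _
  set p := edgeDensity d K with hp
  have hp1 : 0 < 1 - p := by linarith
  have hs : Real.sqrt (p * (1 - p)) * Real.sqrt (p * (1 - p)) = p * (1 - p) :=
    Real.mul_self_sqrt (by positivity)
  simp only [stdKernel, ← hp, div_mul_div_comm, hs]
  generalize K (sphInner (x e.1.1) (x e.1.2)) = a
  generalize K (sphInner (y e.1.1) (y e.1.2)) = b
  have h3 : 1 + ((a : ℝ) - p) * ((b : ℝ) - p) / (p * (1 - p))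
      = ((a : ℝ) * b * (1 - p) + (1 - a) * (1 - b) * p) / (p * (1 - p)) := by
    field_simp; ring
  rw [h3]
  have ha := a.2.1
  have hb := b.2.1
  have ha' : 0 ≤ 1 - (a : ℝ) := sub_nonneg.2 a.2.2
  have hb' : 0 ≤ 1 - (b : ℝ) := sub_nonneg.2 b.2.2
  positivity

theorem exp_add_three_le (a b c : ℝ) :
    Real.exp (a + b + c) ≤ Real.exp (3 * a) + Real.exp (3 * b) + Real.exp (3 * c) := by
  have h : a + b + c ≤ 3 * max a (max b c) := by
    linarith [le_max_left a (max b c), le_max_right a (max b c), le_max_left b c,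
      le_max_right b c]
  refine (Real.exp_le_exp.2 h).trans ?_
  have ha := Real.exp_pos (3 * a)
  have hb := Real.exp_pos (3 * b)
  have hc := Real.exp_pos (3 * c)
  rcases max_choice a (max b c) with h1 | h1 <;> rw [h1]
  · linarith
  rcases max_choice b c with h2 | h2 <;> rw [h2] <;> linarith

theorem measurable_stdKernel {d : ℕ} {K : Set.Icc (-1 : ℝ) 1 → unitInterval} (hK : Measurable K) :
    Measurable (stdKernel d K) := by
  unfold stdKernel
  exact ((measurable_subtype_coe.comp hK).sub_const _).div_const _

theorem measurable_frobInner_kernelMatrix {n d : ℕ} {g : Set.Icc (-1 : ℝ) 1 → ℝ}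
    (hg : Measurable g) : Measurable fun w : (Fin n → Sph d) × (Fin n → Sph d) =>
      frobInner (kernelMatrix g w.1) (gram w.2) := by
  unfold frobInner
  refine Finset.measurable_fun_sum _ fun i _ => Finset.measurable_fun_sum _ fun j _ =>
    Measurable.mul ?_ ((continuous_gram_apply i j).measurable.comp measurable_snd)
  unfold kernelMatrix
  by_cases h : i = j
  · simp only [h, if_true]; exact measurable_const
  · simp only [h, if_false]
    exact hg.comp (measurable_sphInner (by fun_prop) (by fun_prop))

theorem measurable_frobInner_gram_gram {n d : ℕ} :
    Measurable fun w : (Fin n → Sph d) × (Fin n → Sph d) =>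
      frobInner (gram w.1) (gram w.2) := by
  unfold frobInner
  exact Finset.measurable_fun_sum _ fun i _ => Finset.measurable_fun_sum _ fun j _ =>
    Measurable.mul ((continuous_gram_apply i j).measurable.comp measurable_fst)
      ((continuous_gram_apply i j).measurable.comp measurable_snd)

theorem setLIntegral_setLIntegral_le {α : Type*} [MeasurableSpace α] {P : Measure α}
    [IsProbabilityMeasure P] {G : Set α} (hG : MeasurableSet G) {f : α → α → ENNReal}
    {c : ENNReal} (h : ∀ x ∈ G, ∫⁻ y, f x y ∂P ≤ c) : ∫⁻ x in G, ∫⁻ y in G, f x y ∂P ∂P ≤ c := by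
  calc _ ≤ ∫⁻ _ in G, c ∂P := setLIntegral_mono' hG fun x hx =>
        (setLIntegral_le_lintegral _ _).trans (h x hx)
    _ = c * P G := by rw [setLIntegral_const]
    _ ≤ c := mul_le_of_le_one_right' prob_le_one

/-- Pointwise bound of the integrand by three exponentials, each of which is a chaos in one of the
two configurations once the other one is fixed. -/
theorem indicator_mul_prod_le {n d : ℕ} {K : Set.Icc (-1 : ℝ) 1 → unitInterval}
    (h0 : 0 < edgeDensity d K) (h1 : edgeDensity d K < 1) {β F η : ℝ} (hη : 0 ≤ η) (s : ℝ)
    {g : Set.Icc (-1 : ℝ) 1 → ℝ} (hg : g = fun t => stdKernel d K t - β * t)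
    {x y : Fin n → Sph d}
    (hx : ∑ i, ∑ j, kernelMatrix g x i j ^ 2 ≤ F ^ 2)
    (hy : ∑ i, ∑ j, kernelMatrix g y i j ^ 2 ≤ F ^ 2) :
    (overlapPairs n d s).indicator 1 (x, y) *
        ENNReal.ofReal (∏ e : Pairs n, (1 + stdKernel d K (sphInner (x e.1.1) (x e.1.2)) *
          stdKernel d K (sphInner (y e.1.1) (y e.1.2))))
      ≤ ENNReal.ofReal (Real.exp (1 / 2 * F ^ 2 - η * s)) *
        (ENNReal.ofReal (Real.exp (3 * (β ^ 2 / 2 + η) * frobInner (gram x) (gram y))) +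
        (ENNReal.ofReal (Real.exp (3 / 2 * β * frobInner (kernelMatrix g x) (gram y))) +
        ENNReal.ofReal (Real.exp (3 / 2 * β * frobInner (kernelMatrix g y) (gram x))))) := by
  by_cases hE : (x, y) ∈ overlapPairs n d s
  swap
  · simp [hE]
  rw [Set.indicator_of_mem hE, Pi.one_apply, one_mul,
    ← ENNReal.ofReal_add (Real.exp_pos _).le (Real.exp_pos _).le,
    ← ENNReal.ofReal_add (Real.exp_pos _).le (by positivity),
    ← ENNReal.ofReal_mul (Real.exp_pos _).le]
  refine ENNReal.ofReal_le_ofReal ((prod_one_add_stdKernel_le K h0 h1 x y).trans ?_)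
  rw [frobInner_kernelMatrix _ β, ← hg]
  have hE' : s ≤ frobInner (gram x) (gram y) := by
    rw [frobInner_comm]; exact hE
  have hVW := frobInner_le _ _ hx hy
  generalize frobInner (gram x) (gram y) = a at hE' ⊢
  generalize frobInner (kernelMatrix g y) (gram x) = u
  generalize frobInner (kernelMatrix g x) (gram y) = v
  generalize frobInner (kernelMatrix g x) (kernelMatrix g y) = w at hVW ⊢
  have h3 := exp_add_three_le ((β ^ 2 / 2 + η) * a) (1 / 2 * β * v) (1 / 2 * β * u)
  rw [show 3 * ((β ^ 2 / 2 + η) * a) = 3 * (β ^ 2 / 2 + η) * a by ring,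
    show 3 * (1 / 2 * β * v) = 3 / 2 * β * v by ring,
    show 3 * (1 / 2 * β * u) = 3 / 2 * β * u by ring, add_assoc (Real.exp _)] at h3
  calc Real.exp (1 / 2 * (β ^ 2 * a + β * u + β * v + w))
      ≤ Real.exp ((1 / 2 * F ^ 2 - η * s) + ((β ^ 2 / 2 + η) * a + 1 / 2 * β * v
          + 1 / 2 * β * u)) := by
        refine Real.exp_le_exp.2 ?_
        have := mul_le_mul_of_nonneg_left hE' hη
        linarith
    _ = Real.exp (1 / 2 * F ^ 2 - η * s) *
        Real.exp ((β ^ 2 / 2 + η) * a + 1 / 2 * β * v + 1 / 2 * β * u) := by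
        rw [Real.exp_add]
    _ ≤ _ := mul_le_mul_of_nonneg_left h3 (Real.exp_pos _).le

/-- Integration of a sum of a function and the two transposes of another function. -/
theorem setLIntegral_symm_sum_le {α : Type*} [MeasurableSpace α] {P : Measure α}
    [IsProbabilityMeasure P] {G : Set α} (hG : MeasurableSet G) {f f1 f2 : α → α → ENNReal}
    (hf1 : Measurable fun w : α × α => f1 w.1 w.2) (hf2 : Measurable fun w : α × α => f2 w.1 w.2)
    {c c1 c2 : ENNReal} (h : ∀ x ∈ G, ∀ y ∈ G, f x y ≤ c * (f1 x y + (f2 x y + f2 y x)))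
    (h1 : ∀ x ∈ G, ∫⁻ y, f1 x y ∂P ≤ c1) (h2 : ∀ x ∈ G, ∫⁻ y, f2 x y ∂P ≤ c2) :
    ∫⁻ x in G, ∫⁻ y in G, f x y ∂P ∂P ≤ c * (c1 + (c2 + c2)) := by
  have hI3 : ∫⁻ x in G, ∫⁻ y in G, f2 y x ∂P ∂P = ∫⁻ x in G, ∫⁻ y in G, f2 x y ∂P ∂P :=
    (lintegral_lintegral_swap hf2.aemeasurable).symm
  have hm1 : ∀ x, Measurable fun y => f1 x y := fun x => hf1.comp measurable_prodMk_left
  have hm2 : ∀ x, Measurable fun y => f2 x y := fun x => hf2.comp measurable_prodMk_left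
  have hm3 : ∀ x, Measurable fun y => f2 y x := fun x => hf2.comp measurable_prodMk_right
  have hM1 : Measurable fun x => ∫⁻ y in G, f1 x y ∂P := Measurable.lintegral_prod_right' hf1
  have hM2 : Measurable fun x => ∫⁻ y in G, f2 x y ∂P := Measurable.lintegral_prod_right' hf2
  have hM3 : Measurable fun x => ∫⁻ y in G, f2 y x ∂P :=
    Measurable.lintegral_prod_right' (hf2.comp measurable_swap)
  have hM : Measurable fun x => (∫⁻ y in G, f1 x y ∂P) +
      ((∫⁻ y in G, f2 x y ∂P) + ∫⁻ y in G, f2 y x ∂P) := hM1.add (hM2.add hM3)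
  have hm : ∀ x, Measurable fun y => f1 x y + (f2 x y + f2 y x) :=
    fun x => (hm1 x).add ((hm2 x).add (hm3 x))
  calc _ ≤ ∫⁻ x in G, ∫⁻ y in G, c * (f1 x y + (f2 x y + f2 y x)) ∂P ∂P :=
        setLIntegral_mono' hG fun x hx => setLIntegral_mono' hG fun y hy => h x hx y hy
    _ = c * ((∫⁻ x in G, ∫⁻ y in G, f1 x y ∂P ∂P) +
          ((∫⁻ x in G, ∫⁻ y in G, f2 x y ∂P ∂P) + ∫⁻ x in G, ∫⁻ y in G, f2 y x ∂P ∂P)) := by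
        rw [← lintegral_add_left hM2, ← lintegral_add_left hM1,
          ← lintegral_const_mul _ hM]
        refine lintegral_congr fun x => ?_
        rw [lintegral_const_mul _ (hm x),
          lintegral_add_left (hm1 x), lintegral_add_left (hm2 x)]
    _ ≤ c * (c1 + (c2 + c2)) := by
        rw [hI3]
        gcongr
        · exact setLIntegral_setLIntegral_le hG h1
        · exact setLIntegral_setLIntegral_le hG h2
        · exact setLIntegral_setLIntegral_le hG h2

/-- The second moment of the likelihood ratio, truncated to typical latent points and to the event
of overlap at least `s`. The exponent splits into the overlap of the two Gram matrices, two cross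
terms between a Gram matrix and a matrix of higher-order terms, and a product of two matrices of
higher-order terms; the last one is bounded deterministically, and each of the others is a chaos
in one of the two configurations once the other one is fixed. The overlap event is handled by
exponential tilting with parameter `η`. -/
theorem truncated_second_moment_le {n d : ℕ} [NeZero d]
    {K : Set.Icc (-1 : ℝ) 1 → unitInterval} (hK : Measurable K) (h0 : 0 < edgeDensity d K)
    (h1 : edgeDensity d K < 1) {C β ρ r η : ℝ} (hC : 1 ≤ C) (hρ : 0 ≤ ρ) (hr : 0 ≤ r)
    (hη : 0 ≤ η)
    (hg : ∀ t : Set.Icc (-1 : ℝ) 1, r * |(t : ℝ)| ≤ 1 / 2 →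
      |stdKernel d K t - β * t| ≤ ρ / d + 2 * ρ * (t : ℝ) ^ 2)
    (hrn : r * (C * √(Real.log n / d)) ≤ 1 / 2)
    (hop : 3 * (β ^ 2 / 2 + η) * (C * (n / d + √(n / d))) ≤ d / 32)
    (hcross : 3 / 2 * |β| * (10 * C * ρ * n / d) ≤ d / 32) (s : ℝ) :
    ∫⁻ x in {x | IsTypical C x}, ∫⁻ y in {x | IsTypical C x},
      (overlapPairs n d s).indicator 1 (x, y) *
        ENNReal.ofReal (∏ e : Pairs n, (1 + stdKernel d K (sphInner (x e.1.1) (x e.1.2)) *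
          stdKernel d K (sphInner (y e.1.1) (y e.1.2)))) ∂(latentLaw n d) ∂(latentLaw n d)
      ≤ ENNReal.ofReal (Real.exp (1 / 2 * (10 * C * ρ * n / d) ^ 2 - η * s) *
          (Real.exp (128 * (3 * (β ^ 2 / 2 + η)) ^ 2 / d * (C * (n ^ 2 / d))) +
            2 * Real.exp (128 * (3 / 2 * β) ^ 2 / d * (10 * C * ρ * n / d) ^ 2))) := by
  have hd : (0 : ℝ) < d := by exact_mod_cast Nat.pos_of_ne_zero (NeZero.ne d)
  set μ := latentLaw n d with hμ
  set G : Set (Fin n → Sph d) := {x | IsTypical C x} with hG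
  have hGm : MeasurableSet G := measurableSet_isTypical C
  set F := 10 * C * ρ * n / d with hF
  have hF0 : 0 ≤ F := by positivity
  set g : Set.Icc (-1 : ℝ) 1 → ℝ := fun t => stdKernel d K t - β * t with hgdef
  have hgm : Measurable g :=
    (measurable_stdKernel hK).sub (measurable_subtype_coe.const_mul β)
  have hθ0 : 0 ≤ 3 * (β ^ 2 / 2 + η) := by positivity
  have hV : ∀ x ∈ G, ∑ i, ∑ j, kernelMatrix g x i j ^ 2 ≤ F ^ 2 := fun x hx =>
    IsTypical.sum_kernelMatrix_sq_le hC hr hg hrn hx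
  refine (setLIntegral_symm_sum_le hGm
    (Real.measurable_exp.comp (measurable_frobInner_gram_gram.const_mul _)).ennreal_ofReal
    (Real.measurable_exp.comp
      ((measurable_frobInner_kernelMatrix hgm).const_mul (3 / 2 * β))).ennreal_ofReal
    (fun x hx y hy => indicator_mul_prod_le h0 h1 hη s hgdef (hV x hx) (hV y hy))
    (c1 := ENNReal.ofReal (Real.exp (128 * (3 * (β ^ 2 / 2 + η)) ^ 2 / d * (C * (n ^ 2 / d)))))
    (c2 := ENNReal.ofReal (Real.exp (128 * (3 / 2 * β) ^ 2 / d * F ^ 2)))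
    (fun x hx => ?_) (fun x hx => ?_)).trans (le_of_eq ?_)
  · refine (lintegral_exp_frobInner_gram (gram_self x) (gram_symm x) hx.form (by positivity)
      (by rw [abs_of_nonneg hθ0]; exact hop)).trans
      (ENNReal.ofReal_le_ofReal (Real.exp_le_exp.2 ?_))
    gcongr
    exact IsTypical.sum_gram_sq_le hC hx
  · refine (lintegral_exp_frobInner_gram (kernelMatrix_self g x) (kernelMatrix_symm g x)
      (abs_form_le_of_frobenius _ hF0 (hV x hx)) hF0 ?_).trans
      (ENNReal.ofReal_le_ofReal (Real.exp_le_exp.2 ?_))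
    · rw [abs_mul, abs_of_pos (by norm_num : (0 : ℝ) < 3 / 2)]; exact hcross
    · gcongr
      exact hV x hx
  · rw [← ENNReal.ofReal_add (Real.exp_pos _).le (Real.exp_pos _).le,
      ← ENNReal.ofReal_add (Real.exp_pos _).le (by positivity),
      ← ENNReal.ofReal_mul (Real.exp_pos _).le, ← two_mul]

/-! ### Choice of the tilting parameter -/

/-- The tilting parameter `Q + l d / n` times the spectral norm `n / d + √(n / d)` of the Gram
matrix is small compared with `d`, the range in which the exponential moments of the chaos are bounded.
Each of the four terms of the product uses one of the assumptions on the dimension. -/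
theorem mul_add_sqrt_le {n d k Q l : ℝ} (hn : 1 ≤ n) (hd : 1 ≤ d) (hk : 1 ≤ k) (hQ : 0 ≤ Q)
    (hl : 0 ≤ l) (h2 : k ^ 4 * n * Q ≤ d ^ 2) (h3 : k ^ 6 * n * Q ^ 2 ≤ d ^ 3)
    (hlog : k ^ 2 * l ^ 2 ≤ d) :
    k * ((Q + l * d / n) * (n / d + √(n / d))) ≤ 4 * d := by
  have hn0 : 0 < n := by linarith
  have hd0 : 0 < d := by linarith
  have hk0 : 0 < k := by linarith
  have hu : √(n / d) ^ 2 = n / d := Real.sq_sqrt (by positivity)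
  have hu0 : 0 < √(n / d) := Real.sqrt_pos.2 (by positivity)
  set v := √(n / d)
  have hdn : d / n = 1 / v ^ 2 := by rw [hu]; field_simp
  have e1 : k * (Q * (n / d)) ≤ d := by
    rw [mul_div_assoc', mul_div_assoc', div_le_iff₀ hd0]
    calc k * (Q * n) ≤ k ^ 4 * (Q * n) := by
          gcongr
          exact le_self_pow₀ hk (by norm_num)
      _ ≤ d * d := by linarith
  have e2 : k * l ≤ d := by
    refine (sq_le_sq₀ (by positivity) hd0.le).1 ?_
    rw [mul_pow]
    exact hlog.trans (le_self_pow₀ hd two_ne_zero)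
  have e3 : k * (Q * v) ≤ d := by
    refine (sq_le_sq₀ (by positivity) hd0.le).1 ?_
    have : k ^ 2 * n * Q ^ 2 ≤ d ^ 2 * d := by
      calc k ^ 2 * n * Q ^ 2 ≤ k ^ 6 * n * Q ^ 2 := by
            gcongr ?_ * n * Q ^ 2
            exact pow_le_pow_right₀ hk (by norm_num)
        _ ≤ d ^ 2 * d := by linarith
    calc (k * (Q * v)) ^ 2 = k ^ 2 * n * Q ^ 2 / d := by
          rw [mul_pow, mul_pow, hu]; ring
      _ ≤ d ^ 2 := by rwa [div_le_iff₀ hd0]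
  have e4 : k * (l * d / n * v) ≤ d := by
    refine (sq_le_sq₀ (by positivity) hd0.le).1 ?_
    calc (k * (l * d / n * v)) ^ 2 = (k ^ 2 * l ^ 2) * d / n := by
          rw [mul_pow, mul_pow, hu]; field_simp
      _ ≤ d * d / n := by gcongr
      _ ≤ d * d / 1 := by gcongr
      _ = d ^ 2 := by ring
  have e5 : l * d / n * (n / d) = l := by field_simp
  calc k * ((Q + l * d / n) * (n / d + v))
      = k * (Q * (n / d)) + k * (l * d / n * (n / d)) + k * (Q * v) + k * (l * d / n * v) := by
        ring
    _ ≤ 4 * d := by rw [e5]; linarith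

/-- The exponents of the truncated second moment bound, for the tilting parameter
`η = Q + l d / n`, where `l ^ 2 = log n`. In terms of `H = η n / d` all positive exponents are at
most of order `C ^ 2 H ^ 2`, while the tilt contributes `-(c / 2) H ^ 2`, and `H ≥ l`. -/
theorem exp_tilted_le {n d c C D Q β ρ l s : ℝ} (hn : 1 ≤ n) (hd : 1 ≤ d) (hC : 1 ≤ C)
    (hD : 0 < D) (hQ : 0 ≤ Q) (hl : 0 ≤ l) (hρ : 0 ≤ ρ) (hc : 4 * D + 12 + 57700 * C ^ 2 ≤ c)
    (hβ : β ^ 2 ≤ Q) (hρQ : ρ ≤ Q) (hβρ : β ^ 2 * ρ ^ 2 ≤ Q ^ 2 * d)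
    (hs : c / 2 * (Q * (n / d) ^ 2 + l * (n / d)) ≤ s) :
    Real.exp (1 / 2 * (10 * C * ρ * n / d) ^ 2 - (Q + l * d / n) * s) *
        (Real.exp (128 * (3 * (β ^ 2 / 2 + (Q + l * d / n))) ^ 2 / d * (C * (n ^ 2 / d))) +
          2 * Real.exp (128 * (3 / 2 * β) ^ 2 / d * (10 * C * ρ * n / d) ^ 2))
      ≤ 3 * Real.exp (-((2 * D + 6) * l ^ 2)) := by
  have hn0 : 0 < n := by linarith
  have hd0 : 0 < d := by linarith
  set η := Q + l * d / n with hη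
  set H := Q * (n / d) + l with hH
  have hηH : η * (n / d) = H := by rw [hη, hH]; field_simp
  have hη0 : 0 ≤ η := by positivity
  have hH0 : 0 ≤ H := by positivity
  have hQη : Q ≤ η := by rw [hη]; linarith [show 0 ≤ l * d / n by positivity]
  have hQH : Q * (n / d) ≤ H := by rw [hH]; linarith
  have hlH : l ≤ H := by rw [hH]; linarith [show 0 ≤ Q * (n / d) by positivity]
  have hC2 : C ≤ C ^ 2 := le_self_pow₀ hC two_ne_zero
  have a1 : 1 / 2 * (10 * C * ρ * n / d) ^ 2 ≤ 50 * C ^ 2 * H ^ 2 := by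
    calc 1 / 2 * (10 * C * ρ * n / d) ^ 2 = 50 * C ^ 2 * (ρ * (n / d)) ^ 2 := by ring
      _ ≤ 50 * C ^ 2 * (Q * (n / d)) ^ 2 := by gcongr
      _ ≤ 50 * C ^ 2 * H ^ 2 := by gcongr
  have a2 : 128 * (3 * (β ^ 2 / 2 + η)) ^ 2 / d * (C * (n ^ 2 / d)) ≤ 28800 * C ^ 2 * H ^ 2 := by
    calc 128 * (3 * (β ^ 2 / 2 + η)) ^ 2 / d * (C * (n ^ 2 / d))
        = 1152 * C * ((β ^ 2 / 2 + η) * (n / d)) ^ 2 := by field_simp; ring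
      _ ≤ 1152 * C * ((3 / 2 * η) * (n / d)) ^ 2 := by gcongr; linarith
      _ = 2592 * C * H ^ 2 := by rw [mul_assoc (3 / 2 : ℝ), hηH]; ring
      _ ≤ 28800 * C ^ 2 * H ^ 2 := by
          gcongr
          · norm_num
  have a3 : 128 * (3 / 2 * β) ^ 2 / d * (10 * C * ρ * n / d) ^ 2 ≤ 28800 * C ^ 2 * H ^ 2 := by
    calc 128 * (3 / 2 * β) ^ 2 / d * (10 * C * ρ * n / d) ^ 2
        = 28800 * C ^ 2 * ((β ^ 2 * ρ ^ 2) * (n / d) ^ 2 / d) := by field_simp; ring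
      _ ≤ 28800 * C ^ 2 * ((Q ^ 2 * d) * (n / d) ^ 2 / d) := by gcongr
      _ = 28800 * C ^ 2 * (Q * (n / d)) ^ 2 := by field_simp
      _ ≤ 28800 * C ^ 2 * H ^ 2 := by gcongr
  have a4 : c / 2 * H ^ 2 ≤ η * s := by
    calc c / 2 * H ^ 2 = η * (c / 2 * (Q * (n / d) ^ 2 + l * (n / d))) := by
          rw [← hηH, show Q * (n / d) ^ 2 + l * (n / d) = (Q * (n / d) + l) * (n / d) by ring,
            ← hH, ← hηH]; ring
      _ ≤ η * s := by gcongr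
  have a5 : (2 * D + 6) * l ^ 2 + 28850 * C ^ 2 * H ^ 2 ≤ c / 2 * H ^ 2 := by
    calc (2 * D + 6) * l ^ 2 + 28850 * C ^ 2 * H ^ 2
        ≤ (2 * D + 6) * H ^ 2 + 28850 * C ^ 2 * H ^ 2 := by gcongr
      _ = (2 * D + 6 + 28850 * C ^ 2) * H ^ 2 := by ring
      _ ≤ c / 2 * H ^ 2 := by gcongr; linarith
  rw [mul_add, mul_left_comm (Real.exp (_ - _)) 2, ← Real.exp_add, ← Real.exp_add]
  have b1 : Real.exp (1 / 2 * (10 * C * ρ * n / d) ^ 2 - η * s +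
      128 * (3 * (β ^ 2 / 2 + η)) ^ 2 / d * (C * (n ^ 2 / d)))
        ≤ Real.exp (-((2 * D + 6) * l ^ 2)) := Real.exp_le_exp.2 (by linarith)
  have b2 : Real.exp (1 / 2 * (10 * C * ρ * n / d) ^ 2 - η * s +
      128 * (3 / 2 * β) ^ 2 / d * (10 * C * ρ * n / d) ^ 2)
        ≤ Real.exp (-((2 * D + 6) * l ^ 2)) := Real.exp_le_exp.2 (by linarith)
  linarith

/-- The threshold for the overlap is at least the one used with the tilting parameter
`Q + l d / n`. -/
theorem le_mul_max_mul {n d c Q l : ℝ} (hn : 0 < n) (hd : 0 < d) (hc : 0 ≤ c) :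
    c / 2 * (Q * (n / d) ^ 2 + l * (n / d)) ≤ c * max (Q / d) (l / n) * (n ^ 2 / d) := by
  have h : (Q / d + l / n) / 2 ≤ max (Q / d) (l / n) := by
    linarith [le_max_left (Q / d) (l / n), le_max_right (Q / d) (l / n)]
  calc c / 2 * (Q * (n / d) ^ 2 + l * (n / d)) = c * ((Q / d + l / n) / 2) * (n ^ 2 / d) := by
        field_simp
    _ ≤ _ := by gcongr

theorem replicaLaw_overlapEvent_le_one {n d : ℕ} [NeZero d]
    {K : Set.Icc (-1 : ℝ) 1 → unitInterval} (hK : Measurable K) (s : ℝ) :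
    replicaLaw n d K (overlapEvent n d s) ≤ 1 := by
  rw [replicaLaw_overlapEvent hK]
  calc _ ≤ ∑ a, ∫⁻ x, ENNReal.ofReal (likelihood K x a) ∂(latentLaw n d) :=
        Finset.sum_le_sum fun a _ => lintegral_mono fun x =>
          mul_le_of_le_one_right' prob_le_one
    _ = ∫⁻ x, ∑ a, ENNReal.ofReal (likelihood K x a) ∂(latentLaw n d) :=
        (lintegral_finsetSum _ fun a _ => (measurable_likelihood hK a).ennreal_ofReal).symm
    _ = 1 := by
        simp_rw [← ENNReal.ofReal_sum_of_nonneg fun a _ => likelihood_nonneg K _ a,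
          sum_likelihood]
        simp

/-- The overlap bound for a kernel with linear coefficient `β` and higher-order part of size `ρ`,
in terms of a common bound `Q` for `β ^ 2` and `ρ`. -/
theorem exists_replicaLaw_overlapEvent_le {D : ℝ} (hD : 0 < D) : ∃ c : ℝ, 1 ≤ c ∧
    ∀ (n d : ℕ), 1 ≤ n → 1 ≤ d → ∀ K : Set.Icc (-1 : ℝ) 1 → unitInterval, Measurable K →
      0 < edgeDensity d K → edgeDensity d K < 1 → ∀ β ρ r Q : ℝ, 0 ≤ ρ → 0 ≤ r →
      β ^ 2 ≤ Q → ρ ≤ Q → β ^ 2 * ρ ^ 2 ≤ Q ^ 2 * d →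
      c ^ 2 * n * Q ≤ d ^ 2 → c ^ 3 * n * Q ^ 2 ≤ d ^ 3 → c * (|β| * ρ * n) ≤ d ^ 2 →
      c * Real.log n ≤ d → (2 ≤ n → c * (r ^ 2 * Real.log n) ≤ 3 * d) →
      (∀ t : Set.Icc (-1 : ℝ) 1, r * |(t : ℝ)| ≤ 1 / 2 →
        |stdKernel d K t - β * t| ≤ ρ / d + 2 * ρ * (t : ℝ) ^ 2) →
      replicaLaw n d K (overlapEvent n d
          (c * max (Q / d) ((Real.log n) ^ (1 / 2 : ℝ) / n) * (n ^ 2 / d)))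
        ≤ ENNReal.ofReal ((n : ℝ) ^ (-D)) := by
  obtain ⟨C, hC, hC'⟩ := latentLaw_not_isTypical_le (k := D + 3) (by linarith)
  set k : ℝ := 4 * D + 12 + 57700 * C ^ 2 with hk
  have hC2 : C ≤ C ^ 2 := le_self_pow₀ hC two_ne_zero
  have hk1 : 1 ≤ k := by rw [hk]; linarith
  have hkk : k ≤ k ^ 2 := le_self_pow₀ hk1 two_ne_zero
  have hk0 : 0 < k := by linarith
  refine ⟨k ^ 2, by linarith, ?_⟩
  intro n d hn hd K hK h0 h1 β ρ r Q hρ hr hβ hρQ hβρ h2 h3 hcr hlog hrl hg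
  have : NeZero d := ⟨by omega⟩
  -- for a single vertex the bound `n ^ (-D)` is one
  rcases hn.eq_or_lt with rfl | hn2
  · simpa using replicaLaw_overlapEvent_le_one hK _
  have hn2' : (2 : ℝ) ≤ n := by exact_mod_cast hn2
  have hn1 : (1 : ℝ) ≤ n := by linarith
  have hn0 : (0 : ℝ) < n := by linarith
  have hd1 : (1 : ℝ) ≤ d := by exact_mod_cast hd
  have hd0 : (0 : ℝ) < d := by linarith
  have hQ : 0 ≤ Q := hρ.trans hρQ
  have hlog0 : 0 ≤ Real.log n := Real.log_nonneg hn1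
  rw [← Real.sqrt_eq_rpow]
  set l := √(Real.log n) with hl
  have hl2 : l ^ 2 = Real.log n := Real.sq_sqrt hlog0
  have hl0 : 0 ≤ l := Real.sqrt_nonneg _
  set η := Q + l * d / n with hη
  have hη0 : 0 ≤ η := by positivity
  have hQη : Q ≤ η := by rw [hη]; linarith [show 0 ≤ l * d / n by positivity]
  set s := k ^ 2 * max (Q / d) (l / n) * ((n : ℝ) ^ 2 / d) with hs
  have hs' : k ^ 2 / 2 * (Q * ((n : ℝ) / d) ^ 2 + l * (n / d)) ≤ s :=
    le_mul_max_mul hn0 hd0 (by positivity)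
  have hrn : r * (C * √(Real.log n / d)) ≤ 1 / 2 := by
    refine (sq_le_sq₀ (by positivity) (by norm_num)).1 ?_
    rw [mul_pow, mul_pow, Real.sq_sqrt (by positivity)]
    calc r ^ 2 * (C ^ 2 * (Real.log n / d)) = C ^ 2 * (r ^ 2 * Real.log n) / d := by ring
      _ ≤ (k ^ 2 / 12) * (r ^ 2 * Real.log n) / d := by gcongr; linarith
      _ = (k ^ 2 * (r ^ 2 * Real.log n)) / (12 * d) := by field_simp
      _ ≤ 3 * d / (12 * d) := div_le_div_of_nonneg_right (hrl hn2) (by positivity)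
      _ = (1 / 2) ^ 2 := by field_simp; norm_num
  have hop : 3 * (β ^ 2 / 2 + η) * (C * ((n : ℝ) / d + √((n : ℝ) / d))) ≤ d / 32 := by
    have h := mul_add_sqrt_le hn1 hd1 hk1 hQ hl0 (by linarith) (by linarith)
      (by rw [hl2]; exact hlog)
    rw [← hη] at h
    set w := (n : ℝ) / d + √((n : ℝ) / d) with hw
    have hw0 : 0 ≤ w := by positivity
    have hkC : 576 * C ≤ k := by rw [hk]; linarith
    calc 3 * (β ^ 2 / 2 + η) * (C * w) ≤ 3 * (3 / 2 * η) * (C * w) := by gcongr; linarith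
      _ = 576 * C * (η * w) / 128 := by ring
      _ ≤ k * (η * w) / 128 := by gcongr
      _ ≤ 4 * d / 128 := by gcongr
      _ = d / 32 := by ring
  have hcross : 3 / 2 * |β| * (10 * C * ρ * n / d) ≤ d / 32 := by
    calc 3 / 2 * |β| * (10 * C * ρ * n / d) = 480 * C * (|β| * ρ * n) / (32 * d) := by
          field_simp; ring
      _ ≤ k ^ 2 * (|β| * ρ * n) / (32 * d) := by gcongr; linarith
      _ ≤ d ^ 2 / (32 * d) := by gcongr
      _ = d / 32 := by field_simp
  have htsm := truncated_second_moment_le hK h0 h1 hC hρ hr hη0 hg hrn hop hcross s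
  have hexp := exp_tilted_le hn1 hd1 hC hD hQ hl0 hρ (by rw [← hk]; exact hkk) hβ hρQ hβρ hs'
  rw [← hη] at hexp
  have hε : (0 : ℝ) < (n : ℝ) ^ (-(D + 3)) := Real.rpow_pos_of_pos hn0 _
  have hrep := replicaLaw_overlapEvent_le hK h0 h1 s (measurableSet_isTypical (n := n) (d := d) C)
    hε
  set ε := (n : ℝ) ^ (-(D + 3)) with hεdef
  have he : Real.exp (-((2 * D + 6) * l ^ 2)) = ε * ε := by
    rw [hl2, hεdef, ← Real.rpow_add hn0, Real.rpow_def_of_pos hn0]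
    congr 1; ring
  have hfin : 6 * ε ≤ (n : ℝ) ^ (-D) := by
    have h4 : (n : ℝ) ^ (-D) = n ^ 3 * ε := by
      rw [hεdef, ← Real.rpow_natCast, ← Real.rpow_add hn0]
      congr 1; push_cast; ring
    rw [h4]
    gcongr
    calc (6 : ℝ) ≤ 2 ^ 3 := by norm_num
      _ ≤ (n : ℝ) ^ 3 := by gcongr
  calc _ ≤ _ := hrep
    _ ≤ ENNReal.ofReal ε + 2 * ENNReal.ofReal ε +
        ENNReal.ofReal ε⁻¹ * ENNReal.ofReal (3 * (ε * ε)) := by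
        gcongr
        · exact hC' n d hn2
        · exact htsm.trans (ENNReal.ofReal_le_ofReal (hexp.trans_eq (by rw [he])))
    _ = ENNReal.ofReal (6 * ε) := by
        rw [← ENNReal.ofReal_mul (by positivity), ← ENNReal.ofReal_ofNat 2,
          ← ENNReal.ofReal_mul (by norm_num), ← ENNReal.ofReal_add (by positivity) (by positivity),
          ← ENNReal.ofReal_add (by positivity) (by positivity)]
        congr 1
        field_simp
        ring
    _ ≤ _ := ENNReal.ofReal_le_ofReal hfin

/-! ### Polynomial and linear kernels -/

/-- Where `r |t| ≤ 1 / 2`, the terms of degree at least two are dominated by a geometric series with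
leading term `B (r t) ^ 2`. -/
theorem abs_poly_sub_linear_le (L : ℕ) {b : ℕ → ℝ} {B r d t : ℝ} (hB : 0 ≤ B) (hr : 0 ≤ r)
    (hb : ∀ l, 1 ≤ l → |b l| ≤ B * r ^ l / √(l.factorial : ℝ)) (hb0 : |b 0| ≤ B * r ^ 2 / d)
    (ht : r * |t| ≤ 1 / 2) :
    |∑ l ∈ Finset.range (L + 2), b l * t ^ l - b 1 * t| ≤
      B * r ^ 2 / d + 2 * (B * r ^ 2) * t ^ 2 := by
  have h1 : ∑ l ∈ Finset.range (L + 2), b l * t ^ l - b 1 * t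
      = b 0 + ∑ l ∈ Finset.range L, b (l + 2) * t ^ (l + 2) := by
    rw [Finset.sum_range_succ', Finset.sum_range_succ']
    simp only [zero_add, pow_one, pow_zero, mul_one, add_assoc, one_add_one_eq_two]
    ring
  have h2 : ∀ l ∈ Finset.range L,
      |b (l + 2) * t ^ (l + 2)| ≤ B * r ^ 2 * t ^ 2 * (1 / 2) ^ l := by
    intro l _
    have h3 : |b (l + 2)| ≤ B * r ^ (l + 2) :=
      (hb _ (by omega)).trans (div_le_self (by positivity)
        (Real.one_le_sqrt.2 (by exact_mod_cast (Nat.factorial_pos _))))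
    rw [abs_mul, abs_pow]
    calc |b (l + 2)| * |t| ^ (l + 2) ≤ B * r ^ (l + 2) * |t| ^ (l + 2) := by gcongr
      _ = B * r ^ 2 * |t| ^ 2 * (r * |t|) ^ l := by ring
      _ ≤ B * r ^ 2 * |t| ^ 2 * (1 / 2) ^ l := by gcongr
      _ = _ := by rw [sq_abs]
  rw [h1]
  refine (abs_add_le _ _).trans (add_le_add hb0 ?_)
  calc _ ≤ ∑ l ∈ Finset.range L, B * r ^ 2 * t ^ 2 * (1 / 2) ^ l :=
        (Finset.abs_sum_le_sum_abs _ _).trans (Finset.sum_le_sum h2)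
    _ = B * r ^ 2 * t ^ 2 * ∑ l ∈ Finset.range L, (1 / (2 : ℝ)) ^ l := by rw [Finset.mul_sum]
    _ ≤ B * r ^ 2 * t ^ 2 * 2 := by gcongr; exact sum_geometric_two_le L
    _ = _ := by ring

/-- The kernel is an affine function of the standardized kernel. -/
theorem measurable_of_stdKernel {d : ℕ} {K : Set.Icc (-1 : ℝ) 1 → unitInterval}
    (h0 : 0 < edgeDensity d K) (h1 : edgeDensity d K < 1) (h : Measurable (stdKernel d K)) :
    Measurable K := by
  have hs : √(edgeDensity d K * (1 - edgeDensity d K)) ≠ 0 :=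
    (Real.sqrt_pos.2 (mul_pos h0 (by linarith))).ne'
  have hK : (fun t => (K t : ℝ)) = fun t =>
      stdKernel d K t * √(edgeDensity d K * (1 - edgeDensity d K)) + edgeDensity d K := by
    funext t
    unfold stdKernel
    field_simp
    ring
  refine (MeasurableEmbedding.subtype_coe measurableSet_Icc).measurable_comp_iff.1 ?_
  change Measurable fun t => (K t : ℝ)
  rw [hK]
  exact (h.mul_const _).add_const _

theorem mul_sq_le_of_mul_le {c T d : ℝ} (h : c * T ≤ d) (hc : 0 ≤ c) (hT : 0 ≤ T) :
    c ^ 2 * T ^ 2 ≤ d ^ 2 := by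
  rw [← mul_pow]; gcongr

theorem mul_cube_le_of_mul_le {c T d : ℝ} (h : c * T ≤ d) (hc : 0 ≤ c) (hT : 0 ≤ T) :
    c ^ 3 * T ^ 3 ≤ d ^ 3 := by
  rw [← mul_pow]; gcongr

theorem rpow_div_pow {x : ℝ} (hx : 0 ≤ x) (a k : ℕ) (hk : k ≠ 0) :
    (x ^ ((a : ℝ) / k)) ^ k = x ^ a := by
  rw [← Real.rpow_mul_natCast hx, div_mul_cancel₀ _ (by exact_mod_cast hk), Real.rpow_natCast]

theorem sq_mul_sq_le_rpow_cube {B : ℝ} (hB : 0 ≤ B) :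
    (B * (B + 1)) ^ 2 ≤ (B ^ (4 / 3 : ℝ) + B ^ (2 / 3 : ℝ)) ^ 3 := by
  have h1 : (B ^ (2 / 3 : ℝ)) ^ 3 = B ^ 2 := by simpa using rpow_div_pow hB 2 3 (by norm_num)
  have h2 : B ^ (4 / 3 : ℝ) = (B ^ (2 / 3 : ℝ)) ^ 2 := by
    rw [← Real.rpow_mul_natCast hB]; norm_num
  have hx : 0 ≤ B ^ (2 / 3 : ℝ) := Real.rpow_nonneg hB _
  rw [h2]
  generalize B ^ (2 / 3 : ℝ) = x at *
  -- since `B ^ 2 = x ^ 3`, expanding reduces the claim to `2 B ≤ 3 x ^ 2 + 3 x`, and `B` is the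
  -- geometric mean of `x ^ 2` and `x`
  have h3 : 2 * B ≤ x ^ 2 + x := by
    refine (sq_le_sq₀ (by positivity) (by positivity)).1 ?_
    nlinarith [sq_nonneg (x ^ 2 - x)]
  calc (B * (B + 1)) ^ 2 = B ^ 2 * (B ^ 2 + 2 * B + 1) := by ring
    _ ≤ x ^ 3 * (x ^ 3 + (3 * x ^ 2 + 3 * x) + 1) := by
        rw [h1]
        gcongr
        nlinarith
    _ = _ := by ring

theorem rpow_half_sq {x : ℝ} (hx : 0 ≤ x) : (x ^ (1 / 2 : ℝ)) ^ 2 = x := by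
  simpa using rpow_div_pow hx 1 2 (by norm_num)

theorem rpow_third_cube {x : ℝ} (hx : 0 ≤ x) : (x ^ (1 / 3 : ℝ)) ^ 3 = x := by
  simpa using rpow_div_pow hx 1 3 (by norm_num)

theorem rpow_four_thirds_cube {x : ℝ} (hx : 0 ≤ x) : (x ^ (4 / 3 : ℝ)) ^ 3 = x ^ 4 := by
  simpa using rpow_div_pow hx 4 3 (by norm_num)

theorem rpow_three_halves_sq {x : ℝ} (hx : 0 ≤ x) : (x ^ (3 / 2 : ℝ)) ^ 2 = x ^ 3 := by
  simpa using rpow_div_pow hx 3 2 (by norm_num)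

theorem le_of_rpow_half_bound {n d c B r : ℝ} (hn : 0 ≤ n) (hc : 0 ≤ c) (hB : 0 ≤ B) (hr : 0 ≤ r)
    (h : c * (n ^ (1 / 2 : ℝ) * (B + B ^ (1 / 2 : ℝ)) * r) ≤ d) :
    c ^ 2 * n * (B * (B + 1) * r ^ 2) ≤ d ^ 2 := by
  have s := mul_sq_le_of_mul_le h hc (by positivity)
  rw [mul_pow, mul_pow, rpow_half_sq hn] at s
  refine le_trans ?_ s
  have h1 : B * (B + 1) ≤ (B + B ^ (1 / 2 : ℝ)) ^ 2 := by
    rw [add_sq, rpow_half_sq hB]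
    linarith [show 0 ≤ 2 * B * B ^ (1 / 2 : ℝ) by positivity]
  calc c ^ 2 * n * (B * (B + 1) * r ^ 2) = c ^ 2 * n * r ^ 2 * (B * (B + 1)) := by ring
    _ ≤ c ^ 2 * n * r ^ 2 * (B + B ^ (1 / 2 : ℝ)) ^ 2 := by gcongr
    _ = _ := by ring

theorem le_of_rpow_third_bound {n d c B r : ℝ} (hn : 0 ≤ n) (hc : 0 ≤ c) (hB : 0 ≤ B) (hr : 0 ≤ r)
    (h : c * (n ^ (1 / 3 : ℝ) * (B ^ (4 / 3 : ℝ) + B ^ (2 / 3 : ℝ)) * r ^ (4 / 3 : ℝ)) ≤ d) :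
    c ^ 3 * n * (B * (B + 1) * r ^ 2) ^ 2 ≤ d ^ 3 := by
  have s := mul_cube_le_of_mul_le h hc (by positivity)
  rw [mul_pow, mul_pow, rpow_third_cube hn, rpow_four_thirds_cube hr] at s
  refine le_trans ?_ s
  calc c ^ 3 * n * (B * (B + 1) * r ^ 2) ^ 2
      = c ^ 3 * n * r ^ 4 * (B * (B + 1)) ^ 2 := by ring
    _ ≤ c ^ 3 * n * r ^ 4 * (B ^ (4 / 3 : ℝ) + B ^ (2 / 3 : ℝ)) ^ 3 := by
        gcongr
        exact sq_mul_sq_le_rpow_cube hB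
    _ = _ := by ring

theorem le_of_rpow_cross_bound {n d c β B r : ℝ} (hn : 0 ≤ n) (hc : 1 ≤ c) (hB : 0 ≤ B)
    (hr : 0 ≤ r) (hβ : |β| ≤ B * r)
    (h : c * (n ^ (1 / 2 : ℝ) * B * r ^ (3 / 2 : ℝ)) ≤ d) :
    c * (|β| * (B * r ^ 2) * n) ≤ d ^ 2 := by
  have s := mul_sq_le_of_mul_le h (by linarith) (by positivity)
  rw [mul_pow, mul_pow, rpow_half_sq hn, rpow_three_halves_sq hr] at s
  refine le_trans ?_ s
  calc c * (|β| * (B * r ^ 2) * n) ≤ c ^ 2 * ((B * r) * (B * r ^ 2) * n) := by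
        gcongr
        exact le_self_pow₀ hc two_ne_zero
    _ = _ := by ring

theorem log_le_three_mul_log_cube {n : ℕ} (hn : 2 ≤ n) : Real.log n ≤ 3 * Real.log n ^ 3 := by
  have h1 : 6 / 10 ≤ Real.log n := by
    have h2 : Real.log 2 ≤ Real.log n := Real.log_le_log (by norm_num) (by exact_mod_cast hn)
    linarith [Real.log_two_gt_d9]
  have h2 : 1 ≤ 3 * Real.log n ^ 2 := by nlinarith
  nlinarith

/-- A polynomial kernel satisfies the hypotheses of `exists_replicaLaw_overlapEvent_le`, with
`ρ = B r ^ 2` and `Q = B (B + 1) r ^ 2`. -/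
theorem polynomial_regime {n d : ℕ} {c B r β : ℝ} (hd : 1 ≤ d) (hc : 1 ≤ c) (hB : 0 < B)
    (hr : 0 < r) (hβ : |β| ≤ B * r)
    (hdim : c * (B ^ 2 * r ^ 2
              + (n : ℝ) ^ (1 / 2 : ℝ) * B * r ^ (3 / 2 : ℝ)
              + (n : ℝ) ^ (1 / 2 : ℝ) * (B + B ^ (1 / 2 : ℝ)) * r
              + (n : ℝ) ^ (1 / 3 : ℝ) * (B ^ (4 / 3 : ℝ) + B ^ (2 / 3 : ℝ)) * r ^ (4 / 3 : ℝ)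
              + Real.log n
              + r ^ 2 * (Real.log n) ^ 3) ≤ (d : ℝ)) :
    β ^ 2 ≤ B * (B + 1) * r ^ 2 ∧ B * r ^ 2 ≤ B * (B + 1) * r ^ 2 ∧
      β ^ 2 * (B * r ^ 2) ^ 2 ≤ (B * (B + 1) * r ^ 2) ^ 2 * d ∧
      c ^ 2 * n * (B * (B + 1) * r ^ 2) ≤ d ^ 2 ∧ c ^ 3 * n * (B * (B + 1) * r ^ 2) ^ 2 ≤ d ^ 3 ∧
      c * (|β| * (B * r ^ 2) * n) ≤ d ^ 2 ∧ c * Real.log n ≤ d ∧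
      (2 ≤ n → c * (r ^ 2 * Real.log n) ≤ 3 * d) := by
  have hc0 : 0 < c := by linarith
  have hlog : 0 ≤ Real.log n := Real.log_natCast_nonneg n
  have t1 : 0 ≤ c * (B ^ 2 * r ^ 2) := by positivity
  have t2 : 0 ≤ c * ((n : ℝ) ^ (1 / 2 : ℝ) * B * r ^ (3 / 2 : ℝ)) := by positivity
  have t3 : 0 ≤ c * ((n : ℝ) ^ (1 / 2 : ℝ) * (B + B ^ (1 / 2 : ℝ)) * r) := by positivity
  have t4 : 0 ≤ c * ((n : ℝ) ^ (1 / 3 : ℝ) * (B ^ (4 / 3 : ℝ) + B ^ (2 / 3 : ℝ))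
    * r ^ (4 / 3 : ℝ)) := by positivity
  have t5 : 0 ≤ c * Real.log n := by positivity
  have t6 : 0 ≤ c * (r ^ 2 * (Real.log n) ^ 3) := by positivity
  simp only [mul_add c] at hdim
  have hn : (0 : ℝ) ≤ n := Nat.cast_nonneg n
  have s1 : B ^ 2 * r ^ 2 ≤ d :=
    (le_mul_of_one_le_left (by positivity) hc).trans (by linarith)
  have hβ2 : β ^ 2 ≤ B ^ 2 * r ^ 2 := by
    rw [← sq_abs, ← mul_pow]; gcongr
  have hρ : 0 < B * r ^ 2 := by positivity
  refine ⟨?_, ?_, ?_, le_of_rpow_half_bound hn hc0.le hB.le hr.le (by linarith),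
    le_of_rpow_third_bound hn hc0.le hB.le hr.le (by linarith),
    le_of_rpow_cross_bound hn hc hB.le hr.le hβ (by linarith), by linarith, fun hn2 => ?_⟩
  · linarith
  · linarith [show 0 ≤ B ^ 2 * r ^ 2 by positivity]
  · have h : B * r ^ 2 ≤ B * (B + 1) * r ^ 2 := by
      linarith [show 0 ≤ B ^ 2 * r ^ 2 by positivity]
    calc β ^ 2 * (B * r ^ 2) ^ 2 ≤ d * (B * (B + 1) * r ^ 2) ^ 2 :=
          mul_le_mul (hβ2.trans s1) (pow_le_pow_left₀ hρ.le h 2) (by positivity) (by positivity)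
      _ = _ := mul_comm _ _
  · calc c * (r ^ 2 * Real.log n) ≤ c * (r ^ 2 * (3 * Real.log n ^ 3)) := by
          gcongr
          exact log_le_three_mul_log_cube hn2
      _ = 3 * (c * (r ^ 2 * Real.log n ^ 3)) := by ring
      _ ≤ 3 * d := by linarith

/-- A linear kernel satisfies the hypotheses of `exists_replicaLaw_overlapEvent_le`, with `ρ = 0`
and `Q = b ^ 2`. -/
theorem linear_regime {n : ℕ} {d c b : ℝ} (hc : 0 ≤ c)
    (hdim : c * ((n : ℝ) ^ (1 / 2 : ℝ) * |b| + (n : ℝ) ^ (1 / 3 : ℝ) * |b| ^ (4 / 3 : ℝ)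
              + Real.log n) ≤ d) :
    c ^ 2 * n * b ^ 2 ≤ d ^ 2 ∧ c ^ 3 * n * (b ^ 2) ^ 2 ≤ d ^ 3 ∧ c * Real.log n ≤ d := by
  have hn : (0 : ℝ) ≤ n := Nat.cast_nonneg n
  have hlog : 0 ≤ Real.log n := Real.log_natCast_nonneg n
  have t1 : 0 ≤ c * ((n : ℝ) ^ (1 / 2 : ℝ) * |b|) := by positivity
  have t2 : 0 ≤ c * ((n : ℝ) ^ (1 / 3 : ℝ) * |b| ^ (4 / 3 : ℝ)) := by positivity
  have t3 : 0 ≤ c * Real.log n := by positivity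
  simp only [mul_add c] at hdim
  have s1 := mul_sq_le_of_mul_le (c := c) (d := d)
    (T := (n : ℝ) ^ (1 / 2 : ℝ) * |b|) (by linarith) hc (by positivity)
  have s2 := mul_cube_le_of_mul_le (c := c) (d := d)
    (T := (n : ℝ) ^ (1 / 3 : ℝ) * |b| ^ (4 / 3 : ℝ)) (by linarith) hc (by positivity)
  rw [mul_pow, rpow_half_sq hn, sq_abs] at s1
  rw [mul_pow, rpow_third_cube hn, rpow_four_thirds_cube (abs_nonneg b),
    show |b| ^ 4 = (|b| ^ 2) ^ 2 by ring, sq_abs] at s2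
  exact ⟨by linarith, by linarith, by linarith⟩

/-- Coefficients up to degree `L` extended by zero, so that the degree is at least one. -/
theorem exists_coeff_extension {L : ℕ} {b : ℕ → ℝ} {B r : ℝ} (hB : 0 < B) (hr : 0 < r)
    (hb : ∀ l : ℕ, 1 ≤ l → l ≤ L → |b l| ≤ B * r ^ l / √(l.factorial : ℝ)) :
    ∃ a : ℕ → ℝ, a 0 = b 0 ∧ (∀ l, 1 ≤ l → |a l| ≤ B * r ^ l / √(l.factorial : ℝ)) ∧
      ∀ t : ℝ, ∑ l ∈ Finset.range (L + 1), b l * t ^ l =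
        ∑ l ∈ Finset.range (L + 2), a l * t ^ l := by
  refine ⟨fun l => if l ≤ L then b l else 0, by simp, fun l hl => ?_, fun t => ?_⟩
  · by_cases h : l ≤ L
    · simpa [h] using hb l hl h
    · simp only [h, if_false, abs_zero]; positivity
  · rw [Finset.sum_range_succ _ (L + 1)]
    simp only [Nat.not_succ_le_self, if_false, zero_mul, add_zero]
    refine Finset.sum_congr rfl fun l hl => ?_
    rw [if_pos (Nat.lt_succ_iff.1 (Finset.mem_range.1 hl))]

end RGG

theorem mainTheorem7 (D : ℝ) (hD : 0 < D) :
    ∃ C : ℝ, 0 < C ∧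
      ∀ (n d : ℕ), 1 ≤ n → 1 ≤ d →
      ∀ K : Set.Icc (-1 : ℝ) 1 → unitInterval,
        0 < RGG.edgeDensity d K → RGG.edgeDensity d K < 1 →
        -- polynomial kernels
        (∀ (L : ℕ) (b : ℕ → ℝ) (B r : ℝ), 0 < B → 0 < r →
          (∀ t : Set.Icc (-1 : ℝ) 1,
            RGG.stdKernel d K t = ∑ l ∈ Finset.range (L + 1), b l * (t : ℝ) ^ l) →
          (∀ l : ℕ, 1 ≤ l → l ≤ L → |b l| ≤ B * r ^ l / Real.sqrt (l.factorial : ℝ)) →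
          |b 0| ≤ B * r ^ 2 / (d : ℝ) →
          C * (B ^ 2 * r ^ 2
              + (n : ℝ) ^ (1 / 2 : ℝ) * B * r ^ (3 / 2 : ℝ)
              + (n : ℝ) ^ (1 / 2 : ℝ) * (B + B ^ (1 / 2 : ℝ)) * r
              + (n : ℝ) ^ (1 / 3 : ℝ) * (B ^ (4 / 3 : ℝ) + B ^ (2 / 3 : ℝ)) * r ^ (4 / 3 : ℝ)
              + Real.log n
              + r ^ 2 * (Real.log n) ^ 3) ≤ (d : ℝ) →
          RGG.replicaLaw n d K
              (RGG.overlapEvent n d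
                (C * max (B * (B + 1) * r ^ 2 / (d : ℝ)) ((Real.log n) ^ (1 / 2 : ℝ) / (n : ℝ))
                  * ((n : ℝ) ^ 2 / (d : ℝ))))
            ≤ ENNReal.ofReal ((n : ℝ) ^ (-D)))
        ∧
        -- linear kernels
        (∀ b₁ : ℝ,
          (∀ t : Set.Icc (-1 : ℝ) 1, RGG.stdKernel d K t = b₁ * (t : ℝ)) →
          C * ((n : ℝ) ^ (1 / 2 : ℝ) * |b₁|
              + (n : ℝ) ^ (1 / 3 : ℝ) * |b₁| ^ (4 / 3 : ℝ)
              + Real.log n) ≤ (d : ℝ) →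
          RGG.replicaLaw n d K
              (RGG.overlapEvent n d
                (C * max (b₁ ^ 2 / (d : ℝ)) ((Real.log n) ^ (1 / 2 : ℝ) / (n : ℝ))
                  * ((n : ℝ) ^ 2 / (d : ℝ))))
            ≤ ENNReal.ofReal ((n : ℝ) ^ (-D))) := by
  obtain ⟨c, hc, H⟩ := RGG.exists_replicaLaw_overlapEvent_le hD
  have hc0 : 0 < c := by linarith
  refine ⟨c, hc0, fun n d hn hd K h0 h1 => ⟨?_, ?_⟩⟩
  · intro L b B r hB hr hκ hb hb0 hdim
    obtain ⟨a, ha0, ha, hab⟩ := RGG.exists_coeff_extension hB hr hb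
    simp only [hab] at hκ
    have hK : Measurable K := by
      refine RGG.measurable_of_stdKernel h0 h1 ?_
      rw [show RGG.stdKernel d K = _ from funext hκ]
      exact Finset.measurable_fun_sum _ fun l _ =>
        (measurable_subtype_coe.pow_const l).const_mul (a l)
    have hβ : |a 1| ≤ B * r := by simpa using ha 1 le_rfl
    obtain ⟨e1, e2, e3, e4, e5, e6, e7, e8⟩ := RGG.polynomial_regime hd hc hB hr hβ hdim
    refine H n d hn hd K hK h0 h1 (a 1) (B * r ^ 2) r (B * (B + 1) * r ^ 2) (by positivity)
      hr.le e1 e2 e3 e4 e5 e6 e7 e8 fun t ht => ?_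
    rw [hκ t]
    exact RGG.abs_poly_sub_linear_le L hB.le hr.le ha (ha0 ▸ hb0) ht
  · intro b hκ hdim
    have hK : Measurable K := by
      refine RGG.measurable_of_stdKernel h0 h1 ?_
      rw [show RGG.stdKernel d K = _ from funext hκ]
      exact measurable_subtype_coe.const_mul b
    obtain ⟨e1, e2, e3⟩ := RGG.linear_regime hc0.le hdim
    refine H n d hn hd K hK h0 h1 b 0 0 (b ^ 2) le_rfl le_rfl le_rfl (sq_nonneg b)
      ?_ e1 e2 ?_ e3 (fun _ => ?_) (fun t _ => ?_)
    · rw [zero_pow two_ne_zero, mul_zero]; positivity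
    · rw [mul_zero, zero_mul, mul_zero]; positivity
    · rw [zero_pow two_ne_zero, zero_mul, mul_zero]; positivity
    · simp [hκ t]
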